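/- **Conventions.** A hard pulse is $\Omega(t)=\sum_{j\in\mathbb Z}\omega_j\,\delta(t-j\Delta)$ with $\omega_j\in\mathbb C$, $\sum_j|\omega_j|<\infty$ and $|\omega_j|<\pi$ for all $j$. For $w\in S^1\subset\mathbb C$ let $P_w$ be the rotation of $\mathbb R^3$ about the $z$-axis by $\arg w$, and for $\omega\in\mathbb C$ let $R_\omega$ be the (right-handed) rotation by the angle $|\omega|$ about the axis $(\mathrm{Re}\,\omega,\mathrm{Im}\,\omega,0)$. For $\mathbf M:S^1\to S^2$ write $\mathcal T^{\mathrm{disc}}\Omega=\mathbf M$ if for every $w\in S^1$ there is a sequence $M_-(w;j)$, $j\in\mathbb Z$, with $M_-(w;j+1)=P_wR_{\omega_j}M_-(w;j)$, $\lim_{j\to-\infty}M_-(w;j)=(0,0,1)$ and $\lim_{j\to+\infty}P_w^{-j}M_-(w;j)=\mathbf M(w)$. Put $\mu_j=-\tfrac i2\overline{\omega_j}$, and let $(A_{\pm,j},B_{\pm,j})$ be the solutions on $S^1$ of $$A_{j+1}=\cos|\mu_j|\,A_j+\tfrac{\mu_j}{|\mu_j|}\sin|\mu_j|\,B_j,\qquad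 B_{j+1}=w\Bigl(-\tfrac{\overline{\mu_j}}{|\mu_j|}\sin|\mu_j|\,A_j+\cos|\mu_j|\,B_j\Bigr)$$ that tend to $(1,0)$ as $j\to\pm\infty$, respectively. The functions $A_{-,j},B_{-,j}$ and $A_{+,j}^*:=\overline{A_{+,j}},\ B_{+,j}^*:=\overline{B_{+,j}}$ extend continuously to the closed unit disk and analytically to the open disk $\mathbb D$; the same letters denote the extensions. Put $a=A_{+,j}^*A_{-,j}+B_{+,j}^*B_{-,j}$ (independent of $j$). *Discrete bound state data* consist of a finite set of energies $w_1,\dots,w_m\in\mathbb D\setminus\{0\}$ (distinct, $m\ge0$) with multiplicities $d_k\ge1$ and norming polynomials $c_k'$ of degree less than $d_k$ with $c_k'(w_k)\ne0$ (in the generic case $d_k=1$ these are nonzero norming constants). They are *the bound state data of* $\Omega$ if the zeros of $a$ in $\mathbb D$ are exactly the $w_k$, with multiplicities $d_k$, and $$A_{-,j}\equiv-c_k'\,w^jB_{+,j}^*,\qquad B_{-,j}\equiv c_k'\,w^jA_{+,j}^*\pmod{(w-w_k)^{d_k}}\qquad\text{for all }k\text{ and all }j\in\mathbb Z.$$ **Theorem.**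 Let $\mathbf M=(\mathbf M_x,\mathbf M_y,\mathbf M_z):S^1\to S^2$ be a periodic magnetization profile with $\mathbf M_z\ne-1$ everywhere, and suppose that its reflection coefficient $r=\frac{\mathbf M_x+i\mathbf M_y}{1+\mathbf M_z}$ is in $H^1(S^1)$, that is, $r$ is continuous and has a weak derivative in $L^2(S^1)$. (a) There are infinitely many hard pulses $\Omega$ with $\mathcal T^{\mathrm{disc}}\Omega=\mathbf M$. They are parameterized by their bound state data: every $\Omega$ with $\mathcal T^{\mathrm{disc}}\Omega=\mathbf M$ has exactly one set of bound state data, and for all discrete bound state data $D$ there is exactly one hard pulse $\Omega$ with $\mathcal T^{\mathrm{disc}}\Omega=\mathbf M$ whose bound state data are $D$. (b) Let $\rho\in\mathbb Z$. If $r(w)=w^{-\rho}r_0(w)$ on $S^1$, where $r_0$ extends to a meromorphic function on $\mathbb D$ with continuous boundary values $r_0$ on $S^1$, and this extension vanishes at the origin, then there is a hard pulse $\Omega$ with $\mathcal T^{\mathrm{disc}}\Omega=\mathbf M$ and $\rho$ rephasing time steps, that is, $\omega_j=0$ for all $j\ge\rho$. (c) Let $\rho\in\mathbb Z$ and $T\in\mathbb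 N$, and suppose $r(w)=w^{-\rho}\frac{B(w)}{A(w)}$ on $S^1$, where $A$ and $B$ are polynomials with $|A(w)|^2+|B(w)|^2=1$ for all $w\in S^1$. If $A$ and $B$ have degree at most $T$ and $B/A$ vanishes at the origin, then there is a hard pulse $\Omega$ with $\mathcal T^{\mathrm{disc}}\Omega=\mathbf M$, duration $T$ and $\rho$ rephasing time steps, that is, $\omega_j=0$ unless $\rho-T\le j<\rho$. If $A$ and $B$ have degree exactly $T$ (and no condition is imposed at the origin), then there is a hard pulse $\Omega$ with $\mathcal T^{\mathrm{disc}}\Omega=\mathbf M$ that is supported in the closed interval of time steps $\rho-T\le j\le\rho$. -/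

import Mathlib

noncomputable section

open Filter Topology MeasureTheory Metric
open scoped ComplexConjugate Matrix

namespace HardPulse

/-- The reflection coefficient `(M_x + i M_y) / (1 + M_z)` of a magnetization profile. -/
def reflectionCoeff (M : Circle → sphere (0 : EuclideanSpace ℝ (Fin 3)) 1) (w : Circle) : ℂ :=
  (((M w).1 0 : ℝ) + ((M w).1 1 : ℝ) * Complex.I) / (1 + ((M w).1 2 : ℝ))

/-- The Sobolev space `H¹(S¹)`, every class being represented by its continuous member:
continuous functions on the circle that have a weak derivative (with respect to the angle)
in `L²`, tested against smooth `2π`-periodic functions. -/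
def MemH1 (f : Circle → ℂ) : Prop :=
  Continuous f ∧
    ∃ g : Circle → ℂ,
      MemLp (fun θ : ℝ => g (Circle.exp θ)) 2 (volume.restrict (Set.Ioc 0 (2 * Real.pi))) ∧
      ∀ φ : ℝ → ℂ, ContDiff ℝ ((⊤ : ℕ∞) : WithTop ℕ∞) φ → Function.Periodic φ (2 * Real.pi) →
        (∫ θ in (0 : ℝ)..(2 * Real.pi), f (Circle.exp θ) * deriv φ θ) +
          (∫ θ in (0 : ℝ)..(2 * Real.pi), g (Circle.exp θ) * φ θ) = 0

/-- Free precession: with `w = e^{iΔz}`, the rotation by `Δz` about the `z`-axis. -/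
def precession (w : Circle) : Matrix (Fin 3) (Fin 3) ℝ :=
  !![(w : ℂ).re, -(w : ℂ).im, 0;
     (w : ℂ).im, (w : ℂ).re, 0;
     0, 0, 1]

/-- The unit vector `(Re ω, Im ω, 0) / |ω|` (zero if `ω = 0`). -/
def axis (ω : ℂ) : Fin 3 → ℝ := ![ω.re / ‖ω‖, ω.im / ‖ω‖, 0]

/-- The rotation by the angle `|ω|` about the axis `(Re ω, Im ω, 0)`, by Rodrigues' formula. -/
def rotation (ω : ℂ) (v : Fin 3 → ℝ) : Fin 3 → ℝ :=
  Real.cos ‖ω‖ • v + Real.sin ‖ω‖ • (axis ω ⨯₃ v) +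
    ((1 - Real.cos ‖ω‖) * (axis ω ⬝ᵥ v)) • axis ω

/-- `TransformsTo ω M`: the discrete selective excitation transform of the hard pulse
`∑ ω_j δ(t - jΔ)` exists and equals `M`.  Here `m w j` is the magnetization `M_-(w; j)`,
at equilibrium for `j → -∞`, and `precession (w ^ (-j))` is the `(-j)`-th power of
`precession w`. -/
def TransformsTo (ω : ℤ → ℂ) (M : Circle → sphere (0 : EuclideanSpace ℝ (Fin 3)) 1) : Prop :=
  ∃ m : Circle → ℤ → (Fin 3 → ℝ),
    (∀ w j, m w (j + 1) = precession w *ᵥ rotation (ω j) (m w j)) ∧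
    (∀ w, Tendsto (m w) atBot (𝓝 ![0, 0, 1])) ∧
    (∀ w, Tendsto (fun j : ℤ => precession (w ^ (-j)) *ᵥ m w j) atTop (𝓝 (M w).1.ofLp))

/-- The hard pulses of the scattering theory: absolutely summable sequences, normalized by
`|ω_j| < π`.  (The rotation only determines `ω_j` up to full turns; `|ω_j| < π` is the range of `ω_j = 2 arctan |γ_j|` times a phase.) -/
structure IsHardPulse (ω : ℤ → ℂ) : Prop where
  summable : Summable fun j => ‖ω j‖
  norm_lt : ∀ j, ‖ω j‖ < Real.pi

/-- The coefficients `μ_j = -(i/2) ω_j^*` of the Zakharov-Shabat potential of a hard pulse. -/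
def potential (ω : ℤ → ℂ) (j : ℤ) : ℂ := -(Complex.I / 2) * conj (ω j)

/-- One step `(A, B) ↦ (A', B')` of the discrete Zakharov-Shabat recursion, written for the
functions `A_j`, `B_j`, that is, for the solution vector multiplied by `w^{j/2}`. -/
def ZSStep (μ w A B A' B' : ℂ) : Prop :=
  A' = Real.cos ‖μ‖ * A + μ / ‖μ‖ * Real.sin ‖μ‖ * B ∧
  B' = w * (-(conj μ / ‖μ‖ * Real.sin ‖μ‖) * A + Real.cos ‖μ‖ * B)

/-- `A j`, `B j` are the analytic extensions to the unit disk of `A_{-,j}`, `B_{-,j}`,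
where `(A_{-,j}, B_{-,j})` is the solution on the circle that tends to `(1, 0)` at `-∞`. -/
structure IsLeftJost (ω : ℤ → ℂ) (A B : ℤ → ℂ → ℂ) : Prop where
  analytic_A : ∀ j, DiffContOnCl ℂ (A j) (ball 0 1)
  analytic_B : ∀ j, DiffContOnCl ℂ (B j) (ball 0 1)
  step : ∀ (j : ℤ) (w : Circle),
    ZSStep (potential ω j) w (A j w) (B j w) (A (j + 1) w) (B (j + 1) w)
  tendsto_A : ∀ w : Circle, Tendsto (fun j => A j w) atBot (𝓝 1)
  tendsto_B : ∀ w : Circle, Tendsto (fun j => B j w) atBot (𝓝 0)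

/-- `A j`, `B j` are the analytic extensions to the unit disk of the complex conjugates
`A_{+,j}^*`, `B_{+,j}^*`, where `(A_{+,j}, B_{+,j})` is the solution on the circle that tends
to `(1, 0)` at `+∞`. -/
structure IsRightJostConj (ω : ℤ → ℂ) (A B : ℤ → ℂ → ℂ) : Prop where
  analytic_A : ∀ j, DiffContOnCl ℂ (A j) (ball 0 1)
  analytic_B : ∀ j, DiffContOnCl ℂ (B j) (ball 0 1)
  step : ∀ (j : ℤ) (w : Circle),
    ZSStep (potential ω j) w (conj (A j w)) (conj (B j w))
      (conj (A (j + 1) w)) (conj (B (j + 1) w))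
  tendsto_A : ∀ w : Circle, Tendsto (fun j => A j w) atTop (𝓝 1)
  tendsto_B : ∀ w : Circle, Tendsto (fun j => B j w) atTop (𝓝 0)

/-- Discrete bound state data: finitely many energies in the punctured unit disk (the support
of `mult`), each with a multiplicity `d ≥ 1` and a norming polynomial of degree less than `d`
that does not vanish at the energy.  If all multiplicities are `1`, these are distinct
energies `w_1, …, w_m` with nonzero norming constants `c'_1, …, c'_m`. -/
structure BoundStateData where
  mult : ℂ →₀ ℕ
  norming : ℂ → Polynomial ℂ
  mem_disk : ∀ z ∈ mult.support, z ≠ 0 ∧ ‖z‖ < 1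
  degree_lt : ∀ z, (norming z).degree < (mult z : WithBot ℕ)
  eval_ne_zero : ∀ z ∈ mult.support, (norming z).eval z ≠ 0

/-- `D` is the bound state data of the hard pulse `ω`: the energies are the zeros in the unit
disk of `a = A_{+}^* A_{-} + B_{+}^* B_{-}`, with their multiplicities, and at an energy `z`
of multiplicity `d` with norming polynomial `c'` one has, for all `j`,
`(A_{-,j}, B_{-,j}) ≡ c' w^j (-B_{+,j}^*, A_{+,j}^*)` modulo `(w - z)^d`. -/
def HasBoundStateData (ω : ℤ → ℂ) (D : BoundStateData) : Prop :=
  ∃ Am Bm Ap Bp : ℤ → ℂ → ℂ,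
    IsLeftJost ω Am Bm ∧ IsRightJostConj ω Ap Bp ∧
    (∀ z ∈ ball (0 : ℂ) 1,
      analyticOrderAt (fun w => Ap 0 w * Am 0 w + Bp 0 w * Bm 0 w) z = (D.mult z : ℕ∞)) ∧
    (∀ z ∈ ball (0 : ℂ) 1, ∀ j : ℤ,
      (D.mult z : ℕ∞) ≤
        analyticOrderAt (fun w => Am j w + (D.norming z).eval w * w ^ j * Bp j w) z ∧
      (D.mult z : ℕ∞) ≤
        analyticOrderAt (fun w => Bm j w - (D.norming z).eval w * w ^ j * Ap j w) z)

end HardPulse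

end

noncomputable section

open Filter Topology MeasureTheory Metric
open scoped ComplexConjugate Matrix

namespace HardPulse

/-! ### The disk algebra -/

/-! Write (h, k) for the extended right Jost functions (A_+^*, B_+^*) and (U, V) for the left ones
(A_-, B_-). Magnetizations are images of spinors, so excitation is scattering for a product of
unitary transfer matrices. On the circle U = a conj h - b w^j k and V = a conj k + b w^j h, the
final magnetization is the image of the spinor (a, b), and stereographic projection turns the
condition that the transform be M into b = r a (`Jost.transformsTo_iff`). The function a is then
known: |a|^2 (1 + |r|^2) = 1 on the circle, a is positive at the origin, and its zeros are the
energies, so a is a Blaschke product times the exponential of the analytic completion of -(1/2)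
log(1 + |r|^2) (`exists_transmission`, `transmission_unique`). A single polynomial E with E(0) = 0
interpolates all norming polynomials to the required orders, and the bound state congruences say
that a divides U + E w^j k and V - E w^j h. At each fixed time this gives a Riemann-Hilbert problem
in the disk algebra (`Sol`; with unit norm and h(0) > 0, `NSol`).

Uniqueness at a fixed time rests on one identity: h U + k V is divisible by a, and the quotient has
the real boundary values |h|^2 + |k|^2, hence is constant (`Sol.exists_const`). A real combination
of two normalized solutions whose U-part vanishes at the origin therefore vanishes
(`NSol.ext_circle`). For existence, divide by a: with F = r - E/a, both conj h - F w^j k and conj k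
+ F w^j h must be analytic. Comparing nonpositive frequencies gives a Hankel system, which is a
contraction on l^1 at late times because F is in H^1 and has summable Fourier coefficients
(`ScatData.exists_sol`). Other times are reached by layer stripping: the rotation with tangent
k(0)/h(0) removes the value of k at the origin and permits division by w (`NSol.next`). Steps back
use a time reversal that exchanges left and right, replaces r by -conj(r) conj(a)/a, and replaces E
by a polynomial E' with E E' = -1 modulo a (`NSol.dual`).

The parameters k_j(0)/h_j(0) are summable: h_j(0) and k_j(0) are averages against F, and the squared
tails of its coefficients are summable over j (`NSol.bounds`); time reversal treats the other end.
They thus define a hard pulse. Its Jost functions are the given solutions, because L^2 distances are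
conserved and tend to zero at the ends (`jost_of_nsol`). Conversely the Jost functions of any pulse
with the same data solve the same problem, and its strengths are read off at the origin. This proves
(a); infinitude follows by moving one energy.

For (b) and (c) explicit solutions are inserted. At time ρ take the right solution (1, 0) and the
left solution (a, a r_0), where the zeros of a cancel the poles of r_0; for polynomials this is (A,
B). At time ρ - T the left solution is (1, 0) and the right one consists of A and minus the reversed
conjugate of B. A trivial right solution means that the pulse has ended, a trivial left one that it
has not begun. -/

/-- Membership in the disk algebra. -/
abbrev DA (f : ℂ → ℂ) : Prop := DiffContOnCl ℂ f (ball 0 1)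

theorem closure_unitBall : closure (ball (0 : ℂ) 1) = closedBall 0 1 :=
  closure_ball _ one_ne_zero

theorem frontier_unitBall : frontier (ball (0 : ℂ) 1) = sphere 0 1 :=
  frontier_ball _ one_ne_zero

theorem circle_mem_closedBall (w : Circle) : (w : ℂ) ∈ closedBall (0 : ℂ) 1 :=
  mem_closedBall_zero_iff.2 w.norm_coe.le

theorem continuous_circle_coe : Continuous fun w : Circle => (w : ℂ) := continuous_subtype_val

theorem ball_mem_closedBall {z : ℂ} (hz : z ∈ ball (0 : ℂ) 1) : z ∈ closedBall (0 : ℂ) 1 :=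
  ball_subset_closedBall hz

theorem zero_mem_unitBall : (0 : ℂ) ∈ ball (0 : ℂ) 1 := by simp

theorem zero_mem_unitClosedBall : (0 : ℂ) ∈ closedBall (0 : ℂ) 1 := by simp

theorem exists_circle_of_norm_eq_one {z : ℂ} (hz : ‖z‖ = 1) : ∃ w : Circle, (w : ℂ) = z :=
  ⟨⟨z, by simpa [Submonoid.unitSphere] using hz⟩, rfl⟩

theorem mem_ball_or_circle {z : ℂ} (hz : z ∈ closedBall (0 : ℂ) 1) :
    z ∈ ball (0 : ℂ) 1 ∨ ∃ w : Circle, (w : ℂ) = z := by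
  rcases (mem_closedBall_zero_iff.1 hz).lt_or_eq with h | h
  · exact Or.inl (mem_ball_zero_iff.2 h)
  · exact Or.inr (exists_circle_of_norm_eq_one h)

namespace DA

variable {f g : ℂ → ℂ}

theorem mul (hf : DA f) (hg : DA g) : DA (fun z => f z * g z) := hf.smul hg

theorem add' (hf : DA f) (hg : DA g) : DA (fun z => f z + g z) := hf.add hg

theorem sub' (hf : DA f) (hg : DA g) : DA (fun z => f z - g z) := hf.sub hg

theorem const (c : ℂ) : DA (fun _ => c) := diffContOnCl_const

theorem id' : DA (fun z => z) := differentiable_id.diffContOnCl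

theorem pow' (n : ℕ) : DA (fun z => z ^ n) := (differentiable_id.pow n).diffContOnCl

theorem const_mul (hf : DA f) (c : ℂ) : DA (fun z => c * f z) := (const c).mul hf

theorem poly (p : Polynomial ℂ) : DA (fun z => p.eval z) := p.differentiable.diffContOnCl

theorem analyticAt (hf : DA f) {z : ℂ} (hz : z ∈ ball (0 : ℂ) 1) : AnalyticAt ℂ f z :=
  hf.differentiableOn.analyticAt (isOpen_ball.mem_nhds hz)

theorem continuousOn' (hf : DA f) : ContinuousOn f (closedBall 0 1) := by
  have := hf.continuousOn
  rwa [closure_unitBall] at this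

theorem continuous_circle (hf : DA f) : Continuous fun w : Circle => f w :=
  hf.continuousOn'.comp_continuous continuous_circle_coe circle_mem_closedBall

theorem eq_of_circle (hf : DA f) (hg : DA g) (h : ∀ w : Circle, f w = g w) {z : ℂ}
    (hz : z ∈ closedBall (0 : ℂ) 1) : f z = g z := by
  have : Set.EqOn f g (closure (ball 0 1)) := by
    refine Complex.eqOn_closure_of_eqOn_frontier isBounded_ball hf hg ?_
    rw [frontier_unitBall]
    intro x hx
    obtain ⟨w, rfl⟩ := exists_circle_of_norm_eq_one (mem_sphere_zero_iff_norm.1 hx)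
    exact h w
  exact this (by rwa [closure_unitBall])

theorem norm_le_of_circle (hf : DA f) {C : ℝ} (h : ∀ w : Circle, ‖f w‖ ≤ C) {z : ℂ}
    (hz : z ∈ closedBall (0 : ℂ) 1) : ‖f z‖ ≤ C := by
  refine Complex.norm_le_of_forall_mem_frontier_norm_le isBounded_ball hf ?_
    (by rwa [closure_unitBall])
  rw [frontier_unitBall]
  intro x hx
  obtain ⟨w, rfl⟩ := exists_circle_of_norm_eq_one (mem_sphere_zero_iff_norm.1 hx)
  exact h w

/-- A zero-free function in the disk algebra with unimodular boundary values is constant. -/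
theorem eq_of_norm_eq_one (hf : DA f) (h0 : ∀ z ∈ closedBall (0 : ℂ) 1, f z ≠ 0)
    (h : ∀ w : Circle, ‖f w‖ = 1) {z : ℂ} (hz : z ∈ closedBall (0 : ℂ) 1) : f z = f 0 := by
  have h1 : ∀ z ∈ closedBall (0 : ℂ) 1, ‖f z‖ ≤ 1 := fun z hz =>
    hf.norm_le_of_circle (fun w => (h w).le) hz
  -- The maximum principle for 1/f gives the lower bound, so |f| attains its maximum at the interior
  -- point 0.
  have hinv : DA f⁻¹ := hf.inv (by rwa [closure_unitBall])
  have h2 : ∀ z ∈ closedBall (0 : ℂ) 1, 1 ≤ ‖f z‖ := fun z hz => by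
    have := hinv.norm_le_of_circle (C := 1) (fun w => by simp [h w]) hz
    rw [Pi.inv_apply, norm_inv] at this
    have hp : 0 < ‖f z‖ := norm_pos_iff.2 (h0 z hz)
    exact (inv_le_one₀ hp).1 this
  have := Complex.eqOn_closedBall_of_isMaxOn_norm hf (z := 0) (r := 1) fun x hx => by
    simp only [Set.mem_ofPred_eq, Function.comp]
    exact (h1 x (ball_mem_closedBall hx)).trans (h2 0 zero_mem_unitClosedBall)
  exact this hz

/-- A function in the disk algebra with real boundary values is constant. -/
theorem eq_of_real (hf : DA f) (h : ∀ w : Circle, (f w).im = 0) {z : ℂ}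
    (hz : z ∈ closedBall (0 : ℂ) 1) : f z = f 0 := by
  -- For imaginary c the function exp(c f) is zero-free and unimodular on the circle.
  have key : ∀ c : ℂ, c.re = 0 → ∀ z ∈ closedBall (0 : ℂ) 1,
      Complex.exp (c * f z) = Complex.exp (c * f 0) := by
    intro c hc z hz
    have hd : DA (fun z => Complex.exp (c * f z)) :=
      Complex.differentiable_exp.comp_diffContOnCl (hf.const_mul c)
    refine hd.eq_of_norm_eq_one (fun _ _ => Complex.exp_ne_zero _) (fun w => ?_) hz
    simp [Complex.norm_exp, h w, hc]
  by_contra hne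
  set d := f z - f 0 with hd
  have hd0 : d ≠ 0 := sub_ne_zero.2 hne
  have e1 : ∀ c : ℂ, c.re = 0 → Complex.exp (c * d) = 1 := by
    intro c hc
    rw [hd, mul_sub, Complex.exp_sub, key c hc z hz, div_self (Complex.exp_ne_zero _)]
  -- Equality of all these exponentials only fixes d up to periods for each t; differentiating at t
  -- = 0 gives d = 0.
  have hre : ∀ t : ℝ, Complex.exp ((t : ℂ) * Complex.I * d) = 1 := fun t => e1 _ (by simp)
  have hder : HasDerivAt (fun t : ℝ => Complex.exp ((t : ℂ) * Complex.I * d))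
      (Complex.exp (((0 : ℝ) : ℂ) * Complex.I * d) * (1 * Complex.I * d)) 0 :=
    (((Complex.ofRealCLM.hasDerivAt (x := (0 : ℝ))).mul_const Complex.I).mul_const d).cexp
  have hc : (fun t : ℝ => Complex.exp ((t : ℂ) * Complex.I * d)) = fun _ => 1 := funext hre
  rw [hc] at hder
  have := hder.unique (hasDerivAt_const (0 : ℝ) (1 : ℂ))
  simp [hd0] at this

/-- If f vanishes at the origin, `dslope f 0` is f(z)/z; this is how a factor w is stripped off in
the time steps. -/
theorem dslope_zero (hf : DA f) : DA (dslope f 0) := by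
  refine ⟨(Complex.differentiableOn_dslope (isOpen_ball.mem_nhds zero_mem_unitBall)).2
    hf.differentiableOn, ?_⟩
  have hn : closure (ball (0 : ℂ) 1) ∈ 𝓝 (0 : ℂ) :=
    mem_of_superset (isOpen_ball.mem_nhds zero_mem_unitBall) subset_closure
  exact (continuousOn_dslope hn).2 ⟨hf.continuousOn, (hf.analyticAt zero_mem_unitBall).differentiableAt⟩

end DA

theorem mul_dslope_zero {f : ℂ → ℂ} (h0 : f 0 = 0) (z : ℂ) : z * dslope f 0 z = f z := by
  have := sub_smul_dslope f 0 z
  simpa [h0] using this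

/-! ### Divisibility in the punctured disk -/

/-- `a` divides `f` in the punctured unit disk, expressed by orders of vanishing. -/
def DiskDvd (a f : ℂ → ℂ) : Prop :=
  ∀ z ∈ ball (0 : ℂ) 1, z ≠ 0 → analyticOrderAt a z ≤ analyticOrderAt f z

/-- Analyticity on the punctured unit disk. -/
def PuncturedAnalytic (f : ℂ → ℂ) : Prop :=
  ∀ z ∈ ball (0 : ℂ) 1, z ≠ 0 → AnalyticAt ℂ f z

/-- Negative powers are the reason for excluding the origin. Nothing is lost, since the divisor a
does not vanish there. -/
theorem PuncturedAnalytic.zpow (j : ℤ) : PuncturedAnalytic fun z => z ^ j :=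
  fun _ _ h => analyticAt_id.zpow h

theorem DA.punctured {f : ℂ → ℂ} (hf : DA f) : PuncturedAnalytic f :=
  fun _ hz _ => hf.analyticAt hz

namespace PuncturedAnalytic

variable {f g : ℂ → ℂ}

theorem add (hf : PuncturedAnalytic f) (hg : PuncturedAnalytic g) :
    PuncturedAnalytic fun z => f z + g z := fun z hz h => (hf z hz h).add (hg z hz h)

theorem sub (hf : PuncturedAnalytic f) (hg : PuncturedAnalytic g) :
    PuncturedAnalytic fun z => f z - g z := fun z hz h => (hf z hz h).sub (hg z hz h)

theorem mul (hf : PuncturedAnalytic f) (hg : PuncturedAnalytic g) :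
    PuncturedAnalytic fun z => f z * g z := fun z hz h => (hf z hz h).mul (hg z hz h)

end PuncturedAnalytic

namespace DiskDvd

variable {a f g : ℂ → ℂ}

theorem add (hf : DiskDvd a f) (hg : DiskDvd a g) : DiskDvd a fun z => f z + g z :=
  fun z hz h => (le_min (hf z hz h) (hg z hz h)).trans le_analyticOrderAt_add

theorem sub (hf : DiskDvd a f) (hg : DiskDvd a g) : DiskDvd a fun z => f z - g z :=
  fun z hz h => (le_min (hf z hz h) (hg z hz h)).trans le_analyticOrderAt_sub

theorem mul_left (hg : PuncturedAnalytic g) (hf' : PuncturedAnalytic f) (hf : DiskDvd a f) :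
    DiskDvd a fun z => g z * f z := fun z hz h => by
  have := analyticOrderAt_mul (hg z hz h) (hf' z hz h)
  change _ ≤ analyticOrderAt (g * f) z
  rw [this]
  exact (hf z hz h).trans le_add_self

theorem congr (hf : DiskDvd a f) (h : ∀ z ∈ ball (0 : ℂ) 1, z ≠ 0 → g z = f z) :
    DiskDvd a g := fun z hz h0 => by
  have : g =ᶠ[𝓝 z] f := by
    filter_upwards [isOpen_ball.mem_nhds hz, isOpen_ne.mem_nhds h0] with y hy hy0 using h y hy hy0
  rw [analyticOrderAt_congr this]
  exact hf z hz h0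

theorem refl (a : ℂ → ℂ) : DiskDvd a a := fun _ _ _ => le_rfl

end DiskDvd

/-- Division in the disk algebra by a function without zeros on the circle. -/
theorem DiskDvd.exists_mul_eq {a f : ℂ → ℂ} (hd : DiskDvd a f) (ha : DA a) (hf : DA f)
    (ha1 : ∀ w : Circle, a w ≠ 0) (ha0 : a 0 ≠ 0) :
    ∃ q, DA q ∧ ∀ z ∈ closedBall (0 : ℂ) 1, f z = a z * q z := by
  have hle : ∀ z ∈ ball (0 : ℂ) 1, analyticOrderAt a z ≤ analyticOrderAt f z := by
    intro z hz
    rcases eq_or_ne z 0 with rfl | h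
    · rw [(ha.analyticAt hz).analyticOrderAt_eq_zero.2 ha0]; exact zero_le
    · exact hd z hz h
  have hA : AnalyticOnNhd ℂ a (ball 0 1) := fun z hz => ha.analyticAt hz
  have hfin : ∀ z ∈ ball (0 : ℂ) 1, analyticOrderAt a z ≠ ⊤ := fun z hz =>
    hA.analyticOrderAt_ne_top_of_isPreconnected (convex_ball 0 1).isPreconnected
      zero_mem_unitBall hz (by
        rw [(ha.analyticAt zero_mem_unitBall).analyticOrderAt_eq_zero.2 ha0]; simp)
  have hmer : MeromorphicOn (f / a) (ball 0 1) := fun z hz =>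
    (hf.analyticAt hz).meromorphicAt.div (ha.analyticAt hz).meromorphicAt
  -- Passing to the normal form removes the singularities of f/a, whose order is nonnegative
  -- throughout the disk. Values outside the open ball stay untouched, so q is the plain quotient on
  -- the circle.
  set q := toMeromorphicNFOn (f / a) (ball 0 1) with hq
  have hqNF : MeromorphicNFOn q (ball 0 1) := meromorphicNFOn_toMeromorphicNFOn _ _
  have hqan : ∀ z ∈ ball (0 : ℂ) 1, AnalyticAt ℂ q z := by
    intro z hz
    rw [← (hqNF hz).meromorphicOrderAt_nonneg_iff_analyticAt, hq,
      meromorphicOrderAt_toMeromorphicNFOn hmer hz,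
      meromorphicOrderAt_div (hf.analyticAt hz).meromorphicAt (ha.analyticAt hz).meromorphicAt,
      (hf.analyticAt hz).meromorphicOrderAt_eq, (ha.analyticAt hz).meromorphicOrderAt_eq]
    have h1 := hle z hz
    have h2 := hfin z hz
    generalize analyticOrderAt a z = m at h1 h2
    generalize analyticOrderAt f z = n at h1
    induction m using ENat.recTopCoe with
    | top => exact absurd rfl h2
    | coe m =>
      induction n using ENat.recTopCoe with
      | top => simp
      | coe n =>
        have : m ≤ n := by exact_mod_cast h1
        simp only [ENat.map_natCast, sub_eq_add_neg]
        change (0 : WithTop ℤ) ≤ ((n : ℤ) : WithTop ℤ) - ((m : ℤ) : WithTop ℤ)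
        rw [← WithTop.LinearOrderedAddCommGroup.coe_sub]
        exact_mod_cast (by omega : (0 : ℤ) ≤ n - m)
  have hqeq : ∀ z ∈ closedBall (0 : ℂ) 1, a z ≠ 0 → q z = f z / a z := by
    intro z hz haz
    rcases mem_ball_or_circle hz with h | ⟨w, rfl⟩
    · rw [hq, toMeromorphicNFOn_eq_toMeromorphicNFAt hmer h,
        toMeromorphicNFAt_eq_self.2 ((hf.analyticAt h).div (ha.analyticAt h) haz).meromorphicNFAt]
      rfl
    · rw [hq, toMeromorphicNFOn_eq_self_on_compl hmer (by
        rw [Set.mem_compl_iff, mem_ball_zero_iff, w.norm_coe]; exact lt_irrefl _)]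
      rfl
  have hDA : DA q := by
    refine ⟨fun z hz => (hqan z hz).differentiableAt.differentiableWithinAt, ?_⟩
    rw [closure_unitBall]
    intro z hz
    rcases mem_ball_or_circle hz with h | ⟨w, rfl⟩
    · exact (hqan z h).continuousAt.continuousWithinAt
    · have h1 : ContinuousWithinAt (fun z => f z / a z) (closedBall 0 1) w :=
        (hf.continuousOn' w hz).div (ha.continuousOn' w hz) (ha1 w)
      refine h1.congr_of_eventuallyEq ?_ (hqeq _ hz (ha1 w))
      have h2 : ∀ᶠ z in 𝓝[closedBall 0 1] (w : ℂ), a z ≠ 0 :=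
        (ha.continuousOn' w hz).eventually_ne (ha1 w)
      filter_upwards [h2, self_mem_nhdsWithin] with z hz1 hz2 using hqeq z hz2 hz1
  refine ⟨q, hDA, fun z hz => hf.eq_of_circle (ha.mul hDA) (fun w => ?_) hz⟩

  rw [hqeq w (circle_mem_closedBall w) (ha1 w), mul_div_cancel₀ _ (ha1 w)]

end HardPulse

namespace HardPulse

/-! ### Taylor polynomials and Hermite interpolation -/

theorem natCast_le_order_of_dvd {p : Polynomial ℂ} {z : ℂ} {d : ℕ}
    (h : (Polynomial.X - Polynomial.C z) ^ d ∣ p) :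
    (d : ℕ∞) ≤ analyticOrderAt (fun w => p.eval w) z := by
  obtain ⟨q, rfl⟩ := h
  refine (natCast_le_analyticOrderAt (AnalyticOnNhd.eval_polynomial _ z trivial)).2
    ⟨fun w => q.eval w, AnalyticOnNhd.eval_polynomial _ z trivial, ?_⟩
  filter_upwards with w
  simp

theorem order_polynomial {p : Polynomial ℂ} (hp : p ≠ 0) (z : ℂ) :
    analyticOrderAt (fun w => p.eval w) z = p.rootMultiplicity z := by
  obtain ⟨q, hq, hq'⟩ := p.exists_eq_pow_rootMultiplicity_mul_and_not_dvd hp z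
  rw [(AnalyticOnNhd.eval_polynomial p z trivial).analyticOrderAt_eq_natCast]
  refine ⟨fun w => q.eval w, AnalyticOnNhd.eval_polynomial _ z trivial, ?_, ?_⟩
  · rwa [Polynomial.dvd_iff_isRoot] at hq'
  · filter_upwards with w
    conv_lhs => rw [hq]
    simp

/-- Zeros counted with multiplicity do not exceed the degree. Hence a norming polynomial is
determined by its class modulo (w - z)^d. -/
theorem eq_zero_of_degree_lt_of_le_order {p : Polynomial ℂ} {z : ℂ} {d : ℕ}
    (hd : p.degree < d) (h : (d : ℕ∞) ≤ analyticOrderAt (fun w => p.eval w) z) : p = 0 := by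
  by_contra hp
  rw [order_polynomial hp, Nat.cast_le] at h
  have h1 : (p.rootMultiplicity z : WithBot ℕ) ≤ p.degree := by
    rw [Polynomial.degree_eq_natDegree hp]
    have h2 := Polynomial.natDegree_le_of_dvd (p.pow_rootMultiplicity_dvd z) hp
    rw [Polynomial.natDegree_pow, Polynomial.natDegree_X_sub_C, mul_one] at h2
    exact_mod_cast h2
  exact absurd (lt_of_le_of_lt (le_trans (by exact_mod_cast h) h1) hd) (lt_irrefl _)

theorem exists_taylor_polynomial {g : ℂ → ℂ} {z : ℂ} (hg : AnalyticAt ℂ g z) (d : ℕ) :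
    ∃ p : Polynomial ℂ, p.degree < d ∧
      (d : ℕ∞) ≤ analyticOrderAt (fun w => p.eval w - g w) z := by
  induction d with
  | zero => exact ⟨0, by simp, by simp⟩
  | succ d ih =>
    obtain ⟨p, hp, ho⟩ := ih
    have han : AnalyticAt ℂ (fun w => p.eval w - g w) z :=
      (AnalyticOnNhd.eval_polynomial p z trivial).sub hg
    obtain ⟨q, hq, hq'⟩ := (natCast_le_analyticOrderAt han).1 ho
    -- The value at z of the quotient (p - g)/(w - z)^d is the next Taylor coefficient of the error.
    refine ⟨p - Polynomial.C (q z) * (Polynomial.X - Polynomial.C z) ^ d, ?_, ?_⟩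
    · refine lt_of_le_of_lt (Polynomial.degree_sub_le _ _) (max_lt (hp.trans ?_) ?_)
      · exact_mod_cast Nat.lt_succ_self d
      · refine lt_of_le_of_lt (Polynomial.degree_mul_le _ _) ?_
        refine lt_of_le_of_lt (add_le_add_left Polynomial.degree_C_le _) ?_
        rw [zero_add, Polynomial.degree_pow, Polynomial.degree_X_sub_C]
        simp only [nsmul_eq_mul, mul_one]
        exact_mod_cast Nat.lt_succ_self d
    · have hq1 : AnalyticAt ℂ (fun w => q w - q z) z := hq.sub analyticAt_const
      have hq0 : (1 : ℕ∞) ≤ analyticOrderAt (fun w => q w - q z) z := by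
        rw [Order.one_le_iff_ne_zero, hq1.analyticOrderAt_ne_zero]
        simp
      have hpow : AnalyticAt ℂ (fun w => (w - z) ^ d) z := by fun_prop
      have heq : (fun w => (p - Polynomial.C (q z) * (Polynomial.X - Polynomial.C z) ^ d).eval w
          - g w) =ᶠ[𝓝 z] (fun w => (w - z) ^ d) * (fun w => q w - q z) := by
        filter_upwards [hq'] with w hw
        simp only [Polynomial.eval_sub, Polynomial.eval_mul, Polynomial.eval_C,
          Polynomial.eval_pow, Polynomial.eval_X, Pi.mul_apply]
        rw [smul_eq_mul] at hw
        linear_combination hw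
      rw [analyticOrderAt_congr heq,
        analyticOrderAt_mul hpow hq1]
      have : analyticOrderAt (fun w => (w - z) ^ d) z = d := analyticOrderAt_centeredMonomial
      rw [this, Nat.cast_succ]
      gcongr

/-- Hermite interpolation of prescribed germs at finitely many nonzero points by a polynomial
that vanishes at the origin. -/
theorem exists_interpolation (m : ℂ →₀ ℕ) (h0 : m 0 = 0) (g : ℂ → ℂ → ℂ)
    (hg : ∀ z, m z ≠ 0 → AnalyticAt ℂ (g z) z) :
    ∃ E : Polynomial ℂ, E.eval 0 = 0 ∧
      ∀ z, (m z : ℕ∞) ≤ analyticOrderAt (fun w => E.eval w - g z w) z := by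
  have hT : ∀ z, ∃ p : Polynomial ℂ, m z ≠ 0 →
      (m z : ℕ∞) ≤ analyticOrderAt (fun w => p.eval w - g z w) z := by
    intro z
    by_cases hz : m z = 0
    · exact ⟨0, fun h => absurd hz h⟩
    · obtain ⟨p, -, hp⟩ := exists_taylor_polynomial (hg z hz) (m z)
      exact ⟨p, fun _ => hp⟩
  choose p hp using hT
  -- The origin joins the nodes with multiplicity one and target zero, which forces E(0) = 0. The
  -- rest is the Chinese remainder theorem.
  let S : Finset ℂ := insert 0 m.support
  let e : ℂ → ℕ := fun z => if z = 0 then 1 else m z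
  let t : ℂ → Polynomial ℂ := fun z => if z = 0 then 0 else p z
  have hcop : Pairwise fun i j : S =>
      IsCoprime (Ideal.span {(Polynomial.X - Polynomial.C (i : ℂ)) ^ e i})
        (Ideal.span {(Polynomial.X - Polynomial.C (j : ℂ)) ^ e j}) := by
    intro i j hij
    rw [Ideal.isCoprime_span_singleton_iff]
    exact (Polynomial.isCoprime_X_sub_C_of_isUnit_sub
      (sub_ne_zero.2 fun h => hij (Subtype.ext h)).isUnit).pow
  obtain ⟨x, hx⟩ := Ideal.quotientInfToPiQuotient_surj hcop
    (fun i => Ideal.Quotient.mk _ (t i))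
  obtain ⟨E, rfl⟩ := Ideal.Quotient.mk_surjective x
  have hE : ∀ i ∈ S, (Polynomial.X - Polynomial.C i) ^ e i ∣ E - t i := by
    intro i hi
    have := congrFun hx ⟨i, hi⟩
    rw [Ideal.quotientInfToPiQuotient_mk', Ideal.Quotient.eq, Ideal.mem_span_singleton] at this
    exact this
  refine ⟨E, ?_, fun z => ?_⟩
  · have := hE 0 (by simp [S])
    simp only [e, t, if_true, pow_one, sub_zero] at this
    exact Polynomial.dvd_iff_isRoot.1 this
  · by_cases hz : m z = 0
    · simp [hz]
    have hz0 : z ≠ 0 := fun h => hz (h ▸ h0)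
    have h1 := hE z (by simp [S, hz])
    simp only [e, t, if_neg hz0] at h1
    have h2 := natCast_le_order_of_dvd h1
    have h3 := hp z hz
    have : (fun w => E.eval w - g z w) =
        (fun w => (E - p z).eval w) + fun w => (p z).eval w - g z w := by
      ext w; simp
    rw [this]
    exact (le_min h2 h3).trans le_analyticOrderAt_add

/-- The orders of vanishing in the open disk of a disk algebra function without zeros on the
circle. -/
theorem DA.exists_order {a : ℂ → ℂ} (ha : DA a) (ha1 : ∀ w : Circle, a w ≠ 0) (ha0 : a 0 ≠ 0) :
    ∃ m : ℂ →₀ ℕ, (∀ z ∈ m.support, z ≠ 0 ∧ ‖z‖ < 1) ∧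
      ∀ z ∈ ball (0 : ℂ) 1, analyticOrderAt a z = m z := by
  have hA : AnalyticOnNhd ℂ a (ball 0 1) := fun z hz => ha.analyticAt hz
  have hfin : ∀ z ∈ ball (0 : ℂ) 1, analyticOrderAt a z ≠ ⊤ := fun z hz =>
    hA.analyticOrderAt_ne_top_of_isPreconnected (convex_ball 0 1).isPreconnected
      zero_mem_unitBall hz (by
        rw [(ha.analyticAt zero_mem_unitBall).analyticOrderAt_eq_zero.2 ha0]; simp)
  -- An accumulation point of zeros inside the disk contradicts the finite order of a there; one on
  -- the circle contradicts continuity, since a is nonzero on the circle.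
  have hZ : {z ∈ closedBall (0 : ℂ) 1 | a z = 0}.Finite := by
    by_contra hinf
    obtain ⟨x, hx, hacc⟩ := Set.Infinite.exists_accPt_of_subset_isCompact hinf
      (isCompact_closedBall (0 : ℂ) 1) fun z hz => hz.1
    have hfr : ∃ᶠ z in 𝓝[≠] x, z ∈ {z ∈ closedBall (0 : ℂ) 1 | a z = 0} :=
      accPt_iff_frequently_nhdsNE.1 hacc
    rcases mem_ball_or_circle hx with hxb | ⟨w, rfl⟩
    · have : ∀ᶠ z in 𝓝[≠] x, a z ≠ 0 := by
        rcases (ha.analyticAt hxb).eventually_eq_zero_or_eventually_ne_zero with h | h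
        · exact absurd (analyticOrderAt_eq_top.2 h) (hfin x hxb)
        · exact h
      obtain ⟨z, hz1, hz2⟩ := (hfr.and_eventually this).exists
      exact hz2 hz1.2
    · have h1 : ∀ᶠ z in 𝓝[closedBall 0 1] (w : ℂ), a z ≠ 0 :=
        (ha.continuousOn' w hx).eventually_ne (ha1 w)
      rw [eventually_nhdsWithin_iff] at h1
      obtain ⟨z, hz1, hz2⟩ := (hfr.and_eventually (h1.filter_mono nhdsWithin_le_nhds)).exists
      exact hz2 hz1.1 hz1.2
  classical
  refine ⟨Finsupp.onFinset hZ.toFinset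
    (fun z => if z ∈ ball (0 : ℂ) 1 then analyticOrderNatAt a z else 0) ?_, ?_, ?_⟩
  · intro z hz
    simp only [ne_eq, ite_eq_right_iff, Classical.not_imp] at hz
    rw [Set.Finite.mem_toFinset]
    exact ⟨ball_mem_closedBall hz.1, apply_eq_zero_of_analyticOrderNatAt_ne_zero hz.2⟩
  · intro z hz
    rw [Finsupp.mem_support_iff, Finsupp.onFinset_apply] at hz
    simp only [ne_eq, ite_eq_right_iff, Classical.not_imp] at hz
    refine ⟨?_, mem_ball_zero_iff.1 hz.1⟩
    rintro rfl
    exact ha0 (apply_eq_zero_of_analyticOrderNatAt_ne_zero hz.2)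
  · intro z hz
    rw [Finsupp.onFinset_apply, if_pos hz, Nat.cast_analyticOrderNatAt (hfin z hz)]

end HardPulse

namespace HardPulse

/-! ### The scattering problem at a fixed time -/

theorem circle_mul_conj (w : Circle) : (w : ℂ) * conj (w : ℂ) = 1 := by
  rw [Complex.mul_conj, Complex.normSq_eq_norm_sq, w.norm_coe]; simp

theorem circle_conj (w : Circle) : conj (w : ℂ) = (w : ℂ)⁻¹ :=
  eq_inv_of_mul_eq_one_right (circle_mul_conj w)

theorem circle_conj_zpow (w : Circle) (j : ℤ) : conj ((w : ℂ) ^ j) = (w : ℂ) ^ (-j) := by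
  rw [map_zpow₀, circle_conj, inv_zpow']

/-- Scattering data: the reflection coefficient `r`, the transmission function `a` in the disk
algebra, and polynomials `E`, `E'` that interpolate the norming data of `r` and of the time
reversed problem at the zeros of `a`. -/
structure ScatData (r : Circle → ℂ) (a : ℂ → ℂ) (E E' : Polynomial ℂ) : Prop where
  da : DA a
  norm_eq : ∀ w : Circle, a w * conj (a w) * (1 + r w * conj (r w)) = 1
  pos : ∃ t : ℝ, 0 < t ∧ a 0 = t
  eval_zero : E.eval 0 = 0
  eval_zero' : E'.eval 0 = 0
  dvd : DiskDvd a fun z => E.eval z * E'.eval z + 1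

/-- The reflection coefficient of the time reversed problem. -/
def dualCoeff (r : Circle → ℂ) (a : ℂ → ℂ) (w : Circle) : ℂ :=
  -(conj (r w) * conj (a w) / a w)

/-- `h`, `k`, `U`, `V` are, up to a common factor, `A_+^*`, `B_+^*`, `A_-`, `B_-` at time `j`. -/
structure Sol (r : Circle → ℂ) (a : ℂ → ℂ) (E : Polynomial ℂ) (j : ℤ) (h k U V : ℂ → ℂ) :
    Prop where
  dh : DA h
  dk : DA k
  dU : DA U
  dV : DA V
  circ_U : ∀ w : Circle, U w = a w * (conj (h w) - r w * (w : ℂ) ^ j * k w)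
  circ_V : ∀ w : Circle, V w = a w * (conj (k w) + r w * (w : ℂ) ^ j * h w)
  dvd_U : DiskDvd a fun z => U z + E.eval z * z ^ j * k z
  dvd_V : DiskDvd a fun z => V z - E.eval z * z ^ j * h z
  V_zero : V 0 = 0

/-- A normalized solution of the scattering problem. -/
structure NSol (r : Circle → ℂ) (a : ℂ → ℂ) (E : Polynomial ℂ) (j : ℤ) (h k U V : ℂ → ℂ) : Prop
    extends Sol r a E j h k U V where
  unit : ∀ w : Circle, h w * conj (h w) + k w * conj (k w) = 1
  pos : ∃ t : ℝ, 0 < t ∧ h 0 = t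

variable {r : Circle → ℂ} {a : ℂ → ℂ} {E E' : Polynomial ℂ} {j : ℤ} {h k U V : ℂ → ℂ}

namespace ScatData

theorem ne_zero (D : ScatData r a E E') (w : Circle) : a w ≠ 0 := by
  intro h
  have := D.norm_eq w
  simp [h] at this

theorem zero_ne_zero (D : ScatData r a E E') : a 0 ≠ 0 := by
  obtain ⟨t, ht, h⟩ := D.pos
  rw [h]; exact_mod_cast ht.ne'

/-- Time reversal keeps a. The two interpolants trade places, the congruence E E' = -1 modulo a
being symmetric. -/
theorem dual (D : ScatData r a E E') : ScatData (dualCoeff r a) a E' E where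
  da := D.da
  norm_eq w := by
    have h0 := D.ne_zero w
    have h1 : conj (a w) ≠ 0 := by simpa using h0
    have := D.norm_eq w
    simp only [dualCoeff, map_neg, map_div₀, map_mul, Complex.conj_conj]
    field_simp
    linear_combination this
  pos := D.pos
  eval_zero := D.eval_zero'
  eval_zero' := D.eval_zero
  dvd := by simpa only [mul_comm] using D.dvd

theorem dualCoeff_dualCoeff (D : ScatData r a E E') : dualCoeff (dualCoeff r a) a = r := by
  ext w
  have h0 := D.ne_zero w
  have h1 : conj (a w) ≠ 0 := by simpa using h0
  simp only [dualCoeff, map_neg, map_div₀, map_mul, Complex.conj_conj]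
  field_simp

end ScatData

namespace Sol

/-- The terms with E cancel in h U + k V, so a divides it. By the relations on the circle the
quotient has boundary values |h|^2 + |k|^2, which are real, and a disk algebra function with real
boundary values is constant. All rigidity of the problem comes from this. -/
theorem exists_const (S : Sol r a E j h k U V) (D : ScatData r a E E') :
    ∃ q : ℂ, (∀ z ∈ closedBall (0 : ℂ) 1, h z * U z + k z * V z = a z * q) ∧
      ∀ w : Circle, h w * conj (h w) + k w * conj (k w) = q := by
  have hE := (DA.poly E).punctured
  have hj := PuncturedAnalytic.zpow j
  have d1 : DiskDvd a fun z => h z * U z + k z * V z := by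
    have e1 := DiskDvd.mul_left S.dh.punctured
      (S.dU.punctured.add ((hE.mul hj).mul S.dk.punctured)) S.dvd_U
    have e2 := DiskDvd.mul_left S.dk.punctured
      (S.dV.punctured.sub ((hE.mul hj).mul S.dh.punctured)) S.dvd_V
    exact (e1.add e2).congr fun z _ _ => by ring
  obtain ⟨q, hq, hq'⟩ := d1.exists_mul_eq D.da ((S.dh.mul S.dU).add' (S.dk.mul S.dV))
    D.ne_zero D.zero_ne_zero
  have hc : ∀ w : Circle, q w = h w * conj (h w) + k w * conj (k w) := by
    intro w
    have e := hq' w (circle_mem_closedBall w)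
    rw [S.circ_U, S.circ_V] at e
    apply mul_left_cancel₀ (D.ne_zero w)
    linear_combination -e
  have hconst : ∀ z ∈ closedBall (0 : ℂ) 1, q z = q 0 := fun z hz =>
    hq.eq_of_real (fun w => by
      rw [hc, Complex.mul_conj, Complex.mul_conj, ← Complex.ofReal_add, Complex.ofReal_im]) hz
  refine ⟨q 0, fun z hz => ?_, fun w => ?_⟩
  · rw [← hconst z hz]; exact hq' z hz
  · rw [← hconst w (circle_mem_closedBall w), hc]

/-- Real linear combinations of solutions. -/
theorem comb {h' k' U' V' : ℂ → ℂ} (S : Sol r a E j h k U V) (S' : Sol r a E j h' k' U' V')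
    (s t : ℝ) :
    Sol r a E j (fun z => s * h z - t * h' z) (fun z => s * k z - t * k' z)
      (fun z => s * U z - t * U' z) (fun z => s * V z - t * V' z) where
  dh := (S.dh.const_mul s).sub' (S'.dh.const_mul t)
  dk := (S.dk.const_mul s).sub' (S'.dk.const_mul t)
  dU := (S.dU.const_mul s).sub' (S'.dU.const_mul t)
  dV := (S.dV.const_mul s).sub' (S'.dV.const_mul t)
  circ_U w := by
    rw [S.circ_U, S'.circ_U]; simp only [map_sub, map_mul, Complex.conj_ofReal]; ring
  circ_V w := by
    rw [S.circ_V, S'.circ_V]; simp only [map_sub, map_mul, Complex.conj_ofReal]; ring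
  dvd_U := by
    have hE := (DA.poly E).punctured
    have hj := PuncturedAnalytic.zpow j
    have e1 := DiskDvd.mul_left (DA.const s).punctured
      (S.dU.punctured.add ((hE.mul hj).mul S.dk.punctured)) S.dvd_U
    have e2 := DiskDvd.mul_left (DA.const t).punctured
      (S'.dU.punctured.add ((hE.mul hj).mul S'.dk.punctured)) S'.dvd_U
    exact (e1.sub e2).congr fun z _ _ => by ring
  dvd_V := by
    have hE := (DA.poly E).punctured
    have hj := PuncturedAnalytic.zpow j
    have e1 := DiskDvd.mul_left (DA.const s).punctured
      (S.dV.punctured.sub ((hE.mul hj).mul S.dh.punctured)) S.dvd_V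
    have e2 := DiskDvd.mul_left (DA.const t).punctured
      (S'.dV.punctured.sub ((hE.mul hj).mul S'.dh.punctured)) S'.dvd_V
    exact (e1.sub e2).congr fun z _ _ => by ring
  V_zero := by simp [S.V_zero, S'.V_zero]

/-- One step forward in time. -/
theorem next (S : Sol r a E j h k U V) {c : ℝ} {σ : ℂ} (h0 : -σ * h 0 + c * k 0 = 0) :
    Sol r a E (j + 1) (fun z => c * h z + conj σ * k z)
      (dslope (fun z => -σ * h z + c * k z) 0)
      (fun z => c * U z + σ * V z) (fun z => z * (-conj σ * U z + c * V z)) where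
  dh := (S.dh.const_mul _).add' (S.dk.const_mul _)
  -- The new k is a quotient by z; `h0` says that its numerator vanishes at the origin, so
  -- multiplying by z recovers the numerator.
  dk := ((S.dh.const_mul _).add' (S.dk.const_mul _)).dslope_zero
  dU := (S.dU.const_mul _).add' (S.dV.const_mul _)
  dV := DA.id'.mul ((S.dU.const_mul _).add' (S.dV.const_mul _))
  circ_U w := by
    have e := mul_dslope_zero (f := fun z => -σ * h z + c * k z) h0 w
    rw [S.circ_U, S.circ_V, zpow_add_one₀ w.coe_ne_zero]
    simp only [map_add, map_mul, Complex.conj_ofReal, Complex.conj_conj]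
    linear_combination a w * r w * (w : ℂ) ^ j * e
  circ_V w := by
    have e := mul_dslope_zero (f := fun z => -σ * h z + c * k z) h0 w
    have e' := congrArg conj e
    simp only [map_add, map_mul, map_neg, Complex.conj_ofReal] at e'
    rw [S.circ_U, S.circ_V, zpow_add_one₀ w.coe_ne_zero]
    have e2 : (w : ℂ) * (-conj σ * conj (h w) + c * conj (k w)) =
        conj (dslope (fun z => -σ * h z + c * k z) 0 w) := by
      rw [← e', ← mul_assoc, circle_mul_conj, one_mul]
    linear_combination a w * e2
  dvd_U := by
    have hE := (DA.poly E).punctured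
    have hj := PuncturedAnalytic.zpow j
    have e1 := DiskDvd.mul_left (DA.const c).punctured
      (S.dU.punctured.add ((hE.mul hj).mul S.dk.punctured)) S.dvd_U
    have e2 := DiskDvd.mul_left (DA.const σ).punctured
      (S.dV.punctured.sub ((hE.mul hj).mul S.dh.punctured)) S.dvd_V
    refine (e1.add e2).congr fun z _ hz => ?_
    have e := mul_dslope_zero (f := fun z => -σ * h z + c * k z) h0 z
    rw [zpow_add_one₀ hz]
    linear_combination E.eval z * z ^ j * e
  dvd_V := by
    have hE := (DA.poly E).punctured
    have hj := PuncturedAnalytic.zpow j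
    have e1 := DiskDvd.mul_left (DA.id'.const_mul (-conj σ)).punctured
      (S.dU.punctured.add ((hE.mul hj).mul S.dk.punctured)) S.dvd_U
    have e2 := DiskDvd.mul_left (DA.id'.const_mul c).punctured
      (S.dV.punctured.sub ((hE.mul hj).mul S.dh.punctured)) S.dvd_V
    refine (e1.add e2).congr fun z _ hz => ?_
    rw [zpow_add_one₀ hz]
    ring
  V_zero := by simp

/-- Time reversal. -/
theorem dual (S : Sol r a E j h k U V) (D : ScatData r a E E') :
    Sol (dualCoeff r a) a E' (1 - j) U (dslope V 0) h (fun z => z * k z) where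
  dh := S.dU
  dk := S.dV.dslope_zero
  dU := S.dh
  dV := DA.id'.mul S.dk
  circ_U w := by
    have e := mul_dslope_zero S.V_zero w
    have h0 := D.ne_zero w
    rw [sub_eq_add_neg 1 j, zpow_add₀ w.coe_ne_zero, zpow_one]
    rw [S.circ_V] at e
    rw [S.circ_U]
    -- The identity |a|^2 (1 + |r|^2) = 1 is what permits solving the relations for h and k in terms
    -- of U and V.
    have n := D.norm_eq w
    have hj : (w : ℂ) ^ (-j) * (w : ℂ) ^ j = 1 := by
      rw [← zpow_add₀ w.coe_ne_zero]; simp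
    simp only [map_mul, map_sub, circle_conj_zpow, Complex.conj_conj, dualCoeff]
    have e2 : a w * (conj (r w) * conj (a w) / a w) = conj (r w) * conj (a w) := by
      field_simp
    linear_combination -h w * n - conj (r w) * conj (a w) * (w : ℂ) ^ (-j) * e -
      (w : ℂ) * (w : ℂ) ^ (-j) * dslope V 0 w * e2 +
      (- conj (r w) * conj (a w) * a w * r w * h w) * hj
  circ_V w := by
    have e := mul_dslope_zero S.V_zero w
    have h0 := D.ne_zero w
    rw [S.circ_V] at e
    have e1 := congrArg conj e
    rw [sub_eq_add_neg 1 j, zpow_add₀ w.coe_ne_zero, zpow_one, S.circ_U]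
    have n := D.norm_eq w
    have hj : (w : ℂ) ^ (-j) * (w : ℂ) ^ j = 1 := by
      rw [← zpow_add₀ w.coe_ne_zero]; simp
    simp only [map_mul, map_add, circle_conj_zpow, Complex.conj_conj] at e1
    simp only [dualCoeff]
    have hw := circle_mul_conj w
    have e3 : conj (dslope V 0 w) = w * (conj (a w) * (k w + conj (r w) * (w : ℂ) ^ (-j) *
        conj (h w))) := by
      rw [← e1, ← mul_assoc, hw, one_mul]
    rw [e3]
    field_simp
    linear_combination -k w * n + (-conj (r w) * conj (a w) * a w * r w * k w) * hj
  -- Multiplying V = E z^j h by E' z^(-j) and using E E' = -1 gives h = -E' z^(-j) V, all modulo a.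
  -- The missing factor z in z^(1 - j) sits in V = z · `dslope V 0`.
  dvd_U := by
    have hE := (DA.poly E).punctured
    have hE' := (DA.poly E').punctured
    have hj := PuncturedAnalytic.zpow j
    have hj' := PuncturedAnalytic.zpow (-j)
    have e1 := DiskDvd.mul_left (hE'.mul hj')
      (S.dV.punctured.sub ((hE.mul hj).mul S.dh.punctured)) S.dvd_V
    have e2 := DiskDvd.mul_left S.dh.punctured
      ((hE.mul hE').add (DA.const 1).punctured) D.dvd
    refine (e1.add e2).congr fun z _ hz => ?_
    have e := mul_dslope_zero S.V_zero z
    have hj : z ^ (-j) * z ^ j = 1 := by rw [← zpow_add₀ hz]; simp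
    rw [sub_eq_add_neg 1 j, zpow_add₀ hz, zpow_one]
    linear_combination E'.eval z * z ^ (-j) * e + E'.eval z * E.eval z * h z * hj
  dvd_V := by
    have hE := (DA.poly E).punctured
    have hE' := (DA.poly E').punctured
    have hj := PuncturedAnalytic.zpow j
    have hj' := PuncturedAnalytic.zpow (1 - j)
    have e1 := DiskDvd.mul_left (hE'.mul hj')
      (S.dU.punctured.add ((hE.mul hj).mul S.dk.punctured)) S.dvd_U
    have e2 := DiskDvd.mul_left (DA.id'.mul S.dk).punctured
      ((hE.mul hE').add (DA.const 1).punctured) D.dvd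
    refine (e2.sub e1).congr fun z _ hz => ?_
    have hj : z ^ (1 - j) * z ^ j = z := by rw [← zpow_add₀ hz]; simp
    linear_combination E'.eval z * E.eval z * k z * hj
  V_zero := by simp

end Sol

namespace NSol

theorem mul_add_mul (S : NSol r a E j h k U V) (D : ScatData r a E E') {z : ℂ}
    (hz : z ∈ closedBall (0 : ℂ) 1) : h z * U z + k z * V z = a z := by
  obtain ⟨q, h1, h2⟩ := S.toSol.exists_const D
  have : q = 1 := by rw [← h2 1, S.unit]
  rw [h1 z hz, this, mul_one]

theorem U_pos (S : NSol r a E j h k U V) (D : ScatData r a E E') : ∃ t : ℝ, 0 < t ∧ U 0 = t := by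
  have := S.mul_add_mul D zero_mem_unitClosedBall
  rw [S.V_zero, mul_zero, add_zero] at this
  obtain ⟨s, hs, hs'⟩ := S.pos
  obtain ⟨t, ht, ht'⟩ := D.pos
  refine ⟨t / s, by positivity, ?_⟩
  rw [hs', ht'] at this
  have hs0 : (s : ℂ) ≠ 0 := by exact_mod_cast hs.ne'
  push_cast
  rw [eq_div_iff hs0, mul_comm]; exact this

theorem dual (S : NSol r a E j h k U V) (D : ScatData r a E E') :
    NSol (dualCoeff r a) a E' (1 - j) U (dslope V 0) h (fun z => z * k z) where
  toSol := S.toSol.dual D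
  unit w := by
    have e := mul_dslope_zero S.V_zero w
    have e' := congrArg conj e
    rw [map_mul] at e'
    have hw := circle_mul_conj w
    have e1 : dslope V 0 w * conj (dslope V 0 w) = V w * conj (V w) := by
      rw [← e', ← e]
      linear_combination -(dslope V 0 w * conj (dslope V 0 w)) * hw
    rw [e1, S.circ_U, S.circ_V]
    simp only [map_mul, map_add, map_sub, circle_conj_zpow, Complex.conj_conj]
    have n := D.norm_eq w
    have u := S.unit w
    have hj : (w : ℂ) ^ (-j) * (w : ℂ) ^ j = 1 := by
      rw [← zpow_add₀ w.coe_ne_zero]; simp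
    linear_combination n + a w * conj (a w) * (1 + r w * conj (r w)) * u +
      a w * conj (a w) * r w * conj (r w) * (h w * conj (h w) + k w * conj (k w)) * hj
  pos := S.U_pos D

/-- Weighting each solution with the value U(0) of the other gives a difference with U(0) = V(0) =
0. Its constant from `exists_const` is then zero, so |h|^2 + |k|^2 vanishes on the circle for the
difference. The two solutions are positive multiples of each other, and the unit norm makes the
factor one. -/
theorem ext_circle {h' k' U' V' : ℂ → ℂ} (S : NSol r a E j h k U V)
    (S' : NSol r a E j h' k' U' V') (D : ScatData r a E E') {z : ℂ}
    (hz : z ∈ closedBall (0 : ℂ) 1) : h z = h' z ∧ k z = k' z ∧ U z = U' z ∧ V z = V' z := by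
  obtain ⟨t, ht, hU⟩ := S.U_pos D
  obtain ⟨t', ht', hU'⟩ := S'.U_pos D
  have T := S.toSol.comb S'.toSol t' t
  obtain ⟨q, h1, h2⟩ := T.exists_const D
  have hq : q = 0 := by
    have := h1 0 zero_mem_unitClosedBall
    simp only [hU, hU', S.V_zero, S'.V_zero] at this
    have h3 : a 0 * q = 0 := by rw [← this]; ring
    exact (mul_eq_zero.1 h3).resolve_left D.zero_ne_zero
  have hz2 : ∀ w : Circle, (t' : ℂ) * h w = t * h' w ∧ (t' : ℂ) * k w = t * k' w := by
    intro w
    have := h2 w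
    rw [hq, Complex.mul_conj, Complex.mul_conj, ← Complex.ofReal_add,
      Complex.ofReal_eq_zero, add_eq_zero_iff_of_nonneg (Complex.normSq_nonneg _)
        (Complex.normSq_nonneg _), Complex.normSq_eq_zero, Complex.normSq_eq_zero] at this
    exact ⟨sub_eq_zero.1 this.1, sub_eq_zero.1 this.2⟩
  have htt : t' = t := by
    obtain ⟨e1, e2⟩ := hz2 1
    have e1' := congrArg conj e1
    have e2' := congrArg conj e2
    simp only [map_mul, Complex.conj_ofReal] at e1' e2'
    have u := S.unit 1
    have u' := S'.unit 1
    have h4 : (t' : ℂ) ^ 2 = (t : ℂ) ^ 2 := by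
      linear_combination -(t' : ℂ) ^ 2 * u + (t : ℂ) ^ 2 * u' +
        (t' * conj (h (1 : Circle))) * e1 + t * h' (1 : Circle) * e1' +
        (t' * conj (k (1 : Circle))) * e2 + t * k' (1 : Circle) * e2'
    have h5 : t' ^ 2 = t ^ 2 := by exact_mod_cast h4
    exact (pow_left_inj₀ ht'.le ht.le two_ne_zero).1 h5
  have ht0 : (t : ℂ) ≠ 0 := by exact_mod_cast ht.ne'
  subst htt
  have hh : ∀ w : Circle, h w = h' w := fun w => mul_left_cancel₀ ht0 (hz2 w).1
  have hk : ∀ w : Circle, k w = k' w := fun w => mul_left_cancel₀ ht0 (hz2 w).2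
  refine ⟨S.dh.eq_of_circle S'.dh hh hz, S.dk.eq_of_circle S'.dk hk hz,
    S.dU.eq_of_circle S'.dU (fun w => ?_) hz, S.dV.eq_of_circle S'.dV (fun w => ?_) hz⟩
  · rw [S.circ_U, S'.circ_U, hh, hk]
  · rw [S.circ_V, S'.circ_V, hh, hk]

end NSol

/-! ### Propagation of normalized solutions in time -/

/-- The cosine `(1 + |g|²)^{-1/2}`. -/
def cosOf (g : ℂ) : ℝ := 1 / √(1 + ‖g‖ ^ 2)

/-- The complex sine `g (1 + |g|²)^{-1/2}`. -/
def sinOf (g : ℂ) : ℂ := cosOf g * g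

theorem cosOf_pos (g : ℂ) : 0 < cosOf g := by unfold cosOf; positivity

theorem cosOf_sq_add (g : ℂ) : (cosOf g : ℂ) ^ 2 + sinOf g * conj (sinOf g) = 1 := by
  have h1 : cosOf g ^ 2 * (1 + ‖g‖ ^ 2) = 1 := by
    unfold cosOf
    rw [div_pow, Real.sq_sqrt (by positivity)]
    field_simp
  have h2 : (cosOf g : ℂ) ^ 2 * (1 + (‖g‖ : ℂ) ^ 2) = 1 := by exact_mod_cast h1
  have h3 : g * conj g = (‖g‖ : ℂ) ^ 2 := Complex.mul_conj' g
  simp only [sinOf, map_mul, Complex.conj_ofReal]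
  linear_combination h2 + (cosOf g : ℂ) ^ 2 * h3

theorem sinOf_zero : sinOf 0 = 0 := by simp [sinOf]

/-- The tangent g = k(0)/h(0) is forced by the requirement that -s h + c k vanish at the origin.
Positivity persists, since the new h(0) is the old one times c (1 + |g|^2). -/
theorem NSol.next (S : NSol r a E j h k U V) {g : ℂ} (hg : k 0 = g * h 0) :
    NSol r a E (j + 1) (fun z => cosOf g * h z + conj (sinOf g) * k z)
      (dslope (fun z => -sinOf g * h z + cosOf g * k z) 0)
      (fun z => cosOf g * U z + sinOf g * V z)
      (fun z => z * (-conj (sinOf g) * U z + cosOf g * V z)) := by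
  have h0 : -sinOf g * h 0 + cosOf g * k 0 = 0 := by rw [hg, sinOf]; ring
  refine { toSol := S.toSol.next h0, unit := fun w => ?_, pos := ?_ }
  · have e := mul_dslope_zero (f := fun z => -sinOf g * h z + cosOf g * k z) h0 w
    have e' := congrArg conj e
    rw [map_mul] at e'
    have hw := circle_mul_conj w
    have e1 : dslope (fun z => -sinOf g * h z + cosOf g * k z) 0 w *
        conj (dslope (fun z => -sinOf g * h z + cosOf g * k z) 0 w) =
        (-sinOf g * h w + cosOf g * k w) * conj (-sinOf g * h w + cosOf g * k w) := by
      rw [← e', ← e]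
      linear_combination -(dslope (fun z => -sinOf g * h z + cosOf g * k z) 0 w *
        conj (dslope (fun z => -sinOf g * h z + cosOf g * k z) 0 w)) * hw
    rw [e1]
    simp only [map_add, map_mul, map_neg, Complex.conj_ofReal, Complex.conj_conj]
    have c := cosOf_sq_add g
    have u := S.unit w
    linear_combination (h w * conj (h w) + k w * conj (k w)) * c + u
  · obtain ⟨t, ht, hh⟩ := S.pos
    have hc := cosOf_pos g
    refine ⟨t * (cosOf g + cosOf g * ‖g‖ ^ 2), by positivity, ?_⟩
    have h3 : g * conj g = (‖g‖ : ℂ) ^ 2 := Complex.mul_conj' g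
    simp only [hg, hh, sinOf, map_mul, Complex.conj_ofReal]
    push_cast
    linear_combination (t * cosOf g : ℂ) * h3

theorem NSol.exists_next (S : NSol r a E j h k U V) :
    ∃ h' k' U' V', NSol r a E (j + 1) h' k' U' V' := by
  obtain ⟨t, ht, hh⟩ := S.pos
  have h0 : h 0 ≠ 0 := by rw [hh]; exact_mod_cast ht.ne'
  exact ⟨_, _, _, _, S.next (g := k 0 / h 0) (div_mul_cancel₀ _ h0).symm⟩

/-- A step back is a step forward of the reversed problem: the time runs through j, 1 - j, 2 - j, j
- 1. -/
theorem NSol.exists_prev (S : NSol r a E j h k U V) (D : ScatData r a E E') :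
    ∃ h' k' U' V', NSol r a E (j - 1) h' k' U' V' := by
  obtain ⟨h', k', U', V', S'⟩ := (S.dual D).exists_next
  have := S'.dual D.dual
  rw [D.dualCoeff_dualCoeff, show 1 - (1 - j + 1) = j - 1 by ring] at this
  exact ⟨_, _, _, _, this⟩

/-- A normalized solution at one time gives normalized solutions at all times. -/
theorem NSol.exists_all {J : ℤ} (S : NSol r a E J h k U V) (D : ScatData r a E E') (j : ℤ) :
    ∃ h' k' U' V', NSol r a E j h' k' U' V' := by
  induction j using Int.inductionOn' (b := J) with
  | zero => exact ⟨_, _, _, _, S⟩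
  | succ i _ ih => obtain ⟨_, _, _, _, S'⟩ := ih; exact S'.exists_next
  | pred i _ ih => obtain ⟨_, _, _, _, S'⟩ := ih; exact S'.exists_prev D

end HardPulse

namespace HardPulse

/-! ### Jost solutions of a summable potential -/

/-- Used for conserved distances: a quantity that is constant in time and tends to zero at one end
vanishes. Every uniqueness statement from data at infinity below is of this kind. -/
theorem eq_zero_of_periodic_atTop {d : ℤ → ℝ} (hd : ∀ j, d (j + 1) = d j)
    (h : Tendsto d atTop (𝓝 0)) (j : ℤ) : d j = 0 := by
  have hc : ∀ j, d j = d 0 := by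
    intro j
    induction j using Int.induction_on with
    | zero => rfl
    | succ i ih => rw [hd, ih]
    | pred i ih => rw [← ih, ← hd (-(i : ℤ) - 1)]; congr 1; ring
  have h1 : d = fun _ => d 0 := funext hc
  rw [h1] at h
  rw [hc]
  exact tendsto_nhds_unique tendsto_const_nhds h

theorem eq_zero_of_periodic_atBot {d : ℤ → ℝ} (hd : ∀ j, d (j + 1) = d j)
    (h : Tendsto d atBot (𝓝 0)) (j : ℤ) : d j = 0 := by
  have := eq_zero_of_periodic_atTop (d := fun j => d (-j))
    (fun j => by
      have := hd (-(j + 1))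
      rw [show -(j + 1) + 1 = -j by ring] at this
      exact this.symm)
    (h.comp tendsto_neg_atTop_atBot) (-j)
  simpa using this

theorem normSq_transfer {c : ℝ} {s : ℂ} (hc : (c : ℂ) ^ 2 + s * conj s = 1) (x y : ℂ) :
    Complex.normSq (c * x - conj s * y) + Complex.normSq (s * x + c * y) =
      Complex.normSq x + Complex.normSq y := by
  rw [← Complex.ofReal_inj]
  push_cast
  simp only [← Complex.mul_conj, map_sub, map_add, map_mul, Complex.conj_ofReal,
    Complex.conj_conj]
  linear_combination (x * conj x + y * conj y) * hc

theorem DA.tsum {ι : Type*} {f : ι → ℂ → ℂ} {u : ι → ℝ} (hu : Summable u) (hf : ∀ i, DA (f i))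
    (hb : ∀ i, ∀ z ∈ closedBall (0 : ℂ) 1, ‖f i z‖ ≤ u i) : DA fun z => ∑' i, f i z := by
  refine ⟨Complex.differentiableOn_tsum_of_summable_norm hu (fun i => (hf i).differentiableOn)
    isOpen_ball fun i z hz => hb i z (ball_mem_closedBall hz), ?_⟩
  rw [closure_unitBall]
  exact continuousOn_tsum (fun i => (hf i).continuousOn') hu hb

/-- Finite products of transfer matrices applied to `(1, 0)`. -/
def approx (c : ℤ → ℝ) (s : ℤ → ℂ) : ℕ → ℤ → ℂ → ℂ × ℂ
  | 0, _, _ => (1, 0)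
  | n + 1, j, z =>
    (c j * (approx c s n (j + 1) z).1 - conj (s j) * (z * (approx c s n (j + 1) z).2),
      s j * (approx c s n (j + 1) z).1 + c j * (z * (approx c s n (j + 1) z).2))

section transfer

variable {c : ℤ → ℝ} {s : ℤ → ℂ}

theorem approx_succ_fst (n : ℕ) (j : ℤ) (z : ℂ) : (approx c s (n + 1) j z).1 =
    c j * (approx c s n (j + 1) z).1 - conj (s j) * (z * (approx c s n (j + 1) z).2) := rfl

theorem approx_succ_snd (n : ℕ) (j : ℤ) (z : ℂ) : (approx c s (n + 1) j z).2 =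
    s j * (approx c s n (j + 1) z).1 + c j * (z * (approx c s n (j + 1) z).2) := rfl

theorem differentiable_approx (n : ℕ) (j : ℤ) :
    (Differentiable ℂ fun z => (approx c s n j z).1) ∧
      Differentiable ℂ fun z => (approx c s n j z).2 := by
  induction n generalizing j with
  | zero => exact ⟨differentiable_const _, differentiable_const _⟩
  | succ n ih =>
    have h1 := (ih (j + 1)).1
    have h2 := (ih (j + 1)).2
    constructor
    · simp only [approx]; fun_prop
    · simp only [approx]; fun_prop

/-- Consecutive approximations differ only by the innermost transfer matrix, whose effect on (1, 0)
is (c - 1, s). The outer factors are unitary matrices and multiplications by z in one component,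
hence contractions for |z| ≤ 1. -/
theorem normSq_approx_sub_le (hc : ∀ j, (c j : ℂ) ^ 2 + s j * conj (s j) = 1) {z : ℂ}
    (hz : z ∈ closedBall (0 : ℂ) 1) (n : ℕ) (j : ℤ) :
    Complex.normSq ((approx c s (n + 1) j z).1 - (approx c s n j z).1) +
      Complex.normSq ((approx c s (n + 1) j z).2 - (approx c s n j z).2) ≤
      (|1 - c (j + n)| + ‖s (j + n)‖) ^ 2 := by
  induction n generalizing j with
  | zero =>
    simp only [approx, mul_one, mul_zero, sub_zero, add_zero, Nat.cast_zero]
    have h1 : Complex.normSq ((c j : ℂ) - 1) = |1 - c j| ^ 2 := by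
      rw [← Complex.ofReal_one, ← Complex.ofReal_sub, Complex.normSq_ofReal, sq_abs]; ring
    rw [h1, Complex.normSq_eq_norm_sq]
    nlinarith [abs_nonneg (1 - c j), norm_nonneg (s j)]
  | succ n ih =>
    have key := ih (j + 1)
    rw [show j + 1 + (n : ℤ) = j + ((n + 1 : ℕ) : ℤ) by push_cast; ring] at key
    refine le_trans ?_ key
    set x := (approx c s (n + 1) (j + 1) z).1 - (approx c s n (j + 1) z).1
    set y := (approx c s (n + 1) (j + 1) z).2 - (approx c s n (j + 1) z).2
    have e1 : (approx c s (n + 1 + 1) j z).1 - (approx c s (n + 1) j z).1 =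
        c j * x - conj (s j) * (z * y) := by
      rw [approx_succ_fst (n + 1) j, approx_succ_fst n j]
      simp only [x, y]; ring
    have e2 : (approx c s (n + 1 + 1) j z).2 - (approx c s (n + 1) j z).2 =
        s j * x + c j * (z * y) := by
      rw [approx_succ_snd (n + 1) j, approx_succ_snd n j]
      simp only [x, y]; ring
    rw [e1, e2, normSq_transfer (hc j)]
    have hz1 : Complex.normSq z ≤ 1 := by
      rw [Complex.normSq_eq_norm_sq]
      have := mem_closedBall_zero_iff.1 hz
      exact pow_le_one₀ (norm_nonneg _) this
    rw [map_mul]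
    nlinarith [Complex.normSq_nonneg y]

theorem tendsto_tsum_int_tail (f : ℤ → ℝ) :
    Tendsto (fun j : ℤ => ∑' n : ℕ, f (j + n)) atTop (𝓝 0) := by
  have h1 := tendsto_sum_nat_add fun n : ℕ => f n
  have h2 : Tendsto (fun j : ℤ => j.toNat) atTop atTop := by
    rw [Filter.tendsto_atTop]
    intro b
    filter_upwards [eventually_ge_atTop (b : ℤ)] with j hj
    omega
  refine (h1.comp h2).congr' ?_
  filter_upwards [eventually_ge_atTop 0] with j hj
  refine tsum_congr fun n => ?_
  congr 1
  push_cast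
  rw [Int.toNat_of_nonneg hj]; ring

/-- The infinite product of transfer matrices converges as a telescoping series, uniformly on the
closed disk; the bound η is the tail sum of its majorants. -/
theorem exists_transfer_solution (hc : ∀ j, (c j : ℂ) ^ 2 + s j * conj (s j) = 1)
    (hs : Summable fun j => |1 - c j| + ‖s j‖) :
    ∃ h k : ℤ → ℂ → ℂ, (∀ j, DA (h j)) ∧ (∀ j, DA (k j)) ∧
      (∀ j, ∀ z ∈ closedBall (0 : ℂ) 1,
        h j z = c j * h (j + 1) z - conj (s j) * (z * k (j + 1) z)) ∧
      (∀ j, ∀ z ∈ closedBall (0 : ℂ) 1,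
        k j z = s j * h (j + 1) z + c j * (z * k (j + 1) z)) ∧
      ∃ η : ℤ → ℝ, Tendsto η atTop (𝓝 0) ∧ ∀ j, ∀ z ∈ closedBall (0 : ℂ) 1,
        ‖h j z - 1‖ ≤ η j ∧ ‖k j z‖ ≤ η j := by
  set ε : ℤ → ℝ := fun j => |1 - c j| + ‖s j‖ with hε
  have hε0 : ∀ j, 0 ≤ ε j := fun j => by positivity
  have hsum : ∀ j : ℤ, Summable fun n : ℕ => ε (j + n) := fun j =>
    hs.comp_injective fun m n h => by simpa using h
  have hb : ∀ n j, ∀ z ∈ closedBall (0 : ℂ) 1,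
      ‖(approx c s (n + 1) j z).1 - (approx c s n j z).1‖ ≤ ε (j + n) ∧
      ‖(approx c s (n + 1) j z).2 - (approx c s n j z).2‖ ≤ ε (j + n) := by
    intro n j z hz
    have := normSq_approx_sub_le hc hz n j
    rw [Complex.normSq_eq_norm_sq, Complex.normSq_eq_norm_sq] at this
    constructor <;> refine (sq_le_sq₀ (norm_nonneg _) (hε0 _)).1 ?_ <;>
      nlinarith [sq_nonneg ‖(approx c s (n + 1) j z).1 - (approx c s n j z).1‖,
        sq_nonneg ‖(approx c s (n + 1) j z).2 - (approx c s n j z).2‖]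
  let h : ℤ → ℂ → ℂ := fun j z =>
    1 + ∑' n : ℕ, ((approx c s (n + 1) j z).1 - (approx c s n j z).1)
  let k : ℤ → ℂ → ℂ := fun j z =>
    ∑' n : ℕ, ((approx c s (n + 1) j z).2 - (approx c s n j z).2)
  have lim_h : ∀ j, ∀ z ∈ closedBall (0 : ℂ) 1,
      Tendsto (fun n => (approx c s n j z).1) atTop (𝓝 (h j z)) := by
    intro j z hz
    have h1 : Summable fun n : ℕ => (approx c s (n + 1) j z).1 - (approx c s n j z).1 :=
      Summable.of_norm_bounded (hsum j) fun n => (hb n j z hz).1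
    refine (h1.hasSum.tendsto_sum_nat.const_add 1).congr fun n => ?_
    rw [Finset.sum_range_sub fun n => (approx c s n j z).1]
    simp [approx]
  have lim_k : ∀ j, ∀ z ∈ closedBall (0 : ℂ) 1,
      Tendsto (fun n => (approx c s n j z).2) atTop (𝓝 (k j z)) := by
    intro j z hz
    have h1 : Summable fun n : ℕ => (approx c s (n + 1) j z).2 - (approx c s n j z).2 :=
      Summable.of_norm_bounded (hsum j) fun n => (hb n j z hz).2
    refine (h1.hasSum.tendsto_sum_nat).congr fun n => ?_
    rw [Finset.sum_range_sub fun n => (approx c s n j z).2]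
    simp [approx]
  refine ⟨h, k, fun j => ?_, fun j => ?_, fun j z hz => ?_, fun j z hz => ?_,
    fun j => ∑' n : ℕ, ε (j + n), tendsto_tsum_int_tail ε, fun j z hz => ⟨?_, ?_⟩⟩
  · refine DiffContOnCl.const_add (DA.tsum (hsum j) (fun n => ?_) fun n z hz => (hb n j z hz).1) 1
    exact ((differentiable_approx (n + 1) j).1.sub (differentiable_approx n j).1).diffContOnCl
  · refine DA.tsum (hsum j) (fun n => ?_) fun n z hz => (hb n j z hz).2
    exact ((differentiable_approx (n + 1) j).2.sub (differentiable_approx n j).2).diffContOnCl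
  · refine tendsto_nhds_unique ((lim_h j z hz).comp (tendsto_add_atTop_nat 1)) ?_
    exact ((lim_h (j + 1) z hz).const_mul _).sub (((lim_k (j + 1) z hz).const_mul z).const_mul _)
  · refine tendsto_nhds_unique ((lim_k j z hz).comp (tendsto_add_atTop_nat 1)) ?_
    exact ((lim_h (j + 1) z hz).const_mul _).add (((lim_k (j + 1) z hz).const_mul z).const_mul _)
  · simp only [h, add_sub_cancel_left]
    exact tsum_of_norm_bounded (hsum j).hasSum fun n => (hb n j z hz).1
  · exact tsum_of_norm_bounded (hsum j).hasSum fun n => (hb n j z hz).2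

end transfer

/-- The cosine `cos |μ_j|` of half the flip angle. -/
def cosP (ω : ℤ → ℂ) (j : ℤ) : ℝ := Real.cos ‖potential ω j‖

/-- The complex sine `(μ_j / |μ_j|) sin |μ_j|` of half the flip angle. -/
def sinP (ω : ℤ → ℂ) (j : ℤ) : ℂ :=
  potential ω j / ‖potential ω j‖ * Real.sin ‖potential ω j‖

theorem norm_potential (ω : ℤ → ℂ) (j : ℤ) : ‖potential ω j‖ = ‖ω j‖ / 2 := by
  simp [potential]; ring

theorem norm_sinP (ω : ℤ → ℂ) (j : ℤ) : ‖sinP ω j‖ = |Real.sin ‖potential ω j‖| := by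
  unfold sinP
  by_cases h : potential ω j = 0
  · simp [h]
  · rw [norm_mul, norm_div, Complex.norm_real, norm_norm, div_self (norm_ne_zero_iff.2 h),
      one_mul, Complex.norm_real, Real.norm_eq_abs]

theorem cosP_sq_add (ω : ℤ → ℂ) (j : ℤ) :
    (cosP ω j : ℂ) ^ 2 + sinP ω j * conj (sinP ω j) = 1 := by
  rw [Complex.mul_conj', norm_sinP, ← Complex.ofReal_pow, ← Complex.ofReal_pow, sq_abs, cosP,
    ← Complex.ofReal_add, Real.cos_sq_add_sin_sq, Complex.ofReal_one]

/-- This is where |ω_j| < π matters: half the flip angle stays below π/2. -/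
theorem IsHardPulse.cosP_pos {ω : ℤ → ℂ} (hω : IsHardPulse ω) (j : ℤ) : 0 < cosP ω j := by
  apply Real.cos_pos_of_mem_Ioo
  rw [norm_potential]
  constructor
  · linarith [norm_nonneg (ω j), Real.pi_pos]
  · linarith [hω.norm_lt j]

theorem IsHardPulse.summable_coeff {ω : ℤ → ℂ} (hω : IsHardPulse ω) :
    Summable fun j => |1 - cosP ω j| + ‖sinP ω j‖ := by
  refine Summable.of_nonneg_of_le (fun j => by positivity) (fun j => ?_) hω.summable
  have h0 : 0 ≤ ‖potential ω j‖ := norm_nonneg _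
  have h1 : |1 - cosP ω j| ≤ ‖potential ω j‖ := by
    rw [abs_of_nonneg (by unfold cosP; linarith [Real.cos_le_one ‖potential ω j‖])]
    unfold cosP
    rcases le_total ‖potential ω j‖ 2 with h | h
    · nlinarith [Real.one_sub_sq_div_two_le_cos (x := ‖potential ω j‖)]
    · linarith [Real.neg_one_le_cos ‖potential ω j‖]
  have h2 : ‖sinP ω j‖ ≤ ‖potential ω j‖ := by
    rw [norm_sinP]
    simpa [abs_of_nonneg h0] using Real.abs_sin_le_abs (x := ‖potential ω j‖)
  have h3 := norm_potential ω j
  linarith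

/-- Jost solutions of a hard pulse: `h`, `k` are `A_+^*`, `B_+^*` and `U`, `V` are `A_-`, `B_-`. -/
structure Jost (ω : ℤ → ℂ) (h k U V : ℤ → ℂ → ℂ) : Prop where
  dh : ∀ j, DA (h j)
  dk : ∀ j, DA (k j)
  dU : ∀ j, DA (U j)
  dV : ∀ j, DA (V j)
  step_h : ∀ j, ∀ z ∈ closedBall (0 : ℂ) 1,
    h j z = cosP ω j * h (j + 1) z - conj (sinP ω j) * (z * k (j + 1) z)
  step_k : ∀ j, ∀ z ∈ closedBall (0 : ℂ) 1,
    k j z = sinP ω j * h (j + 1) z + cosP ω j * (z * k (j + 1) z)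
  step_U : ∀ j, ∀ z ∈ closedBall (0 : ℂ) 1,
    U (j + 1) z = cosP ω j * U j z + sinP ω j * V j z
  step_V : ∀ j, ∀ z ∈ closedBall (0 : ℂ) 1,
    V (j + 1) z = z * (-conj (sinP ω j) * U j z + cosP ω j * V j z)
  lim_right : ∃ η : ℤ → ℝ, Tendsto η atTop (𝓝 0) ∧ ∀ j, ∀ z ∈ closedBall (0 : ℂ) 1,
    ‖h j z - 1‖ ≤ η j ∧ ‖k j z‖ ≤ η j
  lim_left : ∃ η : ℤ → ℝ, Tendsto η atBot (𝓝 0) ∧ ∀ j, ∀ z ∈ closedBall (0 : ℂ) 1,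
    ‖U j z - 1‖ ≤ η j ∧ ‖V j z‖ ≤ η j

theorem IsHardPulse.exists_jost {ω : ℤ → ℂ} (hω : IsHardPulse ω) :
    ∃ h k U V, Jost ω h k U V := by
  obtain ⟨h, k, dh, dk, sh, sk, lr⟩ := exists_transfer_solution (cosP_sq_add ω) hω.summable_coeff
  -- The left solutions are right solutions for the reversed and inverted transfer matrices: U_j =
  -- h'_(1-j) and V_j = z k'_(1-j). The shift by one and the factor z appear because precession
  -- follows the pulse within each step.
  obtain ⟨h', k', dh', dk', sh', sk', η, hη, hb⟩ :=
    exists_transfer_solution (c := fun j => cosP ω (-j)) (s := fun j => -conj (sinP ω (-j)))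
    (fun j => by
      have := cosP_sq_add ω (-j)
      simp only [map_neg, Complex.conj_conj]
      linear_combination this) (by
      have := hω.summable_coeff.comp_injective (neg_injective (G := ℤ))
      simpa [Function.comp_def] using this)
  refine ⟨h, k, fun j => h' (1 - j), fun j z => z * k' (1 - j) z, dh, dk, fun j => dh' _,
    fun j => DA.id'.mul (dk' _), sh, sk, fun j z hz => ?_, fun j z hz => ?_, lr,
    fun j => η (1 - j), hη.comp ?_, fun j z hz => ?_⟩
  · have := sh' (-j) z hz
    rw [show -j + 1 = 1 - j by ring] at this
    simp only [neg_neg, map_neg, Complex.conj_conj] at this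
    rw [show 1 - (j + 1) = -j by ring, this]; ring
  · have := sk' (-j) z hz
    rw [show -j + 1 = 1 - j by ring] at this
    simp only [neg_neg] at this
    rw [show 1 - (j + 1) = -j by ring, this]
  · exact (tendsto_atTop_add_const_left atBot (1 : ℤ) tendsto_neg_atBot_atTop).congr fun j => by
      ring
  · refine ⟨(hb _ z hz).1, ?_⟩
    rw [norm_mul]
    have h1 := mem_closedBall_zero_iff.1 hz
    have h2 := (hb (1 - j) z hz).2
    nlinarith [norm_nonneg z, norm_nonneg (k' (1 - j) z)]

end HardPulse

namespace HardPulse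

/-! ### From spinors to magnetizations -/

/-- The magnetization of the spinor `(a, b)`. -/
def spin (a b : ℂ) : Fin 3 → ℝ :=
  ![2 * (conj a * b).re, 2 * (conj a * b).im, Complex.normSq a - Complex.normSq b]

theorem precession_mulVec_spin (w : Circle) (a b : ℂ) :
    precession w *ᵥ spin a b = spin a (w * b) := by
  have hw : Complex.normSq (w : ℂ) = 1 := w.normSq_coe
  ext i
  fin_cases i
  · simp [precession, spin, Matrix.mulVec, dotProduct, Fin.sum_univ_three]; ring
  · simp [precession, spin, Matrix.mulVec, dotProduct, Fin.sum_univ_three]; ring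
  · simp [precession, spin, Matrix.mulVec, dotProduct, Fin.sum_univ_three]

theorem axis_sq {ω : ℂ} (h : ω ≠ 0) : (ω.re / ‖ω‖) ^ 2 + (ω.im / ‖ω‖) ^ 2 = 1 := by
  have h0 : ‖ω‖ ≠ 0 := norm_ne_zero_iff.2 h
  rw [div_pow, div_pow, ← add_div, Complex.sq_norm, Complex.normSq_apply, div_eq_one_iff_eq]
  · ring
  · rw [← Complex.normSq_apply, ← Complex.sq_norm]; positivity

theorem rotation_zero (v : Fin 3 → ℝ) : rotation 0 v = v := by
  simp [rotation]

theorem sinP_eq (ω : ℤ → ℂ) (j : ℤ) :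
    sinP ω j = Real.sin (‖ω j‖ / 2) *
      (-((ω j).im / ‖ω j‖ : ℝ) - ((ω j).re / ‖ω j‖ : ℝ) * Complex.I) := by
  unfold sinP
  rw [norm_potential]
  by_cases h : ω j = 0
  · simp [h, potential]
  have h0 : (‖ω j‖ : ℂ) ≠ 0 := by exact_mod_cast norm_ne_zero_iff.2 h
  have hc : conj (ω j) = (ω j).re - (ω j).im * Complex.I := by
    apply Complex.ext <;> simp
  unfold potential
  rw [hc]
  push_cast
  field_simp
  linear_combination (ω j).im * Complex.sin (‖ω j‖ / 2) * Complex.I_sq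

/-- The spinor map intertwines SU(2) and SO(3): a rotation by |ω| is covered by the matrix with half
that angle, which explains the factor 1/2 in `potential`. -/
theorem rotation_spin (ω : ℤ → ℂ) (j : ℤ) (a b : ℂ) :
    rotation (ω j) (spin a b) =
      spin (cosP ω j * a + sinP ω j * b) (-conj (sinP ω j) * a + cosP ω j * b) := by
  by_cases h : ω j = 0
  · have h1 : cosP ω j = 1 := by simp [cosP, potential, h]
    have h2 : sinP ω j = 0 := by simp [sinP, potential, h]
    rw [h, h1, h2, rotation_zero]; simp
  have hpq := axis_sq h
  rw [sinP_eq]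
  have hc : cosP ω j = Real.cos (‖ω j‖ / 2) := by rw [cosP, norm_potential]
  rw [hc]
  have hd : Real.cos ‖ω j‖ = Real.cos (‖ω j‖ / 2) ^ 2 - Real.sin (‖ω j‖ / 2) ^ 2 := by
    rw [← Real.cos_two_mul']; congr 1; ring
  have hs : Real.sin ‖ω j‖ = 2 * Real.sin (‖ω j‖ / 2) * Real.cos (‖ω j‖ / 2) := by
    rw [← Real.sin_two_mul]; congr 1; ring
  have h1 : 1 - Real.cos ‖ω j‖ = 2 * Real.sin (‖ω j‖ / 2) ^ 2 := by
    rw [hd]; linear_combination -Real.cos_sq_add_sin_sq (‖ω j‖ / 2)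
  unfold rotation axis
  rw [h1, hd, hs]
  generalize (ω j).re / ‖ω j‖ = p at hpq
  generalize (ω j).im / ‖ω j‖ = q at hpq
  generalize Real.cos (‖ω j‖ / 2) = C
  generalize Real.sin (‖ω j‖ / 2) = S
  obtain ⟨a1, a2⟩ := a
  obtain ⟨b1, b2⟩ := b
  ext i
  fin_cases i
  · simp [spin, cross_apply, Complex.normSq_apply]
    linear_combination 2 * S ^ 2 * (a1 * b1 + a2 * b2) * hpq
  · simp [spin, cross_apply, Complex.normSq_apply]
    linear_combination 2 * S ^ 2 * (a1 * b2 - a2 * b1) * hpq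
  · simp [spin, cross_apply, Complex.normSq_apply]
    linear_combination S ^ 2 * (a1 ^ 2 + a2 ^ 2 - b1 ^ 2 - b2 ^ 2) * hpq

theorem rotation_sub (ω : ℂ) (v v' : Fin 3 → ℝ) :
    rotation ω (v - v') = rotation ω v - rotation ω v' := by
  simp only [rotation, map_sub, dotProduct_sub, smul_sub, mul_sub, sub_smul]
  abel

theorem rotation_dotProduct_self (ω : ℂ) (v : Fin 3 → ℝ) :
    rotation ω v ⬝ᵥ rotation ω v = v ⬝ᵥ v := by
  by_cases h : ω = 0
  · rw [h, rotation_zero]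
  have hpq := axis_sq h
  have hcs := Real.cos_sq_add_sin_sq ‖ω‖
  unfold rotation axis
  generalize ω.re / ‖ω‖ = p at hpq
  generalize ω.im / ‖ω‖ = q at hpq
  generalize Real.cos ‖ω‖ = C at hcs
  generalize Real.sin ‖ω‖ = S at hcs
  obtain ⟨x, y, z, rfl⟩ : ∃ x y z, v = ![x, y, z] :=
    ⟨v 0, v 1, v 2, by ext i; fin_cases i <;> rfl⟩
  simp only [cross_apply, Matrix.vec3_dotProduct, Matrix.cons_val, Pi.add_apply, Pi.smul_apply,
    smul_eq_mul]
  grind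

theorem precession_dotProduct_self (w : Circle) (v : Fin 3 → ℝ) :
    (precession w *ᵥ v) ⬝ᵥ (precession w *ᵥ v) = v ⬝ᵥ v := by
  have hw : Complex.normSq (w : ℂ) = 1 := w.normSq_coe
  rw [Complex.normSq_apply] at hw
  simp only [precession, Matrix.mulVec, dotProduct, Fin.sum_univ_three,
    Matrix.of_apply, Matrix.cons_val]
  linear_combination (v 0 ^ 2 + v 1 ^ 2) * hw

theorem tendsto_spin {ι : Type*} {l : Filter ι} {f g : ι → ℂ} {a b : ℂ}
    (hf : Tendsto f l (𝓝 a)) (hg : Tendsto g l (𝓝 b)) :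
    Tendsto (fun i => spin (f i) (g i)) l (𝓝 (spin a b)) := by
  have h1 := ((Complex.continuous_conj.tendsto a).comp hf).mul hg
  have h2 := ((Complex.continuous_normSq.tendsto a).comp hf).sub
    ((Complex.continuous_normSq.tendsto b).comp hg)
  rw [tendsto_pi_nhds]
  intro i
  fin_cases i
  · exact ((Complex.continuous_re.tendsto _).comp h1).const_mul 2
  · exact ((Complex.continuous_im.tendsto _).comp h1).const_mul 2
  · exact h2

namespace Jost

variable {ω : ℤ → ℂ} {h k U V : ℤ → ℂ → ℂ}

theorem lim_h (J : Jost ω h k U V) {z : ℂ} (hz : z ∈ closedBall (0 : ℂ) 1) :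
    Tendsto (fun j => h j z) atTop (𝓝 1) := by
  obtain ⟨η, hη, hb⟩ := J.lim_right
  rw [tendsto_iff_norm_sub_tendsto_zero]
  exact squeeze_zero (fun _ => norm_nonneg _) (fun j => (hb j z hz).1) hη

theorem lim_k (J : Jost ω h k U V) {z : ℂ} (hz : z ∈ closedBall (0 : ℂ) 1) :
    Tendsto (fun j => k j z) atTop (𝓝 0) := by
  obtain ⟨η, hη, hb⟩ := J.lim_right
  exact squeeze_zero_norm (fun j => (hb j z hz).2) hη

theorem lim_U (J : Jost ω h k U V) {z : ℂ} (hz : z ∈ closedBall (0 : ℂ) 1) :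
    Tendsto (fun j => U j z) atBot (𝓝 1) := by
  obtain ⟨η, hη, hb⟩ := J.lim_left
  rw [tendsto_iff_norm_sub_tendsto_zero]
  exact squeeze_zero (fun _ => norm_nonneg _) (fun j => (hb j z hz).1) hη

theorem lim_V (J : Jost ω h k U V) {z : ℂ} (hz : z ∈ closedBall (0 : ℂ) 1) :
    Tendsto (fun j => V j z) atBot (𝓝 0) := by
  obtain ⟨η, hη, hb⟩ := J.lim_left
  exact squeeze_zero_norm (fun j => (hb j z hz).2) hη

theorem next_h (J : Jost ω h k U V) (j : ℤ) {z : ℂ} (hz : z ∈ closedBall (0 : ℂ) 1) :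
    h (j + 1) z = cosP ω j * h j z + conj (sinP ω j) * k j z := by
  rw [J.step_h j z hz, J.step_k j z hz]
  linear_combination -h (j + 1) z * cosP_sq_add ω j

theorem next_k (J : Jost ω h k U V) (j : ℤ) {z : ℂ} (hz : z ∈ closedBall (0 : ℂ) 1) :
    z * k (j + 1) z = -sinP ω j * h j z + cosP ω j * k j z := by
  rw [J.step_h j z hz, J.step_k j z hz]
  linear_combination -z * k (j + 1) z * cosP_sq_add ω j

theorem prev_U (J : Jost ω h k U V) (j : ℤ) {z : ℂ} (hz : z ∈ closedBall (0 : ℂ) 1) :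
    z * U j z = cosP ω j * (z * U (j + 1) z) - sinP ω j * V (j + 1) z := by
  rw [J.step_U j z hz, J.step_V j z hz]
  linear_combination -z * U j z * cosP_sq_add ω j

theorem prev_V (J : Jost ω h k U V) (j : ℤ) {z : ℂ} (hz : z ∈ closedBall (0 : ℂ) 1) :
    z * V j z = conj (sinP ω j) * (z * U (j + 1) z) + cosP ω j * V (j + 1) z := by
  rw [J.step_U j z hz, J.step_V j z hz]
  linear_combination -z * V j z * cosP_sq_add ω j

theorem V_zero (J : Jost ω h k U V) (j : ℤ) : V j 0 = 0 := by
  have := J.step_V (j - 1) 0 zero_mem_unitClosedBall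
  simpa using this

/-- `a` does not depend on the time. -/
theorem a_eq (J : Jost ω h k U V) (j : ℤ) {z : ℂ} (hz : z ∈ closedBall (0 : ℂ) 1) :
    h j z * U j z + k j z * V j z = h 0 z * U 0 z + k 0 z * V 0 z := by
  have key : ∀ j, h (j + 1) z * U (j + 1) z + k (j + 1) z * V (j + 1) z =
      h j z * U j z + k j z * V j z := by
    intro j
    rw [J.step_U j z hz, J.step_V j z hz, J.next_h j hz]
    have := J.next_k j hz
    linear_combination (h j z * U j z + k j z * V j z) * cosP_sq_add ω j +
      (-conj (sinP ω j) * U j z + cosP ω j * V j z) * this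
  induction j using Int.induction_on with
  | zero => rfl
  | succ i ih => rw [key, ih]
  | pred i ih => rw [← ih, ← key (-(i : ℤ) - 1), sub_add_cancel]

theorem unit_right (J : Jost ω h k U V) (j : ℤ) (w : Circle) :
    h j w * conj (h j w) + k j w * conj (k j w) = 1 := by
  have hw := circle_mem_closedBall w
  have := eq_zero_of_periodic_atTop
    (d := fun j => Complex.normSq (h j w) + Complex.normSq (k j w) - 1) (fun j => by
      have e := normSq_transfer (cosP_sq_add ω j) (h (j + 1) w) (w * k (j + 1) w)
      rw [map_mul, w.normSq_coe, one_mul] at e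
      rw [J.step_h j w hw, J.step_k j w hw, e]) (by
      have e1 := (Complex.continuous_normSq.tendsto 1).comp (J.lim_h hw)
      have e2 := (Complex.continuous_normSq.tendsto 0).comp (J.lim_k hw)
      simpa using (e1.add e2).sub_const 1) j
  rw [Complex.mul_conj, Complex.mul_conj, ← Complex.ofReal_add, sub_eq_zero.1 this,
    Complex.ofReal_one]

theorem unit_left (J : Jost ω h k U V) (j : ℤ) (w : Circle) :
    U j w * conj (U j w) + V j w * conj (V j w) = 1 := by
  have hw := circle_mem_closedBall w
  have := eq_zero_of_periodic_atBot
    (d := fun j => Complex.normSq (U j w) + Complex.normSq (V j w) - 1) (fun j => by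
      have e := normSq_transfer (c := cosP ω j) (s := -conj (sinP ω j)) (by
        have := cosP_sq_add ω j
        simp only [map_neg, Complex.conj_conj]
        linear_combination this) (U j w) (V j w)
      rw [J.step_U j w hw, J.step_V j w hw, map_mul, w.normSq_coe, one_mul, ← e]
      simp) (by
      have e1 := (Complex.continuous_normSq.tendsto 1).comp (J.lim_U hw)
      have e2 := (Complex.continuous_normSq.tendsto 0).comp (J.lim_V hw)
      simpa using (e1.add e2).sub_const 1) j
  rw [Complex.mul_conj, Complex.mul_conj, ← Complex.ofReal_add, sub_eq_zero.1 this,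
    Complex.ofReal_one]

end Jost

end HardPulse

namespace HardPulse

/-! ### Uniqueness of Jost solutions and the scattering relation -/

theorem zsStep_iff {ω : ℤ → ℂ} {j : ℤ} {w A B A' B' : ℂ} :
    ZSStep (potential ω j) w A B A' B' ↔
      A' = cosP ω j * A + sinP ω j * B ∧
        B' = w * (-conj (sinP ω j) * A + cosP ω j * B) := by
  have : conj (sinP ω j) = conj (potential ω j) / ‖potential ω j‖ *
      Real.sin ‖potential ω j‖ := by
    simp only [sinP, map_mul, map_div₀, Complex.conj_ofReal]
  rw [this]
  rfl

namespace Jost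

variable {ω : ℤ → ℂ} {h k U V : ℤ → ℂ → ℂ}

theorem isLeftJost (J : Jost ω h k U V) : IsLeftJost ω U V where
  analytic_A := J.dU
  analytic_B := J.dV
  step j w := zsStep_iff.2 ⟨J.step_U j w (circle_mem_closedBall w),
    J.step_V j w (circle_mem_closedBall w)⟩
  tendsto_A w := J.lim_U (circle_mem_closedBall w)
  tendsto_B w := J.lim_V (circle_mem_closedBall w)

theorem conj_next_h (J : Jost ω h k U V) (j : ℤ) (w : Circle) :
    conj (h (j + 1) w) = cosP ω j * conj (h j w) + sinP ω j * conj (k j w) := by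
  rw [J.next_h j (circle_mem_closedBall w)]
  simp

theorem conj_next_k (J : Jost ω h k U V) (j : ℤ) (w : Circle) :
    conj (k (j + 1) w) = w * (-conj (sinP ω j) * conj (h j w) + cosP ω j * conj (k j w)) := by
  have e := congrArg conj (J.next_k j (circle_mem_closedBall w))
  simp only [map_mul, map_add, map_neg, Complex.conj_ofReal] at e
  rw [← e, ← mul_assoc, circle_mul_conj, one_mul]

theorem isRightJostConj (J : Jost ω h k U V) : IsRightJostConj ω h k where
  analytic_A := J.dh
  analytic_B := J.dk
  step j w := zsStep_iff.2 ⟨J.conj_next_h j w, J.conj_next_k j w⟩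
  tendsto_A w := J.lim_h (circle_mem_closedBall w)
  tendsto_B w := J.lim_k (circle_mem_closedBall w)

end Jost

theorem normSq_step {c : ℝ} {s : ℂ} (hc : (c : ℂ) ^ 2 + s * conj s = 1) (w : Circle) (x y : ℂ) :
    Complex.normSq (c * x + s * y) + Complex.normSq (w * (-conj s * x + c * y)) =
      Complex.normSq x + Complex.normSq y := by
  have e := normSq_transfer (c := c) (s := -conj s) (by
    simp only [map_neg, Complex.conj_conj]
    linear_combination hc) x y
  rw [map_mul, w.normSq_coe, one_mul, ← e]
  simp

/-- Two solutions on the circle with the same limit at `-∞` agree. -/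
theorem zs_unique {ω : ℤ → ℂ} {w : Circle} {l : Filter ℤ} (hl : l = atTop ∨ l = atBot)
    {A B A' B' : ℤ → ℂ}
    (h : ∀ j, ZSStep (potential ω j) w (A j) (B j) (A (j + 1)) (B (j + 1)))
    (h' : ∀ j, ZSStep (potential ω j) w (A' j) (B' j) (A' (j + 1)) (B' (j + 1)))
    (hA : Tendsto (fun j => A j - A' j) l (𝓝 0)) (hB : Tendsto (fun j => B j - B' j) l (𝓝 0))
    (j : ℤ) : A j = A' j ∧ B j = B' j := by
  have hd : ∀ j, Complex.normSq (A (j + 1) - A' (j + 1)) +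
      Complex.normSq (B (j + 1) - B' (j + 1)) =
      Complex.normSq (A j - A' j) + Complex.normSq (B j - B' j) := by
    intro j
    obtain ⟨e1, e2⟩ := zsStep_iff.1 (h j)
    obtain ⟨e3, e4⟩ := zsStep_iff.1 (h' j)
    rw [← normSq_step (cosP_sq_add ω j) w (A j - A' j) (B j - B' j), e1, e2, e3, e4]
    congr 2 <;> ring
  have hlim : Tendsto (fun j => Complex.normSq (A j - A' j) + Complex.normSq (B j - B' j))
      l (𝓝 0) := by
    have e1 := (Complex.continuous_normSq.tendsto 0).comp hA
    have e2 := (Complex.continuous_normSq.tendsto 0).comp hB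
    simpa [Function.comp_def] using e1.add e2
  have h0 : Complex.normSq (A j - A' j) + Complex.normSq (B j - B' j) = 0 := by
    rcases hl with rfl | rfl
    · exact eq_zero_of_periodic_atTop hd hlim j
    · exact eq_zero_of_periodic_atBot hd hlim j
  rw [add_eq_zero_iff_of_nonneg (Complex.normSq_nonneg _) (Complex.normSq_nonneg _),
    Complex.normSq_eq_zero, Complex.normSq_eq_zero] at h0
  exact ⟨sub_eq_zero.1 h0.1, sub_eq_zero.1 h0.2⟩

theorem IsLeftJost.unique {ω : ℤ → ℂ} {A B A' B' : ℤ → ℂ → ℂ} (H : IsLeftJost ω A B)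
    (H' : IsLeftJost ω A' B') (j : ℤ) {z : ℂ} (hz : z ∈ closedBall (0 : ℂ) 1) :
    A j z = A' j z ∧ B j z = B' j z := by
  have key : ∀ w : Circle, A j w = A' j w ∧ B j w = B' j w := fun w =>
    zs_unique (Or.inr rfl) (fun j => H.step j w) (fun j => H'.step j w)
      (by simpa using (H.tendsto_A w).sub (H'.tendsto_A w))
      (by simpa using (H.tendsto_B w).sub (H'.tendsto_B w)) j
  exact ⟨DA.eq_of_circle (H.analytic_A j) (H'.analytic_A j) (fun w => (key w).1) hz,
    DA.eq_of_circle (H.analytic_B j) (H'.analytic_B j) (fun w => (key w).2) hz⟩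

theorem IsRightJostConj.unique {ω : ℤ → ℂ} {A B A' B' : ℤ → ℂ → ℂ} (H : IsRightJostConj ω A B)
    (H' : IsRightJostConj ω A' B') (j : ℤ) {z : ℂ} (hz : z ∈ closedBall (0 : ℂ) 1) :
    A j z = A' j z ∧ B j z = B' j z := by
  have lim : ∀ {f g : ℤ → ℂ} {c : ℂ}, Tendsto f atTop (𝓝 c) → Tendsto g atTop (𝓝 c) →
      Tendsto (fun j => conj (f j) - conj (g j)) atTop (𝓝 0) := by
    intro f g c hf hg
    have := (Complex.continuous_conj.tendsto 0).comp (by simpa using hf.sub hg)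
    simpa [Function.comp_def] using this
  have key : ∀ w : Circle, A j w = A' j w ∧ B j w = B' j w := fun w => by
    have := zs_unique (Or.inl rfl) (fun j => H.step j w) (fun j => H'.step j w)
      (lim (H.tendsto_A w) (H'.tendsto_A w)) (lim (H.tendsto_B w) (H'.tendsto_B w)) j
    exact ⟨(starRingEnd ℂ).injective this.1, (starRingEnd ℂ).injective this.2⟩
  exact ⟨DA.eq_of_circle (H.analytic_A j) (H'.analytic_A j) (fun w => (key w).1) hz,
    DA.eq_of_circle (H.analytic_B j) (H'.analytic_B j) (fun w => (key w).2) hz⟩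

namespace Jost

variable {ω : ℤ → ℂ} {h k U V : ℤ → ℂ → ℂ}

/-- This is the Wronskian of the two solutions (conj h, conj k) and (U, V); the transfer matrix has
determinant w. -/
theorem b_eq (J : Jost ω h k U V) (j : ℤ) (w : Circle) :
    conj (h j w) * V j w - conj (k j w) * U j w =
      (w : ℂ) ^ j * (conj (h 0 w) * V 0 w - conj (k 0 w) * U 0 w) := by
  have key : ∀ j, conj (h (j + 1) w) * V (j + 1) w - conj (k (j + 1) w) * U (j + 1) w =
      w * (conj (h j w) * V j w - conj (k j w) * U j w) := by
    intro j
    rw [J.conj_next_h, J.conj_next_k, J.step_U j w (circle_mem_closedBall w),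
      J.step_V j w (circle_mem_closedBall w)]
    linear_combination w * (conj (h j w) * V j w - conj (k j w) * U j w) * cosP_sq_add ω j
  induction j using Int.induction_on with
  | zero => rw [zpow_zero, one_mul]
  | succ i ih => rw [key, ih, zpow_add_one₀ w.coe_ne_zero]; ring
  | pred i ih =>
    have := key (-(i : ℤ) - 1)
    rw [sub_add_cancel, ih] at this
    rw [zpow_sub_one₀ w.coe_ne_zero]
    apply mul_left_cancel₀ w.coe_ne_zero
    rw [← this, mul_assoc, mul_left_comm, mul_inv_cancel_left₀ w.coe_ne_zero]

/-- Since |h|^2 + |k|^2 = 1, the vectors (conj h, conj k) and (-k, h) form an orthonormal basis. The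
left solution has coordinates a and b w^j in it. -/
theorem circ_U (J : Jost ω h k U V) (j : ℤ) (w : Circle) :
    U j w = (h 0 w * U 0 w + k 0 w * V 0 w) * conj (h j w) -
      (conj (h 0 w) * V 0 w - conj (k 0 w) * U 0 w) * (w : ℂ) ^ j * k j w := by
  have e := J.b_eq j w
  rw [← J.a_eq j (circle_mem_closedBall w)]
  linear_combination -U j w * J.unit_right j w - k j w * e

theorem circ_V (J : Jost ω h k U V) (j : ℤ) (w : Circle) :
    V j w = (h 0 w * U 0 w + k 0 w * V 0 w) * conj (k j w) +
      (conj (h 0 w) * V 0 w - conj (k 0 w) * U 0 w) * (w : ℂ) ^ j * h j w := by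
  have e := J.b_eq j w
  rw [← J.a_eq j (circle_mem_closedBall w)]
  linear_combination -V j w * J.unit_right j w + h j w * e

theorem unit_ab (J : Jost ω h k U V) (w : Circle) :
    (h 0 w * U 0 w + k 0 w * V 0 w) * conj (h 0 w * U 0 w + k 0 w * V 0 w) +
      (conj (h 0 w) * V 0 w - conj (k 0 w) * U 0 w) *
        conj (conj (h 0 w) * V 0 w - conj (k 0 w) * U 0 w) = 1 := by
  have e1 := J.unit_right 0 w
  have e2 := J.unit_left 0 w
  simp only [map_add, map_sub, map_mul, Complex.conj_conj]
  linear_combination (U 0 w * conj (U 0 w) + V 0 w * conj (V 0 w)) * e1 + e2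

/-- The image of (U, V) under the spinor map solves the Bloch recursion, and after undoing the
precession its spinor tends to (a, b). Any other admissible magnetization agrees with it, because
rotations preserve the length of the difference, which tends to zero at the left end. -/
theorem transformsTo_iff_spin (J : Jost ω h k U V)
    (M : Circle → sphere (0 : EuclideanSpace ℝ (Fin 3)) 1) :
    TransformsTo ω M ↔ ∀ w : Circle, spin (h 0 w * U 0 w + k 0 w * V 0 w)
      (conj (h 0 w) * V 0 w - conj (k 0 w) * U 0 w) = (M w).1.ofLp := by
  have hstep : ∀ (w : Circle) j, spin (U (j + 1) w) (V (j + 1) w) =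
      precession w *ᵥ rotation (ω j) (spin (U j w) (V j w)) := by
    intro w j
    rw [rotation_spin, precession_mulVec_spin, ← J.step_U j w (circle_mem_closedBall w),
      ← J.step_V j w (circle_mem_closedBall w)]
  have hbot : ∀ w : Circle, Tendsto (fun j => spin (U j w) (V j w)) atBot (𝓝 ![0, 0, 1]) := by
    intro w
    have := tendsto_spin (J.lim_U (circle_mem_closedBall w)) (J.lim_V (circle_mem_closedBall w))
    have e : spin 1 0 = ![0, 0, 1] := by simp [spin]
    rwa [e] at this
  have htop : ∀ w : Circle, Tendsto (fun j : ℤ => precession (w ^ (-j)) *ᵥ spin (U j w) (V j w))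
      atTop (𝓝 (spin (h 0 w * U 0 w + k 0 w * V 0 w)
        (conj (h 0 w) * V 0 w - conj (k 0 w) * U 0 w))) := by
    intro w
    have hw := circle_mem_closedBall w
    have lh := J.lim_h hw
    have lk := J.lim_k hw
    have lh' := (Complex.continuous_conj.tendsto 1).comp lh
    rw [map_one] at lh'
    have hk : Tendsto (fun j => ‖k j w‖) atTop (𝓝 0) := by simpa using lk.norm
    simp only [precession_mulVec_spin]
    refine tendsto_spin ?_ ?_
    · have e : Tendsto (fun j : ℤ => (w : ℂ) ^ j * k j w) atTop (𝓝 0) :=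
        squeeze_zero_norm (fun j => by
          rw [norm_mul, norm_zpow, w.norm_coe, one_zpow, one_mul]) hk
      have := (lh'.const_mul (h 0 w * U 0 w + k 0 w * V 0 w)).sub
        (e.const_mul (conj (h 0 w) * V 0 w - conj (k 0 w) * U 0 w))
      rw [mul_one, mul_zero, sub_zero] at this
      refine this.congr fun j => ?_
      rw [J.circ_U j w, Function.comp_apply]; ring
    · have e : Tendsto (fun j : ℤ => (w : ℂ) ^ (-j) * conj (k j w)) atTop (𝓝 0) :=
        squeeze_zero_norm (fun j => by
          rw [norm_mul, norm_zpow, w.norm_coe, one_zpow, one_mul, RCLike.norm_conj]) hk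
      have := (e.const_mul (h 0 w * U 0 w + k 0 w * V 0 w)).add
        (lh.const_mul (conj (h 0 w) * V 0 w - conj (k 0 w) * U 0 w))
      rw [mul_one, mul_zero, zero_add] at this
      refine this.congr fun j => ?_
      have hj : (w : ℂ) ^ (-j) * (w : ℂ) ^ j = 1 := by
        rw [← zpow_add₀ w.coe_ne_zero]; simp
      rw [J.circ_V j w, Circle.coe_zpow]
      linear_combination -(conj (h 0 w) * V 0 w - conj (k 0 w) * U 0 w) * h j w * hj
  constructor
  · rintro ⟨m, h1, h2, h3⟩ w
    have hm : ∀ j, m w j = spin (U j w) (V j w) := by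
      intro j
      have := eq_zero_of_periodic_atBot
        (d := fun j => (m w j - spin (U j w) (V j w)) ⬝ᵥ (m w j - spin (U j w) (V j w)))
        (fun j => by
          rw [h1, hstep, ← Matrix.mulVec_sub, ← rotation_sub, precession_dotProduct_self,
            rotation_dotProduct_self])
        (by
          have e := (h2 w).sub (hbot w)
          rw [sub_self] at e
          have hc : Continuous fun v : Fin 3 → ℝ => v ⬝ᵥ v := by
            unfold dotProduct; fun_prop
          have := (hc.tendsto 0).comp e
          simpa [Function.comp_def] using this) j
      exact sub_eq_zero.1 (dotProduct_self_eq_zero.1 this)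
    refine tendsto_nhds_unique (htop w) ?_
    simpa only [hm] using h3 w
  · intro H
    exact ⟨fun w j => spin (U j w) (V j w), fun w j => hstep w j, hbot,
      fun w => by rw [← H w]; exact htop w⟩

end Jost

/-! ### Stereographic projection and the reflection coefficient -/

theorem sphere_sq (v : sphere (0 : EuclideanSpace ℝ (Fin 3)) 1) :
    v.1 0 ^ 2 + v.1 1 ^ 2 + v.1 2 ^ 2 = 1 := by
  have h := mem_sphere_zero_iff_norm.1 v.2
  rw [EuclideanSpace.norm_eq, Real.sqrt_eq_one, Fin.sum_univ_three] at h
  simpa using h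

/-- Stereographic projection. -/
theorem spin_eq_iff {M : Circle → sphere (0 : EuclideanSpace ℝ (Fin 3)) 1} {w : Circle}
    (hM : (M w).1 2 ≠ -1) {a b : ℂ} (hab : a * conj a + b * conj b = 1) :
    spin a b = (M w).1.ofLp ↔ b = reflectionCoeff M w * a := by
  have hs := sphere_sq (M w)
  unfold reflectionCoeff
  set X := (M w).1 0
  set Y := (M w).1 1
  set Z := (M w).1 2
  have hZ : (1 + Z : ℂ) ≠ 0 := by
    intro h
    apply hM
    have : (1 + Z : ℝ) = 0 := by exact_mod_cast h
    linarith
  have hs' : (X : ℂ) ^ 2 + Y ^ 2 + Z ^ 2 = 1 := by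
    rw [← Complex.ofReal_one, ← hs]; push_cast; rfl
  have hspin : spin a b = (M w).1.ofLp ↔
      2 * (conj a * b) = X + Y * Complex.I ∧ a * conj a - b * conj b = Z := by
    rw [funext_iff, Fin.forall_fin_succ, Fin.forall_fin_two]
    constructor
    · rintro ⟨h0, h1, h2⟩
      constructor
      · have h0' : 2 * (conj a * b).re = X := h0
        have h1' : 2 * (conj a * b).im = Y := h1
        rw [← h0', ← h1', ← Complex.re_add_im (conj a * b)]
        push_cast
        simp
        ring
      · rw [Complex.mul_conj, Complex.mul_conj, ← Complex.ofReal_sub]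
        exact congrArg _ h2
    · rintro ⟨h0, h1⟩
      refine ⟨?_, ?_, ?_⟩
      · have := congrArg Complex.re h0
        simp at this
        change 2 * (conj a * b).re = X
        simp; linarith
      · have := congrArg Complex.im h0
        simp at this
        change 2 * (conj a * b).im = Y
        simp; linarith
      · rw [Complex.mul_conj, Complex.mul_conj, ← Complex.ofReal_sub] at h1
        exact_mod_cast h1
  rw [hspin]
  have hI := Complex.I_sq
  constructor
  · rintro ⟨h0, h1⟩
    rw [← h0, ← h1]
    have ha : a ≠ 0 := by
      rintro rfl
      apply hZ
      rw [← h1]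
      linear_combination -hab
    have h2 : 1 + (a * conj a - b * conj b) = 2 * (a * conj a) := by linear_combination -hab
    have hc : conj a ≠ 0 := by simpa using ha
    rw [h2]
    field_simp
  · intro hb
    have hcb : conj b = (X - Y * Complex.I) / (1 + Z) * conj a := by
      rw [hb]
      simp [sub_eq_add_neg]
    have h2 : 2 * (a * conj a) = 1 + Z := by
      have e : a * conj a * ((1 + Z) ^ 2 + X ^ 2 + Y ^ 2) = (1 + Z) ^ 2 := by
        rw [hcb, hb] at hab
        field_simp at hab
        linear_combination hab + (a * conj a * Y ^ 2) * hI
      have e2 : (1 + Z : ℂ) * (2 * (a * conj a)) = (1 + Z) * (1 + Z) := by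
        linear_combination e - a * conj a * hs'
      exact mul_left_cancel₀ hZ e2
    refine ⟨?_, by linear_combination h2 - hab⟩
    rw [hb]
    field_simp
    linear_combination (X + Y * Complex.I) * h2

theorem Jost.transformsTo_iff {ω : ℤ → ℂ} {h k U V : ℤ → ℂ → ℂ} (J : Jost ω h k U V)
    {M : Circle → sphere (0 : EuclideanSpace ℝ (Fin 3)) 1} (hM : ∀ w, (M w).1 2 ≠ -1) :
    TransformsTo ω M ↔ ∀ w : Circle, conj (h 0 w) * V 0 w - conj (k 0 w) * U 0 w =
      reflectionCoeff M w * (h 0 w * U 0 w + k 0 w * V 0 w) := by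
  rw [J.transformsTo_iff_spin]
  exact forall_congr' fun w => spin_eq_iff (hM w) (J.unit_ab w)

end HardPulse

namespace HardPulse

/-! ### Fourier series on the circle -/

instance fact_two_pi_pos : Fact (0 < 2 * Real.pi) := ⟨Real.two_pi_pos⟩

/-- The point of the circle with a given angle. -/
def pt (x : AddCircle (2 * Real.pi)) : Circle := x.toCircle

theorem continuous_pt : Continuous pt := AddCircle.continuous_toCircle

theorem pt_coe (θ : ℝ) : pt (θ : AddCircle (2 * Real.pi)) = Circle.exp θ := by
  rw [pt, AddCircle.toCircle_apply_mk, div_self Real.two_pi_pos.ne', one_mul]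

theorem pt_add (x y : AddCircle (2 * Real.pi)) : pt (x + y) = pt x * pt y :=
  AddCircle.toCircle_add x y

theorem pt_surjective (w : Circle) : ∃ x, pt x = w :=
  ⟨((Complex.arg w : ℝ) : AddCircle (2 * Real.pi)), by rw [pt_coe, Circle.exp_arg]⟩

theorem fourier_eq_pt_zpow (n : ℤ) (x : AddCircle (2 * Real.pi)) :
    fourier n x = (pt x : ℂ) ^ n := by
  rw [fourier_apply, AddCircle.toCircle_zsmul, Circle.coe_zpow, pt]

/-- The average of a function over the circle. -/
def avg {E : Type*} [NormedAddCommGroup E] [NormedSpace ℝ E] (F : Circle → E) : E :=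
  ∫ x : AddCircle (2 * Real.pi), F (pt x) ∂AddCircle.haarAddCircle

/-- The Fourier coefficients of a function on the circle. -/
def fc (F : Circle → ℂ) (n : ℤ) : ℂ := avg fun w => (w : ℂ) ^ (-n) * F w

theorem fc_eq_fourierCoeff (F : Circle → ℂ) (n : ℤ) :
    fc F n = fourierCoeff (fun x : AddCircle (2 * Real.pi) => F (pt x)) n := by
  simp only [fc, avg, fourierCoeff, fourier_eq_pt_zpow, smul_eq_mul]

section avg

variable {E : Type*} [NormedAddCommGroup E]

theorem integrable_comp_pt {F : Circle → E} (hF : Continuous F) :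
    Integrable (fun x => F (pt x)) (AddCircle.haarAddCircle (T := 2 * Real.pi)) :=
  (hF.comp continuous_pt).integrable_of_hasCompactSupport (HasCompactSupport.of_compactSpace _)

variable [NormedSpace ℝ E]

theorem avg_add {F G : Circle → E} (hF : Continuous F) (hG : Continuous G) :
    avg (fun w => F w + G w) = avg F + avg G :=
  integral_add (integrable_comp_pt hF) (integrable_comp_pt hG)

theorem avg_sub {F G : Circle → E} (hF : Continuous F) (hG : Continuous G) :
    avg (fun w => F w - G w) = avg F - avg G :=
  integral_sub (integrable_comp_pt hF) (integrable_comp_pt hG)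

theorem avg_mono {F G : Circle → ℝ} (hF : Continuous F) (hG : Continuous G)
    (h : ∀ w, F w ≤ G w) : avg F ≤ avg G :=
  integral_mono (integrable_comp_pt hF) (integrable_comp_pt hG) fun _ => h _

theorem avg_nonneg {F : Circle → ℝ} (h : ∀ w, 0 ≤ F w) : 0 ≤ avg F :=
  integral_nonneg fun _ => h _

theorem avg_const [CompleteSpace E] (c : E) : avg (fun _ => c) = c := by
  simp [avg]

theorem avg_const_mul (c : ℝ) (F : Circle → ℝ) : avg (fun w => c * F w) = c * avg F :=
  integral_const_mul _ _

theorem avg_const_mul' (c : ℂ) (F : Circle → ℂ) : avg (fun w => c * F w) = c * avg F :=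
  integral_const_mul _ _

theorem avg_conj (F : Circle → ℂ) : avg (fun w => conj (F w)) = conj (avg F) :=
  integral_conj

theorem avg_ofReal (F : Circle → ℝ) : avg (fun w => (F w : ℂ)) = avg F :=
  integral_ofReal

theorem avg_mul_left (F : Circle → E) (u : Circle) : avg (fun w => F (u * w)) = avg F := by
  obtain ⟨y, rfl⟩ := pt_surjective u
  simp only [avg, ← pt_add]
  exact integral_add_left_eq_self (fun x => F (pt x)) y

theorem eq_zero_of_avg_eq_zero {F : Circle → ℝ} (hF : Continuous F) (h0 : ∀ w, 0 ≤ F w)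
    (h : avg F = 0) (w : Circle) : F w = 0 := by
  obtain ⟨x, rfl⟩ := pt_surjective w
  have h1 := (integral_eq_zero_iff_of_nonneg (fun x => h0 (pt x)) (integrable_comp_pt hF)).1 h
  have h2 := (Continuous.ae_eq_iff_eq AddCircle.haarAddCircle (hF.comp continuous_pt)
    continuous_const).1 h1
  exact congrFun h2 x

theorem avg_eq_intervalIntegral (F : Circle → E) :
    avg F = (2 * Real.pi)⁻¹ • ∫ θ in (0 : ℝ)..(2 * Real.pi), F (Circle.exp θ) := by
  have h := AddCircle.intervalIntegral_preimage (2 * Real.pi) 0 fun x => F (pt x)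
  simp only [pt_coe, zero_add] at h
  rw [h, avg, AddCircle.integral_haarAddCircle]

end avg

theorem avg_DA {f : ℂ → ℂ} (hf : DA f) : avg (fun w => f w) = f 0 := by
  have h := DiffContOnCl.circleAverage (f := f) (c := 0) (R := 1) (by simpa using hf)
  rw [avg_eq_intervalIntegral, ← h, Real.circleAverage]
  congr 1
  refine intervalIntegral.integral_congr fun θ _ => ?_
  simp [circleMap]

theorem fc_DA_neg {f : ℂ → ℂ} (hf : DA f) {n : ℕ} (hn : n ≠ 0) :
    fc (fun w => f w) (-(n : ℤ)) = 0 := by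
  have h := avg_DA ((DA.pow' n).mul hf)
  simp only [zero_pow hn, zero_mul] at h
  simpa [fc] using h

theorem fc_DA_zero {f : ℂ → ℂ} (hf : DA f) : fc (fun w => f w) 0 = f 0 := by
  have h := avg_DA hf
  simpa [fc] using h

theorem hasSum_sq_fc {F : Circle → ℂ} (hF : Continuous F) :
    HasSum (fun n => ‖fc F n‖ ^ 2) (avg fun w => ‖F w‖ ^ 2) := by
  let f : C(AddCircle (2 * Real.pi), ℂ) := ⟨fun x => F (pt x), hF.comp continuous_pt⟩
  have h := hasSum_sq_fourierCoeff (ContinuousMap.toLp 2 AddCircle.haarAddCircle ℂ f)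
  simp only [fourierCoeff_toLp] at h
  convert h using 1
  · ext n; rw [fc_eq_fourierCoeff]; rfl
  · refine integral_congr_ae ?_
    filter_upwards [ContinuousMap.coeFn_toLp (p := 2) (𝕜 := ℂ) AddCircle.haarAddCircle f] with x hx
    rw [hx]; rfl

theorem hasSum_fc {F : Circle → ℂ} (hF : Continuous F) (hs : Summable (fc F)) (w : Circle) :
    HasSum (fun n => fc F n * (w : ℂ) ^ n) (F w) := by
  obtain ⟨x, rfl⟩ := pt_surjective w
  let f : C(AddCircle (2 * Real.pi), ℂ) := ⟨fun x => F (pt x), hF.comp continuous_pt⟩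
  have e : fourierCoeff f = fc F := by ext n; rw [fc_eq_fourierCoeff]; rfl
  have h := has_pointwise_sum_fourier_series_of_summable (f := f) (by rwa [e]) x
  rw [e] at h
  simp only [fourier_eq_pt_zpow, smul_eq_mul] at h
  exact h

theorem fc_rotate (F : Circle → ℂ) (u : Circle) (n : ℤ) :
    fc (fun w => F (u * w)) n = (u : ℂ) ^ n * fc F n := by
  have h := avg_mul_left (fun w : Circle => (w : ℂ) ^ (-n) * F w) u
  rw [fc, fc, ← h, ← avg_const_mul']
  congr 1
  ext w
  have hu : (u : ℂ) ^ n * (u : ℂ) ^ (-n) = 1 := by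
    rw [← zpow_add₀ u.coe_ne_zero, add_neg_cancel, zpow_zero]
  rw [Circle.coe_mul, mul_zpow]
  linear_combination -(w : ℂ) ^ (-n) * F (u * w) * hu

theorem continuous_circle_zpow (n : ℤ) : Continuous fun w : Circle => (w : ℂ) ^ n := by
  have : Continuous fun w : Circle => ((w ^ n : Circle) : ℂ) :=
    continuous_circle_coe.comp (continuous_zpow _)
  simpa only [Circle.coe_zpow] using this

theorem fc_sub {F G : Circle → ℂ} (hF : Continuous F) (hG : Continuous G) (n : ℤ) :
    fc (fun w => F w - G w) n = fc F n - fc G n := by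
  have hz := continuous_circle_zpow (-n)
  have h := avg_sub (hz.mul hF) (hz.mul hG)
  simp only [fc, mul_sub]
  exact h

/-- The class `H¹` of the circle, described by difference quotients in the mean. -/
def SobolevLip (F : Circle → ℂ) : Prop :=
  Continuous F ∧ ∃ C : ℝ, ∀ t : ℝ, avg (fun w => ‖F (Circle.exp t * w) - F w‖ ^ 2) ≤ C * t ^ 2

theorem hasSum_sq_fc_diff {F : Circle → ℂ} (hF : Continuous F) (u : Circle) :
    HasSum (fun n : ℤ => ‖(u : ℂ) ^ n - 1‖ ^ 2 * ‖fc F n‖ ^ 2)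
      (avg fun w => ‖F (u * w) - F w‖ ^ 2) := by
  have hG : Continuous fun w => F (u * w) := hF.comp (continuous_const_mul u)
  have h : HasSum (fun n => ‖fc (fun w => F (u * w) - F w) n‖ ^ 2)
    (avg fun w => ‖F (u * w) - F w‖ ^ 2) := hasSum_sq_fc (hG.sub hF)
  convert h using 2 with n
  rw [← mul_pow, ← norm_mul, sub_mul, one_mul, ← fc_rotate, ← fc_sub hG hF]

theorem exp_zpow (t : ℝ) (n : ℤ) :
    ((Circle.exp t : Circle) : ℂ) ^ n = Complex.exp (n * t * Complex.I) := by
  rw [Circle.coe_exp, ← Complex.exp_int_mul]; congr 1; ring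

theorem tendsto_exp_sub_one_div (n : ℤ) :
    Tendsto (fun t : ℝ => ‖((Circle.exp t : Circle) : ℂ) ^ n - 1‖ ^ 2 / t ^ 2) (𝓝[≠] 0)
      (𝓝 ((n : ℝ) ^ 2)) := by
  have hd : HasDerivAt (fun t : ℝ => Complex.exp (n * t * Complex.I))
      (Complex.exp (n * (0 : ℝ) * Complex.I) * (n * 1 * Complex.I)) 0 :=
    (((Complex.ofRealCLM.hasDerivAt (x := (0 : ℝ))).const_mul (n : ℂ)).mul_const Complex.I).cexp
  have h1 := (hd.tendsto_slope.norm).pow 2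
  have e : ‖Complex.exp (n * (0 : ℝ) * Complex.I) * (n * 1 * Complex.I)‖ ^ 2 = (n : ℝ) ^ 2 := by
    simp
  rw [e] at h1
  refine h1.congr fun t => ?_
  rw [exp_zpow, slope_def_module, norm_smul, mul_pow]
  simp
  ring

namespace SobolevLip

variable {F G : Circle → ℂ}

/-- Parseval for the difference F(e^(it) w) - F(w) has weights |e^(int) - 1|^2. Divide a finite
partial sum by t^2 and let t tend to zero. -/
theorem summable_sq (hF : SobolevLip F) : Summable fun n : ℤ => (n : ℝ) ^ 2 * ‖fc F n‖ ^ 2 := by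
  obtain ⟨hc, C, hC⟩ := hF
  refine summable_of_sum_le (c := C) (fun n => by positivity) fun s => ?_
  have hlim : Tendsto (fun t : ℝ => ∑ n ∈ s,
      ‖((Circle.exp t : Circle) : ℂ) ^ n - 1‖ ^ 2 / t ^ 2 * ‖fc F n‖ ^ 2) (𝓝[≠] 0)
      (𝓝 (∑ n ∈ s, (n : ℝ) ^ 2 * ‖fc F n‖ ^ 2)) :=
    tendsto_finsetSum _ fun n _ => (tendsto_exp_sub_one_div n).mul_const _
  refine le_of_tendsto hlim ?_
  filter_upwards [self_mem_nhdsWithin] with t ht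
  have ht : t ≠ 0 := ht
  have ht2 : 0 < t ^ 2 := by positivity
  have h := (sum_le_hasSum s (fun n _ => by positivity)
    (hasSum_sq_fc_diff hc (Circle.exp t))).trans (hC t)
  rw [← div_le_iff₀ ht2, Finset.sum_div] at h
  refine le_of_eq_of_le (Finset.sum_congr rfl fun n _ => ?_) h
  ring

theorem of_summable_sq (hc : Continuous F)
    (hs : Summable fun n : ℤ => (n : ℝ) ^ 2 * ‖fc F n‖ ^ 2) : SobolevLip F := by
  refine ⟨hc, ∑' n : ℤ, (n : ℝ) ^ 2 * ‖fc F n‖ ^ 2, fun t => ?_⟩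
  refine hasSum_le (fun n => ?_) (hasSum_sq_fc_diff hc (Circle.exp t))
    (hs.hasSum.mul_right (t ^ 2))
  have h1 : ‖((Circle.exp t : Circle) : ℂ) ^ n - 1‖ ≤ |(n : ℝ) * t| := by
    rw [exp_zpow]
    have := Real.norm_exp_I_mul_ofReal_sub_one_le (x := n * t)
    rw [Real.norm_eq_abs] at this
    refine le_of_eq_of_le ?_ this
    congr 3
    push_cast; ring
  have h2 : ‖((Circle.exp t : Circle) : ℂ) ^ n - 1‖ ^ 2 ≤ (n : ℝ) ^ 2 * t ^ 2 := by
    rw [← mul_pow, ← sq_abs ((n : ℝ) * t)]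
    exact pow_le_pow_left₀ (norm_nonneg _) h1 2
  nlinarith [sq_nonneg ‖fc F n‖]

/-- The inequality 2 |f_n| ≤ n^(-2) + n^2 |f_n|^2 makes H^1 part of the Wiener algebra. -/
theorem summable_norm (hF : SobolevLip F) : Summable fun n : ℤ => ‖fc F n‖ := by
  have h1 : Summable fun n : ℤ => 1 / (n : ℝ) ^ 2 := Real.summable_one_div_int_pow.2 one_lt_two
  have h2 := h1.add hF.summable_sq
  -- Both terms of the majorant are 0 at n = 0, where 1/0 is read as 0, so the mean needs its own
  -- term.
  have h3 : Summable fun n : ℤ => if n = 0 then ‖fc F 0‖ else 0 := by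
    refine summable_of_ne_finset_zero (s := {0}) fun n hn => ?_
    rw [if_neg (by simpa using hn)]
  refine Summable.of_nonneg_of_le (fun n => norm_nonneg _) (fun n => ?_) (h2.add h3)
  by_cases hn : n = 0
  · subst hn; simp
  · rw [if_neg hn, add_zero]
    have hn' : (0 : ℝ) < (n : ℝ) ^ 2 := by
      have : (n : ℝ) ≠ 0 := by exact_mod_cast hn
      positivity
    have e : (1 / (n : ℝ) ^ 2) * (n : ℝ) ^ 2 = 1 := by field_simp
    have hp : 0 < 1 / (n : ℝ) ^ 2 := by positivity
    have key : 2 * ‖fc F n‖ ≤ 1 / (n : ℝ) ^ 2 + (n : ℝ) ^ 2 * ‖fc F n‖ ^ 2 := by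
      have := mul_nonneg hp.le (sq_nonneg (1 - (n : ℝ) ^ 2 * ‖fc F n‖))
      have e2 : 1 / (n : ℝ) ^ 2 * (1 - (n : ℝ) ^ 2 * ‖fc F n‖) ^ 2 =
        1 / (n : ℝ) ^ 2 + (n : ℝ) ^ 2 * ‖fc F n‖ ^ 2 - 2 * ‖fc F n‖ := by
        field_simp; ring
      linarith
    linarith [norm_nonneg (fc F n)]

/-- Closure of `H¹` under Lipschitz operations. -/
theorem of_le {f g : Circle → ℂ} (hf : SobolevLip f) (hg : SobolevLip g) (hc : Continuous F)
    (K : ℝ) (h : ∀ u v, ‖F u - F v‖ ≤ K * (‖f u - f v‖ + ‖g u - g v‖)) : SobolevLip F := by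
  obtain ⟨cf, C, hC⟩ := hf
  obtain ⟨cg, C', hC'⟩ := hg
  refine ⟨hc, 2 * K ^ 2 * (C + C'), fun t => ?_⟩
  have cF : ∀ {f : Circle → ℂ}, Continuous f →
      Continuous fun w => ‖f (Circle.exp t * w) - f w‖ ^ 2 := fun hf =>
    ((hf.comp (continuous_const_mul _)).sub hf).norm.pow 2
  calc avg (fun w => ‖F (Circle.exp t * w) - F w‖ ^ 2)
      ≤ avg (fun w => 2 * K ^ 2 * (‖f (Circle.exp t * w) - f w‖ ^ 2 +
        ‖g (Circle.exp t * w) - g w‖ ^ 2)) := by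
        refine avg_mono (cF hc) (continuous_const.mul ((cF cf).add (cF cg))) fun w => ?_
        have h1 := pow_le_pow_left₀ (norm_nonneg _) (h (Circle.exp t * w) w) 2
        rw [mul_pow] at h1
        refine h1.trans ?_
        nlinarith [mul_nonneg (sq_nonneg K) (sq_nonneg (‖f (Circle.exp t * w) - f w‖ -
          ‖g (Circle.exp t * w) - g w‖))]
    _ = 2 * K ^ 2 * (avg (fun w => ‖f (Circle.exp t * w) - f w‖ ^ 2) +
        avg (fun w => ‖g (Circle.exp t * w) - g w‖ ^ 2)) := by
        rw [avg_const_mul, avg_add (cF cf) (cF cg)]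
    _ ≤ 2 * K ^ 2 * (C * t ^ 2 + C' * t ^ 2) := by
        have := hC t
        have := hC' t
        gcongr
    _ = 2 * K ^ 2 * (C + C') * t ^ 2 := by ring

theorem of_le_single {f : Circle → ℂ} (hf : SobolevLip f) (hc : Continuous F)
    (K : ℝ) (h : ∀ u v, ‖F u - F v‖ ≤ K * ‖f u - f v‖) : SobolevLip F :=
  hf.of_le hf hc (K / 2) fun u v => (h u v).trans_eq (by ring)

theorem const (c : ℂ) : SobolevLip fun _ => c :=
  ⟨continuous_const, 0, fun t => by simp [avg]⟩

theorem coe : SobolevLip fun w => (w : ℂ) := by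
  refine ⟨continuous_circle_coe, 1, fun t => ?_⟩
  rw [← avg_const (1 * t ^ 2)]
  refine avg_mono ?_ continuous_const fun w => ?_
  · exact ((continuous_circle_coe.comp (continuous_const_mul _)).sub
      continuous_circle_coe).norm.pow 2
  · change ‖((Circle.exp t * w : Circle) : ℂ) - w‖ ^ 2 ≤ _
    rw [Circle.coe_mul, ← sub_one_mul, norm_mul, w.norm_coe, mul_one, one_mul, ← sq_abs t]
    refine pow_le_pow_left₀ (norm_nonneg _) ?_ 2
    have := Real.norm_exp_I_mul_ofReal_sub_one_le (x := t)
    rwa [mul_comm, ← Circle.coe_exp, Real.norm_eq_abs] at this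

theorem exists_bound (hF : Continuous F) : ∃ B : ℝ, 0 ≤ B ∧ ∀ w, ‖F w‖ ≤ B := by
  obtain ⟨B, hB⟩ := isCompact_univ.exists_bound_of_continuousOn hF.continuousOn
  exact ⟨B, (norm_nonneg _).trans (hB 1 trivial), fun w => hB w trivial⟩

theorem add (hF : SobolevLip F) (hG : SobolevLip G) : SobolevLip fun w => F w + G w :=
  hF.of_le hG (hF.1.add hG.1) 1 fun u v => by
    rw [one_mul, add_sub_add_comm]; exact norm_add_le _ _

theorem mul (hF : SobolevLip F) (hG : SobolevLip G) : SobolevLip fun w => F w * G w := by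
  obtain ⟨B, hB, hb⟩ := exists_bound hF.1
  obtain ⟨B', hB', hb'⟩ := exists_bound hG.1
  refine hF.of_le hG (hF.1.mul hG.1) (B + B') fun u v => ?_
  have e : F u * G u - F v * G v = (F u - F v) * G u + F v * (G u - G v) := by ring
  rw [e]
  refine (norm_add_le _ _).trans ?_
  rw [norm_mul, norm_mul]
  nlinarith [hb v, hb' u, norm_nonneg (F u - F v), norm_nonneg (G u - G v),
    mul_le_mul_of_nonneg_left (hb' u) (norm_nonneg (F u - F v)),
    mul_le_mul_of_nonneg_right (hb v) (norm_nonneg (G u - G v))]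

theorem neg (hF : SobolevLip F) : SobolevLip fun w => -F w :=
  hF.of_le_single hF.1.neg 1 fun u v => by rw [one_mul, neg_sub_neg, norm_sub_rev]

theorem sub (hF : SobolevLip F) (hG : SobolevLip G) : SobolevLip fun w => F w - G w := by
  simpa only [sub_eq_add_neg] using hF.add hG.neg

theorem conj' (hF : SobolevLip F) : SobolevLip fun w => conj (F w) :=
  hF.of_le_single (Complex.continuous_conj.comp hF.1) 1 fun u v => by
    rw [one_mul, ← map_sub, RCLike.norm_conj]

theorem inv (hF : SobolevLip F) (h0 : ∀ w, F w ≠ 0) : SobolevLip fun w => (F w)⁻¹ := by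
  have hc : Continuous fun w => (F w)⁻¹ := hF.1.inv₀ h0
  obtain ⟨B, hB, hb⟩ := exists_bound hc
  refine hF.of_le_single hc (B * B) fun u v => ?_
  rw [inv_sub_inv (h0 u) (h0 v), norm_div, norm_mul, div_eq_mul_inv, mul_inv, ← norm_inv,
    ← norm_inv, norm_sub_rev, mul_comm]
  have h1 := hb u
  have h2 := hb v
  gcongr

theorem div (hF : SobolevLip F) (hG : SobolevLip G) (h0 : ∀ w, G w ≠ 0) :
    SobolevLip fun w => F w / G w := by
  simpa only [div_eq_mul_inv] using hF.mul (hG.inv h0)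

theorem polynomial (p : Polynomial ℂ) : SobolevLip fun w => p.eval (w : ℂ) := by
  induction p using Polynomial.induction_on' with
  | add p q hp hq => simpa using hp.add hq
  | monomial n c =>
    simp only [Polynomial.eval_monomial]
    refine (const c).mul ?_
    induction n with
    | zero => simpa using const 1
    | succ n ih => simpa only [pow_succ] using ih.mul coe

/-- Composition with a continuously differentiable function. -/
theorem comp_contDiff {Φ : ℂ → ℂ} (hΦ : ContDiff ℝ 1 Φ) (hF : SobolevLip F) :
    SobolevLip fun w => Φ (F w) := by
  obtain ⟨B, -, hb⟩ := exists_bound hF.1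
  obtain ⟨K, hK⟩ := ContDiffOn.exists_lipschitzOnWith
    (hΦ.contDiffOn (s := closedBall (0 : ℂ) B)) one_ne_zero (convex_closedBall 0 B)
    (isCompact_closedBall 0 B)
  refine hF.of_le_single (hΦ.continuous.comp hF.1) K fun u v => ?_
  have := hK.dist_le_mul (F u) (by simpa using hb u) (F v) (by simpa using hb v)
  rwa [dist_eq_norm, dist_eq_norm] at this

end SobolevLip

/-- Testing the weak derivative against e^(-inθ) gives the coefficients i n f_n, which are square
summable. From here on only the difference quotient form is used, as it passes easily through
products, inverses, exp and log. -/
theorem MemH1.sobolevLip {F : Circle → ℂ} (hF : MemH1 F) : SobolevLip F := by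
  obtain ⟨hc, g, hg, hw⟩ := hF
  refine SobolevLip.of_summable_sq hc ?_
  have hP := (hasSum_sq_fourierCoeffOn Real.two_pi_pos hg).summable
  refine hP.congr fun n => ?_
  rw [← mul_pow, ← sq_abs ((n : ℝ) * _), abs_mul, abs_norm]
  congr 1
  let φ : ℝ → ℂ := fun θ => Complex.exp (-(n * θ * Complex.I))
  have hφd : ∀ θ : ℝ, HasDerivAt φ (-(n * Complex.I) * φ θ) θ := by
    intro θ
    have : HasDerivAt φ (φ θ * -(n * 1 * Complex.I)) θ :=
      ((((Complex.ofRealCLM.hasDerivAt (x := θ)).const_mul (n : ℂ)).mul_const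
        Complex.I).fun_neg).cexp
    convert this using 1
    ring
  have hφc : ContDiff ℝ ((⊤ : ℕ∞) : WithTop ℕ∞) φ := by
    simp only [φ]
    have : ContDiff ℝ ((⊤ : ℕ∞) : WithTop ℕ∞) (fun θ : ℝ => (θ : ℂ)) := Complex.ofRealCLM.contDiff
    fun_prop
  have hφp : Function.Periodic φ (2 * Real.pi) := by
    intro θ
    simp only [φ]
    rw [Complex.exp_eq_exp_iff_exists_int]
    exact ⟨-n, by push_cast; ring⟩
  have key := hw φ hφc hφp
  have hφz : ∀ θ : ℝ, φ θ = ((Circle.exp θ : Circle) : ℂ) ^ (-n) := by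
    intro θ
    rw [exp_zpow]
    simp only [φ]
    congr 1
    push_cast; ring
  have e1 : (∫ θ in (0 : ℝ)..(2 * Real.pi), F (Circle.exp θ) * deriv φ θ) =
      -(n * Complex.I) * ((2 * Real.pi) * fc F n) := by
    rw [fc, avg_eq_intervalIntegral, Complex.real_smul, ← mul_assoc (2 * (Real.pi : ℂ))]
    have : (2 * (Real.pi : ℂ)) * (((2 * Real.pi)⁻¹ : ℝ) : ℂ) = 1 := by
      have := Real.pi_ne_zero
      push_cast
      field_simp
    rw [this, one_mul, ← intervalIntegral.integral_const_mul]
    refine intervalIntegral.integral_congr fun θ _ => ?_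
    rw [(hφd θ).deriv, hφz]; ring
  have e2 : fourierCoeffOn Real.two_pi_pos (fun θ => g (Circle.exp θ)) n =
      (2 * Real.pi)⁻¹ * ∫ θ in (0 : ℝ)..(2 * Real.pi), g (Circle.exp θ) * φ θ := by
    rw [fourierCoeffOn_eq_integral, sub_zero, one_div, Complex.real_smul]
    push_cast
    congr 1
    refine intervalIntegral.integral_congr fun θ _ => ?_
    rw [fourier_eq_pt_zpow, pt_coe, ← hφz, smul_eq_mul, mul_comm]
  rw [e1] at key
  have e3 : (∫ θ in (0 : ℝ)..(2 * Real.pi), g (Circle.exp θ) * φ θ) =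
      n * Complex.I * ((2 * Real.pi) * fc F n) := by linear_combination key
  have e4 : (((2 * Real.pi)⁻¹ : ℝ) : ℂ) * (n * Complex.I * ((2 * Real.pi) * fc F n)) =
      n * Complex.I * fc F n := by
    have := Real.pi_ne_zero
    push_cast
    field_simp
  rw [e2, e3, e4]
  simp

end HardPulse

namespace HardPulse

/-! ### Decay of the reflection data -/

theorem hasSum_avg {ι : Type*} [Countable ι] {f : ι → Circle → ℂ} {u : ι → ℝ}
    (hc : ∀ n, Continuous (f n)) (hu : Summable u) (hb : ∀ n w, ‖f n w‖ ≤ u n) :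
    HasSum (fun n => avg (f n)) (avg fun w => ∑' n, f n w) := by
  refine hasSum_integral_of_summable_integral_norm (fun n => integrable_comp_pt (hc n)) ?_
  refine Summable.of_nonneg_of_le (fun n => integral_nonneg fun x => norm_nonneg _)
    (fun n => ?_) hu
  have := integral_mono (integrable_comp_pt (hc n)).norm (integrable_const (u n))
    fun x => hb n (pt x)
  simpa using this

theorem hasSum_avg_mul {F G : Circle → ℂ} (hF : Continuous F) (hs : Summable fun n => ‖fc F n‖)
    (hG : Continuous G) : HasSum (fun n : ℤ => fc F n * fc G (-n)) (avg fun w => F w * G w) := by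
  obtain ⟨B, hB0, hB⟩ := SobolevLip.exists_bound hG
  have h := hasSum_avg (f := fun (n : ℤ) (w : Circle) => fc F n * ((w : ℂ) ^ n * G w))
    (fun n => continuous_const.mul ((continuous_circle_zpow n).mul hG)) (hs.mul_right B)
    fun n w => by
      rw [norm_mul, norm_mul, norm_zpow, w.norm_coe, one_zpow, one_mul]
      exact mul_le_mul_of_nonneg_left (hB w) (norm_nonneg _)
  have e1 : ∀ n : ℤ, avg (fun w : Circle => fc F n * ((w : ℂ) ^ n * G w)) =
      fc F n * fc G (-n) := by
    intro n
    rw [avg_const_mul', fc, fc, neg_neg]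
  have e2 : (fun w : Circle => ∑' n : ℤ, fc F n * ((w : ℂ) ^ n * G w)) = fun w => F w * G w := by
    ext w
    have := (hasSum_fc hF hs.of_norm w).mul_right (G w)
    rw [← this.tsum_eq]
    exact tsum_congr fun n => (mul_assoc _ _ _).symm
  rw [e2] at h
  simpa only [e1] using h

theorem fc_zpow_mul (G : Circle → ℂ) (j n : ℤ) :
    fc (fun w => (w : ℂ) ^ j * G w) n = fc G (n - j) := by
  rw [fc, fc]
  congr 1
  ext w
  rw [← mul_assoc, ← zpow_add₀ w.coe_ne_zero]
  congr 2
  ring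

/-- Pairing with the boundary values of a disk algebra function only involves the nonpositive
frequencies. -/
theorem hasSum_avg_mul_DA {F : Circle → ℂ} (hF : Continuous F)
    (hs : Summable fun n => ‖fc F n‖) {g : ℂ → ℂ} (hg : DA g) (j : ℕ) :
    HasSum (fun m : ℕ => fc F (-((j + m : ℕ) : ℤ)) * fc (fun w => g w) m)
      (avg fun w => F w * ((w : ℂ) ^ (j : ℤ) * g w)) := by
  have h : HasSum (fun n : ℤ => fc F n * fc (fun w : Circle => (w : ℂ) ^ (j : ℤ) * g w) (-n))
    (avg fun w => F w * ((w : ℂ) ^ (j : ℤ) * g w)) :=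
    hasSum_avg_mul hF hs ((continuous_circle_zpow j).mul hg.continuous_circle)
  have hinj : Function.Injective fun m : ℕ => -((j + m : ℕ) : ℤ) := fun m n hmn => by
    simpa using hmn
  rw [← hinj.hasSum_iff] at h
  · convert h using 2 with m
    rw [Function.comp_apply]
    congr 1
    have := fc_zpow_mul (fun w : Circle => g w) j (-(-((j + m : ℕ) : ℤ)))
    refine Eq.trans ?_ this.symm
    congr 1
    push_cast; ring
  · intro n hn
    have := fc_zpow_mul (fun w : Circle => g w) j (-n)
    rw [mul_eq_zero]
    right
    refine this.trans ?_
    have hlt : 0 < j + n := by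
      by_contra hle
      exact hn ⟨(-(j + n)).toNat, by
        simp only
        push_cast
        rw [Int.toNat_of_nonneg (by omega)]; ring⟩
    have e : -n - (j : ℤ) = -((j + n).toNat : ℤ) := by rw [Int.toNat_of_nonneg hlt.le]; ring
    rw [e]
    exact fc_DA_neg hg (by omega)

variable {r : Circle → ℂ} {a : ℂ → ℂ} {E E' : Polynomial ℂ}

/-- The symbol of the Hankel operators of the scattering problem. -/
def hankelSymbol (r : Circle → ℂ) (a : ℂ → ℂ) (E : Polynomial ℂ) (w : Circle) : ℂ :=
  r w - E.eval (w : ℂ) / a w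

theorem ScatData.sobolev_symbol (D : ScatData r a E E') (hr : SobolevLip r)
    (ha : SobolevLip fun w => a w) : SobolevLip (hankelSymbol r a E) :=
  hr.sub ((SobolevLip.polynomial E).div ha D.ne_zero)

theorem ScatData.sobolev_dual (D : ScatData r a E E') (hr : SobolevLip r)
    (ha : SobolevLip fun w => a w) : SobolevLip (dualCoeff r a) :=
  ((hr.conj'.mul ha.conj').div ha D.ne_zero).neg

/-- Along antidiagonals the double sum is the sum of (n + 1) |f_(-n)|^2, so half a derivative would
suffice. This is the Hilbert-Schmidt norm of the Hankel operator. -/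
theorem summable_tail_sq {F : Circle → ℂ} (hF : SobolevLip F) :
    Summable fun p : ℕ × ℕ => ‖fc F (-((p.1 + p.2 : ℕ) : ℤ))‖ ^ 2 := by
  have hinj : Function.Injective fun m : ℕ => -(m : ℤ) := fun m n hmn => by simpa using hmn
  have h1 := (hasSum_sq_fc hF.1).summable.comp_injective hinj
  have h2 := hF.summable_sq.comp_injective hinj
  rw [← (Finset.HasAntidiagonal.sigmaAntidiagonalEquivProd (A := ℕ)).summable_iff]
  refine (summable_sigma_of_nonneg (fun x => by exact sq_nonneg _)).2
    ⟨fun n => (hasSum_fintype _).summable, ?_⟩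
  refine Summable.of_nonneg_of_le (fun n => tsum_nonneg fun x => by exact sq_nonneg _)
    (fun n => ?_) (h1.add h2)
  have e : ∀ x : Finset.HasAntidiagonal.antidiagonal n, ((fun p : ℕ × ℕ => ‖fc F (-((p.1 + p.2 : ℕ) : ℤ))‖ ^ 2) ∘
      (Finset.HasAntidiagonal.sigmaAntidiagonalEquivProd (A := ℕ))) ⟨n, x⟩ = ‖fc F (-(n : ℤ))‖ ^ 2 := by
    intro x
    have := Finset.HasAntidiagonal.mem_antidiagonal.1 x.2
    simp only [Function.comp_apply, Finset.HasAntidiagonal.sigmaAntidiagonalEquivProd_apply]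
    rw [this]
  rw [tsum_congr e, tsum_fintype, Finset.sum_const, Finset.card_univ, Fintype.card_coe,
    Finset.Nat.card_antidiagonal, nsmul_eq_mul]
  simp only [Function.comp_apply]
  push_cast
  have hn : (n : ℝ) ≤ (n : ℝ) ^ 2 := by exact_mod_cast Nat.le_self_pow two_ne_zero n
  nlinarith [sq_nonneg ‖fc F (-(n : ℤ))‖]

theorem norm_tsum_mul_le {f g : ℕ → ℂ} (hf : Summable fun m => ‖f m‖ ^ 2)
    (hg : Summable fun m => ‖g m‖ ^ 2) :
    Summable (fun m => f m * g m) ∧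
      ‖∑' m, f m * g m‖ ≤ ((∑' m, ‖f m‖ ^ 2) + ∑' m, ‖g m‖ ^ 2) / 2 := by
  have hb : ∀ m, ‖f m * g m‖ ≤ (‖f m‖ ^ 2 + ‖g m‖ ^ 2) / 2 := fun m => by
    rw [norm_mul]; nlinarith [sq_nonneg (‖f m‖ - ‖g m‖)]
  have hS := (hf.hasSum.add hg.hasSum).div_const 2
  exact ⟨Summable.of_norm_bounded hS.summable hb, tsum_of_norm_bounded hS hb⟩

/-- A priori bounds for normalized solutions at nonnegative times. -/
theorem NSol.bounds {j : ℕ} {h k U V : ℂ → ℂ} (S : NSol r a E j h k U V)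
    (D : ScatData r a E E') (hr : SobolevLip r) (ha : SobolevLip fun w => a w) {t : ℝ}
    (ht : 0 < t) (h0 : h 0 = t) :
    1 - t ^ 2 ≤ ∑' m : ℕ, ‖fc (hankelSymbol r a E) (-((j + m : ℕ) : ℤ))‖ ^ 2 ∧
    ‖k 0‖ ≤ ‖fc (hankelSymbol r a E) (-(j : ℤ))‖ +
      ∑' m : ℕ, ‖fc (hankelSymbol r a E) (-((j + m : ℕ) : ℤ))‖ ^ 2 := by
  have hF := D.sobolev_symbol hr ha
  set F := hankelSymbol r a E with hFdef
  set T := ∑' m : ℕ, ‖fc F (-((j + m : ℕ) : ℤ))‖ ^ 2 with hT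
  have hTs : Summable fun m : ℕ => ‖fc F (-((j + m : ℕ) : ℤ))‖ ^ 2 :=
    (summable_tail_sq hF).prod_factor j
  have hEj : DA fun z => E.eval z * z ^ (j : ℤ) := by
    simp only [zpow_natCast]; exact (DA.poly E).mul (DA.pow' j)
  -- The quotients by a are analytic, with boundary values conj h - F w^j k and conj k + F w^j h.
  -- Their mean values express h(0) and k(0) through pairings with F that see only frequencies ≤ -j
  -- of F.
  obtain ⟨q₁, dq₁, e₁⟩ := S.dvd_U.exists_mul_eq D.da (S.dU.add' (hEj.mul S.dk)) D.ne_zero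
    D.zero_ne_zero
  obtain ⟨q₂, dq₂, e₂⟩ := S.dvd_V.exists_mul_eq D.da (S.dV.sub' (hEj.mul S.dh)) D.ne_zero
    D.zero_ne_zero
  have c₁ : ∀ w : Circle, q₁ w = conj (h w) - F w * ((w : ℂ) ^ (j : ℤ) * k w) := by
    intro w
    have hw := D.ne_zero w
    have e := e₁ w (circle_mem_closedBall w)
    rw [S.circ_U] at e
    apply mul_left_cancel₀ hw
    rw [← e, hFdef, hankelSymbol]
    field_simp
    ring
  have c₂ : ∀ w : Circle, q₂ w = conj (k w) + F w * ((w : ℂ) ^ (j : ℤ) * h w) := by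
    intro w
    have hw := D.ne_zero w
    have e := e₂ w (circle_mem_closedBall w)
    rw [S.circ_V] at e
    apply mul_left_cancel₀ hw
    rw [← e, hFdef, hankelSymbol]
    field_simp
    ring
  have ch := S.dh.continuous_circle
  have ck := S.dk.continuous_circle
  have cj := continuous_circle_zpow (j : ℤ)
  have m₁ : q₁ 0 = conj (h 0) - avg (fun w : Circle => F w * ((w : ℂ) ^ (j : ℤ) * k w)) := by
    rw [← avg_DA dq₁, ← avg_DA S.dh, ← avg_conj]
    simp only [c₁]
    exact avg_sub (Complex.continuous_conj.comp ch) (hF.1.mul (cj.mul ck))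
  have m₂ : q₂ 0 = conj (k 0) + avg (fun w : Circle => F w * ((w : ℂ) ^ (j : ℤ) * h w)) := by
    rw [← avg_DA dq₂, ← avg_DA S.dk, ← avg_conj]
    simp only [c₂]
    exact avg_add (Complex.continuous_conj.comp ck) (hF.1.mul (cj.mul ch))
  -- At the origin E = 0 and V = 0, so a(0) = h(0) U(0) = t a(0) q₁(0).
  have v₁ : (t : ℂ) * q₁ 0 = 1 := by
    have e := e₁ 0 zero_mem_unitClosedBall
    have e' := S.mul_add_mul D zero_mem_unitClosedBall
    simp only [D.eval_zero, zero_mul, add_zero, S.V_zero, mul_zero, h0] at e e'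
    apply mul_left_cancel₀ D.zero_ne_zero
    rw [e] at e'
    linear_combination e'
  have v₂ : q₂ 0 = 0 := by
    have e := e₂ 0 zero_mem_unitClosedBall
    simp only [D.eval_zero, zero_mul, sub_zero, S.V_zero] at e
    exact (mul_eq_zero.1 e.symm).resolve_left D.zero_ne_zero
  have s₁ := hasSum_avg_mul_DA hF.1 hF.summable_norm S.dk j
  have s₂ := hasSum_avg_mul_DA hF.1 hF.summable_norm S.dh j
  -- Parseval
  have P₁ := hasSum_sq_fc ch
  have P₂ := hasSum_sq_fc ck
  have Ptot : avg (fun w : Circle => ‖h w‖ ^ 2) + avg (fun w : Circle => ‖k w‖ ^ 2) = 1 := by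
    have e := avg_add (ch.norm.pow 2) (ck.norm.pow 2)
    refine e.symm.trans ?_
    rw [← avg_const (1 : ℝ)]
    refine congrArg avg (funext fun w => ?_)
    have := S.unit w
    rw [Complex.mul_conj', Complex.mul_conj'] at this
    exact_mod_cast this
  have hinj : Function.Injective fun m : ℕ => (m : ℤ) := Nat.cast_injective
  have hinj' : Function.Injective fun m : ℕ => ((m + 1 : ℕ) : ℤ) := fun m n hmn => by
    simpa using hmn
  have sk : Summable fun m : ℕ => ‖fc (fun w => k w) m‖ ^ 2 := P₂.summable.comp_injective hinj
  have sh : Summable fun m : ℕ => ‖fc (fun w => h w) m‖ ^ 2 := P₁.summable.comp_injective hinj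
  have sh' : Summable fun m : ℕ => ‖fc (fun w => h w) (m + 1 : ℕ)‖ ^ 2 :=
    P₁.summable.comp_injective hinj'
  have lk : ∑' m : ℕ, ‖fc (fun w => k w) m‖ ^ 2 ≤ avg (fun w : Circle => ‖k w‖ ^ 2) := by
    rw [← P₂.tsum_eq]
    exact sk.tsum_le_tsum_of_inj _ hinj (fun _ _ => sq_nonneg _) (fun _ => le_rfl) P₂.summable
  have lh : ∑' m : ℕ, ‖fc (fun w => h w) m‖ ^ 2 ≤ avg (fun w : Circle => ‖h w‖ ^ 2) := by
    rw [← P₁.tsum_eq]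
    exact sh.tsum_le_tsum_of_inj _ hinj (fun _ _ => sq_nonneg _) (fun _ => le_rfl) P₁.summable
  have f0 : fc (fun w => h w) 0 = t := by rw [fc_DA_zero S.dh, h0]
  have lh' : t ^ 2 + ∑' m : ℕ, ‖fc (fun w => h w) (m + 1 : ℕ)‖ ^ 2 ≤
      avg (fun w : Circle => ‖h w‖ ^ 2) := by
    rw [sh.tsum_eq_zero_add] at lh
    rw [Nat.cast_zero, f0, Complex.norm_real, Real.norm_eq_abs, sq_abs] at lh
    exact lh
  have nh' : 0 ≤ ∑' m : ℕ, ‖fc (fun w => h w) (m + 1 : ℕ)‖ ^ 2 :=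
    tsum_nonneg fun _ => sq_nonneg _
  have nk : 0 ≤ ∑' m : ℕ, ‖fc (fun w => k w) m‖ ^ 2 := tsum_nonneg fun _ => sq_nonneg _
  have ht1 : t ^ 2 ≤ 1 := by
    have := avg_nonneg (F := fun w : Circle => ‖k w‖ ^ 2) fun _ => sq_nonneg _
    linarith
  have ht1' : t ≤ 1 := by nlinarith
  -- Here 1 - t^2 equals -t times the pairing of F with w^j k, which is at most (T + ‖k‖^2)/2 in
  -- modulus. As ‖k‖^2 ≤ 1 - t^2, the term with k is absorbed on the left.
  have first : 1 - t ^ 2 ≤ T := by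
    have b := (norm_tsum_mul_le hTs sk).2
    rw [s₁.tsum_eq] at b
    have e : (1 - t ^ 2 : ℂ) = -(t * avg (fun w : Circle => F w * ((w : ℂ) ^ (j : ℤ) * k w))) := by
      rw [h0, Complex.conj_ofReal] at m₁
      rw [m₁] at v₁
      linear_combination -v₁
    have e' : |1 - t ^ 2| = t * ‖avg (fun w : Circle => F w * ((w : ℂ) ^ (j : ℤ) * k w))‖ := by
      have := congrArg norm e
      rw [norm_neg, norm_mul, Complex.norm_real, Real.norm_of_nonneg ht.le] at this
      rw [← this, ← Real.norm_eq_abs, ← Complex.norm_real]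
      push_cast; rfl
    rw [abs_of_nonneg (by linarith)] at e'
    have : t * ‖avg (fun w : Circle => F w * ((w : ℂ) ^ (j : ℤ) * k w))‖ ≤
        1 * ((T + ∑' m : ℕ, ‖fc (fun w => k w) m‖ ^ 2) / 2) :=
      mul_le_mul ht1' b (norm_nonneg _) zero_le_one
    linarith
  refine ⟨first, ?_⟩
  have e : conj (k 0) = -avg (fun w : Circle => F w * ((w : ℂ) ^ (j : ℤ) * h w)) := by
    rw [v₂] at m₂; linear_combination -m₂
  have hTs' : Summable fun m : ℕ => ‖fc F (-((j + (m + 1) : ℕ) : ℤ))‖ ^ 2 :=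
    hTs.comp_injective (add_left_injective 1)
  have hT' : ∑' m : ℕ, ‖fc F (-((j + (m + 1) : ℕ) : ℤ))‖ ^ 2 ≤ T := by
    rw [hT, hTs.tsum_eq_zero_add]
    linarith [sq_nonneg ‖fc F (-((j + 0 : ℕ) : ℤ))‖]
  have b := (norm_tsum_mul_le hTs' sh').2
  -- Only the constant coefficient t of h yields a linear term in F. The others have square sum at
  -- most 1 - t^2 ≤ T, so their contribution is quadratic.
  have e2 : ‖k 0‖ = ‖fc F (-(j : ℤ)) * t +
      ∑' m : ℕ, fc F (-((j + (m + 1) : ℕ) : ℤ)) * fc (fun w => h w) (m + 1 : ℕ)‖ := by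
    rw [← RCLike.norm_conj (k 0), e, norm_neg, ← s₂.tsum_eq, s₂.summable.tsum_eq_zero_add,
      Nat.cast_zero, f0, add_zero]
  rw [e2]
  refine (norm_add_le _ _).trans ?_
  rw [norm_mul, Complex.norm_real, Real.norm_of_nonneg ht.le]
  have := mul_le_mul_of_nonneg_left ht1' (norm_nonneg (fc F (-(j : ℤ))))
  linarith

/-- The reflection parameters of a family of normalized solutions are summable. -/
theorem summable_of_nsol {h k U V : ℕ → ℂ → ℂ}
    (S : ∀ j : ℕ, NSol r a E j (h j) (k j) (U j) (V j)) (D : ScatData r a E E')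
    (hr : SobolevLip r) (ha : SobolevLip fun w => a w) :
    (Summable fun j : ℕ => ‖k j 0 / h j 0‖) ∧ Tendsto (fun j : ℕ => h j 0) atTop (𝓝 1) := by
  have hF := D.sobolev_symbol hr ha
  choose t ht h0 using fun j => (S j).pos
  set T : ℕ → ℝ := fun j => ∑' m : ℕ, ‖fc (hankelSymbol r a E) (-((j + m : ℕ) : ℤ))‖ ^ 2
  have hT : Summable T := (summable_tail_sq hF).prod
  have hb := fun j => (S j).bounds D hr ha (ht j) (h0 j)
  have hT0 : Tendsto T atTop (𝓝 0) := hT.tendsto_atTop_zero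
  have lim : Tendsto t atTop (𝓝 1) := by
    have hl : ∀ j, 1 - T j ≤ t j ∧ t j ≤ 1 + T j := by
      intro j
      have h1 : 1 - t j ^ 2 ≤ T j := (hb j).1
      have hT0 : 0 ≤ T j := tsum_nonneg fun _ => sq_nonneg _
      have h2 : t j ≤ 1 := by
        have hh := (S j).dh.norm_le_of_circle (C := 1) (fun w => by
          have := (S j).unit w
          rw [Complex.mul_conj', Complex.mul_conj'] at this
          have h3 : ‖h j w‖ ^ 2 + ‖k j w‖ ^ 2 = 1 := by exact_mod_cast this
          nlinarith [norm_nonneg (h j w), sq_nonneg ‖k j w‖]) zero_mem_unitClosedBall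
        rwa [h0, Complex.norm_real, Real.norm_of_nonneg (ht j).le] at hh
      have := ht j
      constructor <;> nlinarith
    refine tendsto_of_tendsto_of_tendsto_of_le_of_le
      (by simpa using (tendsto_const_nhds (x := (1 : ℝ))).sub hT0)
      (by simpa using (tendsto_const_nhds (x := (1 : ℝ))).add hT0) (fun j => (hl j).1)
      fun j => (hl j).2
  constructor
  · have hinj : Function.Injective fun m : ℕ => -(m : ℤ) := fun m n hmn => by simpa using hmn
    have hs := ((hF.summable_norm.comp_injective hinj).add hT).mul_left 2
    refine Summable.of_norm_bounded_eventually_nat hs ?_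
    -- Once h_j(0) exceeds 1/2, division by it costs the factor 2 in the majorant.
    filter_upwards [lim.eventually (lt_mem_nhds (by norm_num : (1 / 2 : ℝ) < 1))] with j hj
    rw [norm_norm, norm_div, h0, Complex.norm_real, Real.norm_of_nonneg (ht j).le,
      div_le_iff₀ (ht j)]
    have h2 : ‖k j 0‖ ≤ ‖fc (hankelSymbol r a E) (-(j : ℤ))‖ + T j := (hb j).2
    simp only [Function.comp_apply]
    nlinarith [norm_nonneg (k j 0)]
  · simp only [h0]
    exact_mod_cast (Complex.continuous_ofReal.tendsto 1).comp lim

end HardPulse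

namespace HardPulse

/-! ### Solving the scattering problem at a late time -/

/-- Each column of a Hankel matrix is a tail of κ, so its norm on l^1 is at most the l^1 norm of κ.
-/
theorem summable_hankel {κ x : ℕ → ℂ} (hκ : Summable fun n => ‖κ n‖)
    (hx : Summable fun n => ‖x n‖) :
    (∀ n, Summable fun m => ‖κ (n + m) * x m‖) ∧
      (Summable fun n => ‖∑' m, κ (n + m) * x m‖) ∧
      ∑' n, ‖∑' m, κ (n + m) * x m‖ ≤ (∑' n, ‖κ n‖) * ∑' n, ‖x n‖ := by
  have hshift : ∀ m, Summable fun n => ‖κ (n + m)‖ := fun m =>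
    hκ.comp_injective (add_left_injective m)
  have hle : ∀ m, ∑' n, ‖κ (n + m) * x m‖ ≤ (∑' n, ‖κ n‖) * ‖x m‖ := by
    intro m
    simp only [norm_mul]
    rw [tsum_mul_right]
    refine mul_le_mul_of_nonneg_right ?_ (norm_nonneg _)
    exact (hshift m).tsum_le_tsum_of_inj _ (add_left_injective m) (fun _ _ => norm_nonneg _)
      (fun _ => le_rfl) hκ
  have hs : Summable fun p : ℕ × ℕ => ‖κ (p.2 + p.1) * x p.1‖ := by
    have hnn : 0 ≤ fun p : ℕ × ℕ => ‖κ (p.2 + p.1) * x p.1‖ := fun p => by exact norm_nonneg _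
    refine (summable_prod_of_nonneg hnn).2 ⟨fun m => ?_, ?_⟩
    · simp only [norm_mul]
      exact (hshift m).mul_right _
    · exact Summable.of_nonneg_of_le (fun m => tsum_nonneg fun _ => norm_nonneg _) hle
        (hx.mul_left _)
  have hs' : Summable fun p : ℕ × ℕ => ‖κ (p.1 + p.2) * x p.2‖ :=
    hs.prod_symm
  have h1 : ∀ n, Summable fun m => ‖κ (n + m) * x m‖ := fun n => hs'.prod_factor n
  have h2 : Summable fun n => ∑' m, ‖κ (n + m) * x m‖ := hs'.prod
  have h3 : ∀ n, ‖∑' m, κ (n + m) * x m‖ ≤ ∑' m, ‖κ (n + m) * x m‖ := fun n =>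
    norm_tsum_le_tsum_norm (h1 n)
  have h4 : Summable fun n => ‖∑' m, κ (n + m) * x m‖ :=
    Summable.of_nonneg_of_le (fun n => norm_nonneg _) h3 h2
  refine ⟨h1, h4, (h4.tsum_le_tsum h3 h2).trans ?_⟩
  have e : ∑' n, ∑' m, ‖κ (n + m) * x m‖ = ∑' m, ∑' n, ‖κ (n + m) * x m‖ :=
    Summable.tsum_comm (f := fun m n => ‖κ (n + m) * x m‖) hs
  rw [e, ← tsum_mul_left]
  exact hs.prod.tsum_le_tsum hle (hx.mul_left _)

/-- The space `ℓ¹(ℕ)`. -/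
abbrev EllOne : Type := lp (fun _ : ℕ => ℂ) 1

theorem EllOne.summable (x : EllOne) : Summable fun n => ‖x n‖ := by
  have := (memℓp_gen_iff (by norm_num)).1 x.2
  simpa using this

theorem EllOne.norm_eq (x : EllOne) : ‖x‖ = ∑' n, ‖x n‖ := by
  have := lp.norm_eq_tsum_rpow (p := 1) (by norm_num) x
  simpa using this

theorem memℓp_one {x : ℕ → ℂ} (hx : Summable fun n => ‖x n‖) : Memℓp x 1 :=
  (memℓp_gen_iff (by norm_num)).2 (by simpa using hx)

/-- The conjugate linear Hankel operator `x ↦ conj (∑ κ (n + m) x m)` on `ℓ¹`. -/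
def hankelOp {κ : ℕ → ℂ} (hκ : Summable fun n => ‖κ n‖) (x : EllOne) : EllOne :=
  ⟨fun n => conj (∑' m, κ (n + m) * x m),
    memℓp_one (by simpa only [RCLike.norm_conj] using (summable_hankel hκ x.summable).2.1)⟩

theorem hankelOp_apply {κ : ℕ → ℂ} (hκ : Summable fun n => ‖κ n‖) (x : EllOne) (n : ℕ) :
    hankelOp hκ x n = conj (∑' m, κ (n + m) * x m) := rfl

theorem dist_hankelOp {κ : ℕ → ℂ} (hκ : Summable fun n => ‖κ n‖) (x y : EllOne) :
    dist (hankelOp hκ x) (hankelOp hκ y) ≤ (∑' n, ‖κ n‖) * dist x y := by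
  have e : hankelOp hκ x - hankelOp hκ y = hankelOp hκ (x - y) := by
    ext n
    rw [lp.coeFn_sub, Pi.sub_apply, hankelOp_apply, hankelOp_apply, hankelOp_apply, ← map_sub,
      ← Summable.tsum_sub ((summable_hankel hκ x.summable).1 n).of_norm
        ((summable_hankel hκ y.summable).1 n).of_norm]
    congr 1
    exact tsum_congr fun m => by rw [lp.coeFn_sub, Pi.sub_apply]; ring
  rw [dist_eq_norm, dist_eq_norm, e, EllOne.norm_eq, EllOne.norm_eq]
  simp only [hankelOp_apply, RCLike.norm_conj]
  exact (summable_hankel hκ (x - y).summable).2.2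

/-- With H the conjugate linear Hankel map, the second equation is y = -H x and the first becomes
the fixed point equation x = e + H(-H x), a contraction. -/
theorem exists_hankel_solution {κ : ℕ → ℂ} (hκ : Summable fun n => ‖κ n‖)
    (hle : ∑' n, ‖κ n‖ ≤ 1 / 2) :
    ∃ x y : ℕ → ℂ, (Summable fun n => ‖x n‖) ∧ (Summable fun n => ‖y n‖) ∧
      (∀ n, conj (x n) - ∑' m, κ (n + m) * y m = if n = 0 then 1 else 0) ∧
      ∀ n, conj (y n) + ∑' m, κ (n + m) * x m = 0 := by
  have hd : ∀ x y : EllOne, dist (hankelOp hκ x) (hankelOp hκ y) ≤ 1 / 2 * dist x y :=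
    fun x y => (dist_hankelOp hκ x y).trans (mul_le_mul_of_nonneg_right hle dist_nonneg)
  set e : EllOne := ⟨fun n => if n = 0 then 1 else 0, memℓp_one
    (summable_of_ne_finset_zero (s := {0}) fun n hn => by simp_all)⟩ with he
  set Φ : EllOne → EllOne := fun x => e + hankelOp hκ (-hankelOp hκ x) with hΦ
  have hc : ContractingWith (1 / 2) Φ := by
    refine ⟨by rw [← NNReal.coe_lt_coe]; norm_num, LipschitzWith.of_dist_le_mul fun x y => ?_⟩
    have h1 := hd (-hankelOp hκ x) (-hankelOp hκ y)
    rw [dist_neg_neg] at h1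
    have h2 := hd x y
    have h3 : dist (Φ x) (Φ y) =
      dist (hankelOp hκ (-hankelOp hκ x)) (hankelOp hκ (-hankelOp hκ y)) := dist_add_left _ _ _
    rw [h3]
    push_cast
    have := dist_nonneg (x := x) (y := y)
    linarith
  have hfix : Φ (ContractingWith.fixedPoint Φ hc) = ContractingWith.fixedPoint Φ hc :=
    hc.fixedPoint_isFixedPt
  set x := ContractingWith.fixedPoint Φ hc
  refine ⟨x, -hankelOp hκ x, x.summable, (-hankelOp hκ x).summable, fun n => ?_, fun n => ?_⟩
  · have := congrArg (fun y : EllOne => conj (y n)) hfix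
    simp only [hΦ, lp.coeFn_add, Pi.add_apply, map_add, hankelOp_apply, Complex.conj_conj] at this
    rw [← this, lp.coeFn_neg]
    rw [he]
    dsimp only
    split_ifs <;> simp
  · rw [Pi.neg_apply, hankelOp_apply, map_neg, Complex.conj_conj]
    ring

/-- The disk algebra function with absolutely summable Taylor coefficients `x`. -/
def powSum (x : ℕ → ℂ) (z : ℂ) : ℂ := ∑' n, x n * z ^ n

theorem norm_mul_pow_le {z : ℂ} (hz : z ∈ closedBall (0 : ℂ) 1) (c : ℂ) (n : ℕ) :
    ‖c * z ^ n‖ ≤ ‖c‖ := by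
  rw [norm_mul, norm_pow]
  exact mul_le_of_le_one_right (norm_nonneg _)
    (pow_le_one₀ (norm_nonneg _) (mem_closedBall_zero_iff.1 hz))

theorem DA.powSum {x : ℕ → ℂ} (hx : Summable fun n => ‖x n‖) : DA (powSum x) :=
  DA.tsum hx (fun n => (DA.pow' n).const_mul _) fun n _ hz => norm_mul_pow_le hz _ n

theorem powSum_zero (x : ℕ → ℂ) : powSum x 0 = x 0 := by
  rw [powSum, tsum_eq_single 0 fun n hn => by simp [hn]]; simp

theorem summable_mul_pow {x : ℕ → ℂ} (hx : Summable fun n => ‖x n‖) {z : ℂ}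
    (hz : z ∈ closedBall (0 : ℂ) 1) : Summable fun n => x n * z ^ n :=
  Summable.of_norm_bounded hx fun n => norm_mul_pow_le hz _ n

theorem conj_powSum (x : ℕ → ℂ) (w : Circle) :
    conj (powSum x w) = ∑' n : ℕ, conj (x n) * (w : ℂ) ^ (-(n : ℤ)) := by
  rw [powSum, Complex.conj_tsum]
  refine tsum_congr fun n => ?_
  rw [map_mul, map_pow, circle_conj, zpow_neg, zpow_natCast, inv_pow]

/-- Splitting a product into its nonpositive and its positive frequencies. -/
theorem exists_frequency_split {F : Circle → ℂ} (hF : Continuous F)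
    (hs : Summable fun n => ‖fc F n‖) (J : ℕ) {y : ℕ → ℂ} (hy : Summable fun n => ‖y n‖) :
    ∃ g : ℂ → ℂ, DA g ∧ g 0 = 0 ∧
      (Summable fun n : ℕ => ‖∑' m, fc F (-((J + (n + m) : ℕ) : ℤ)) * y m‖) ∧
      ∀ w : Circle, F w * ((w : ℂ) ^ (J : ℤ) * powSum y w) =
        ∑' n : ℕ, (∑' m, fc F (-((J + (n + m) : ℕ) : ℤ)) * y m) * (w : ℂ) ^ (-(n : ℤ)) + g w := by
  -- This is the coefficient of the product at frequency p; the bijection `e` reindexes the double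
  -- series by total frequency.
  set c : ℤ → ℂ := fun p => ∑' m : ℕ, fc F (p - J - m) * y m with hc
  let e : ℤ × ℕ ≃ ℤ × ℕ :=
    { toFun := fun p => (p.1 - J - p.2, p.2)
      invFun := fun p => (p.1 + J + p.2, p.2)
      left_inv := fun p => Prod.ext (by dsimp only; ring) rfl
      right_inv := fun p => Prod.ext (by dsimp only; ring) rfl }
  have hS : Summable fun p : ℤ × ℕ => ‖fc F (p.1 - J - p.2) * y p.2‖ := by
    have := e.summable_iff.2 (hs.mul_norm hy)
    refine this.congr fun p => by simp [e]
  have hcs : Summable fun p => ‖c p‖ :=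
    Summable.of_nonneg_of_le (fun _ => norm_nonneg _)
      (fun p => norm_tsum_le_tsum_norm (hS.prod_factor p)) hS.prod
  have hrow : ∀ p : ℤ, Summable fun m : ℕ => fc F (p - J - m) * y m := fun p =>
    (hS.prod_factor p).of_norm
  have hw : ∀ w : Circle, HasSum (fun p : ℤ => c p * (w : ℂ) ^ p)
      (F w * ((w : ℂ) ^ (J : ℤ) * powSum y w)) := by
    intro w
    have n1 : ∀ (n : ℤ), ‖(w : ℂ) ^ n‖ = 1 := fun n => by rw [norm_zpow, w.norm_coe, one_zpow]
    have h1 : HasSum (fun n : ℤ => fc F n * (w : ℂ) ^ n) (F w) := hasSum_fc hF hs.of_norm w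
    have h2 : HasSum (fun m : ℕ => (w : ℂ) ^ (J : ℤ) * (y m * (w : ℂ) ^ m))
        ((w : ℂ) ^ (J : ℤ) * powSum y w) :=
      (summable_mul_pow hy (circle_mem_closedBall w)).hasSum.mul_left _
    have h1' : Summable fun n : ℤ => ‖fc F n * (w : ℂ) ^ n‖ :=
      hs.congr fun n => by rw [norm_mul, n1, mul_one]
    have h2' : Summable fun m : ℕ => ‖(w : ℂ) ^ (J : ℤ) * (y m * (w : ℂ) ^ m)‖ :=
      hy.congr fun m => by rw [norm_mul, n1, one_mul, norm_mul, ← zpow_natCast, n1, mul_one]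
    obtain ⟨f, hf⟩ : ∃ f : ℤ → ℂ, f = fun n : ℤ => fc F n * (w : ℂ) ^ n := ⟨_, rfl⟩
    obtain ⟨g, hg⟩ : ∃ g : ℕ → ℂ, g = fun m : ℕ => (w : ℂ) ^ (J : ℤ) * (y m * (w : ℂ) ^ m) :=
      ⟨_, rfl⟩
    rw [← hf] at h1
    rw [← hg] at h2
    have h3 := h1.mul h2 (summable_mul_of_summable_norm (by rw [hf]; exact h1')
      (by rw [hg]; exact h2'))
    rw [← e.hasSum_iff] at h3
    have h4 : (fun p : ℤ × ℕ => fc F (p.1 - J - p.2) * y p.2 * (w : ℂ) ^ p.1) =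
        (fun x : ℤ × ℕ => f x.1 * g x.2) ∘ e := by
      ext p
      have : (w : ℂ) ^ p.1 = (w : ℂ) ^ (p.1 - J - p.2) * ((w : ℂ) ^ (J : ℤ) * (w : ℂ) ^ p.2) := by
        rw [← zpow_natCast (w : ℂ) p.2, ← zpow_add₀ w.coe_ne_zero, ← zpow_add₀ w.coe_ne_zero]
        congr 1; ring
      rw [this]
      simp only [Function.comp_apply, e, Equiv.coe_fn_mk, hf, hg]
      ring
    rw [← h4] at h3
    have h5 : ∀ p : ℤ, HasSum (fun m : ℕ => fc F (p - J - m) * y m * (w : ℂ) ^ p)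
        (c p * (w : ℂ) ^ p) := fun p => by
      have := (hrow p).hasSum.mul_right ((w : ℂ) ^ p)
      exact this
    exact HasSum.prod_fiberwise h3 h5
  have inj1 : Function.Injective fun n : ℕ => -(n : ℤ) := fun m n hmn => by simpa using hmn
  have inj2 : Function.Injective fun n : ℕ => (n : ℤ) + 1 := fun m n hmn => by simpa using hmn
  have hneg : ∀ n : ℕ, ∑' m, fc F (-((J + (n + m) : ℕ) : ℤ)) * y m = c (-(n : ℤ)) := by
    intro n
    refine tsum_congr fun m => ?_
    congr 2
    push_cast; ring
  have hpos : Summable fun n : ℕ => ‖c ((n : ℤ) + 1)‖ := hcs.comp_injective inj2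
  refine ⟨fun z => z * powSum (fun n : ℕ => c ((n : ℤ) + 1)) z, DA.id'.mul (DA.powSum hpos),
    zero_mul _, ?_, fun w => ?_⟩
  · simp only [hneg]
    exact hcs.comp_injective inj1
  · simp only [hneg]
    have h1 : HasSum (fun p : ℤ => c (-p) * (w : ℂ) ^ (-p))
        (F w * ((w : ℂ) ^ (J : ℤ) * powSum y w)) := (Equiv.neg ℤ).hasSum_iff.2 (hw w)
    have s1 : Summable fun n : ℕ => c (-(n : ℤ)) * (w : ℂ) ^ (-(n : ℤ)) :=
      (hw w).summable.comp_injective inj1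
    have h2 : HasSum (fun n : ℕ => c (-(-((n : ℤ) + 1))) * (w : ℂ) ^ (-(-((n : ℤ) + 1))))
        (w * powSum (fun n : ℕ => c ((n : ℤ) + 1)) w) := by
      have := (summable_mul_pow hpos (circle_mem_closedBall w)).hasSum.mul_left (w : ℂ)
      have e : (fun n : ℕ => c (-(-((n : ℤ) + 1))) * (w : ℂ) ^ (-(-((n : ℤ) + 1)))) =
          fun n : ℕ => (w : ℂ) * (c ((n : ℤ) + 1) * (w : ℂ) ^ n) := by
        ext n
        rw [neg_neg, zpow_add_one₀ w.coe_ne_zero, zpow_natCast]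
        ring
      rw [e]
      exact this
    have h3 := HasSum.of_nat_of_neg_add_one (f := fun p : ℤ => c (-p) * (w : ℂ) ^ (-p))
      s1.hasSum h2
    exact h1.unique h3

variable {r : Circle → ℂ} {a : ℂ → ℂ} {E E' : Polynomial ℂ}

theorem DiskDvd.self_mul {g : ℂ → ℂ} (ha : DA a) (hg : DA g) : DiskDvd a fun z => a z * g z :=
  (DiskDvd.mul_left hg.punctured ha.punctured (DiskDvd.refl a)).congr fun _ _ _ => mul_comm _ _

/-- After division by a the requirements read conj h - F w^J k = 1 - g₁ and conj k + F w^J h = g₂,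
with g₁, g₂ analytic and zero at the origin. The nonpositive frequencies form the Hankel system, and
the positive ones define g₁ and g₂. The choice of 1 at frequency zero normalizes U(0) = a(0). -/
theorem ScatData.exists_sol (D : ScatData r a E E') (hr : SobolevLip r)
    (ha : SobolevLip fun w => a w) :
    ∃ (J : ℕ) (h k U V : ℂ → ℂ), Sol r a E J h k U V ∧ U 0 = a 0 := by
  have hF := D.sobolev_symbol hr ha
  set F := hankelSymbol r a E with hFdef
  have inj1 : Function.Injective fun n : ℕ => -(n : ℤ) := fun m n hmn => by simpa using hmn
  have hf : Summable fun n : ℕ => ‖fc F (-(n : ℤ))‖ := hF.summable_norm.comp_injective inj1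
  obtain ⟨J, hJ⟩ := ((tendsto_sum_nat_add fun n : ℕ => ‖fc F (-(n : ℤ))‖).eventually
    (ge_mem_nhds (by norm_num : (0 : ℝ) < 1 / 2))).exists
  have hκ : Summable fun n : ℕ => ‖fc F (-((J + n : ℕ) : ℤ))‖ :=
    hf.comp_injective (add_right_injective J)
  obtain ⟨x, y, hx, hy, exy, eyx⟩ := exists_hankel_solution (κ := fun n => fc F (-((J + n : ℕ) : ℤ)))
    hκ (by simpa only [add_comm J] using hJ)
  obtain ⟨g₁, dg₁, z₁, s₁, c₁⟩ := exists_frequency_split hF.1 hF.summable_norm J hy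
  obtain ⟨g₂, dg₂, z₂, s₂, c₂⟩ := exists_frequency_split hF.1 hF.summable_norm J hx
  have n1 : ∀ (w : Circle) (n : ℤ), ‖(w : ℂ) ^ n‖ = 1 := fun w n => by
    rw [norm_zpow, w.norm_coe, one_zpow]
  have sc : ∀ {u : ℕ → ℂ}, (Summable fun n => ‖u n‖) → ∀ w : Circle,
      Summable fun n : ℕ => u n * (w : ℂ) ^ (-(n : ℤ)) := fun hu w =>
    Summable.of_norm (hu.congr fun n => by rw [norm_mul, n1, mul_one])
  have t₁ : ∀ w : Circle, conj (powSum x w) - F w * ((w : ℂ) ^ (J : ℤ) * powSum y w) =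
      1 - g₁ w := by
    intro w
    have hx' : Summable fun n => ‖conj (x n)‖ := by simpa only [RCLike.norm_conj] using hx
    have hsub := (sc hx' w).tsum_sub (sc s₁ w)
    have hone : ∑' n : ℕ, (conj (x n) * (w : ℂ) ^ (-(n : ℤ)) -
        (∑' m, fc F (-((J + (n + m) : ℕ) : ℤ)) * y m) * (w : ℂ) ^ (-(n : ℤ))) = 1 := by
      rw [tsum_eq_single 0 fun n hn => ?_]
      · rw [← sub_mul, exy 0]; simp
      · rw [← sub_mul, exy n]; simp [hn]
    rw [c₁, conj_powSum]
    rw [hone] at hsub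
    linear_combination -hsub
  have t₂ : ∀ w : Circle, conj (powSum y w) + F w * ((w : ℂ) ^ (J : ℤ) * powSum x w) =
      g₂ w := by
    intro w
    have hy' : Summable fun n => ‖conj (y n)‖ := by simpa only [RCLike.norm_conj] using hy
    have hadd := (sc hy' w).tsum_add (sc s₂ w)
    have hone : ∑' n : ℕ, (conj (y n) * (w : ℂ) ^ (-(n : ℤ)) +
        (∑' m, fc F (-((J + (n + m) : ℕ) : ℤ)) * x m) * (w : ℂ) ^ (-(n : ℤ))) = 0 := by
      refine (tsum_congr fun n => ?_).trans tsum_zero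
      rw [← add_mul, eyx n, zero_mul]
    rw [c₂, conj_powSum]
    rw [hone] at hadd
    linear_combination -hadd
  have hEJ : DA fun z => E.eval z * z ^ (J : ℤ) := by
    simp only [zpow_natCast]; exact (DA.poly E).mul (DA.pow' J)
  have dx := DA.powSum hx
  have dy := DA.powSum hy
  refine ⟨J, powSum x, powSum y, fun z => a z * (1 - g₁ z) - E.eval z * z ^ (J : ℤ) * powSum y z,
    fun z => a z * g₂ z + E.eval z * z ^ (J : ℤ) * powSum x z,
    { dh := dx, dk := dy
      dU := (D.da.mul ((DA.const 1).sub' dg₁)).sub' (hEJ.mul dy)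
      dV := (D.da.mul dg₂).add' (hEJ.mul dx)
      circ_U := fun w => ?_
      circ_V := fun w => ?_
      dvd_U := (DiskDvd.self_mul D.da ((DA.const 1).sub' dg₁)).congr fun z _ _ => by ring
      dvd_V := (DiskDvd.self_mul D.da dg₂).congr fun z _ _ => by ring
      V_zero := by simp [z₂, D.eval_zero] }, by simp [z₁, D.eval_zero]⟩
  · have hw := D.ne_zero w
    rw [← t₁, hFdef, hankelSymbol]
    field_simp
    ring
  · have hw := D.ne_zero w
    rw [← t₂, hFdef, hankelSymbol]
    field_simp
    ring

/-- The constant |h|^2 + |k|^2 coincides with h(0), because U(0) = a(0). It is positive, as h = k =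
0 would force U = 0. Dividing by its square root normalizes. -/
theorem ScatData.exists_nsol (D : ScatData r a E E') (hr : SobolevLip r)
    (ha : SobolevLip fun w => a w) : ∃ (J : ℤ) (h k U V : ℂ → ℂ), NSol r a E J h k U V := by
  obtain ⟨J, h, k, U, V, S, hU⟩ := D.exists_sol hr ha
  obtain ⟨q, h1, h2⟩ := S.exists_const D
  have hq : h 0 = q := by
    have := h1 0 zero_mem_unitClosedBall
    rw [S.V_zero, hU, mul_zero, add_zero, mul_comm] at this
    exact mul_left_cancel₀ D.zero_ne_zero this
  have hq' : ∀ w : Circle, q = ((‖h w‖ ^ 2 + ‖k w‖ ^ 2 : ℝ) : ℂ) := fun w => by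
    rw [← h2 w, Complex.mul_conj', Complex.mul_conj']; push_cast; rfl
  obtain ⟨t, ht⟩ : ∃ t : ℝ, t = ‖h (1 : Circle)‖ ^ 2 + ‖k (1 : Circle)‖ ^ 2 := ⟨_, rfl⟩
  have hqt : q = t := by rw [hq' 1, ht]
  have ht0 : 0 < t := by
    refine lt_of_le_of_ne (by rw [ht]; positivity) fun h0 => ?_
    have hz : ∀ w : Circle, h w = 0 ∧ k w = 0 := by
      intro w
      have := hq' w
      rw [hqt, ← h0] at this
      have h3 : ‖h w‖ ^ 2 + ‖k w‖ ^ 2 = 0 := by exact_mod_cast this.symm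
      rw [add_eq_zero_iff_of_nonneg (sq_nonneg _) (sq_nonneg _)] at h3
      simpa using h3
    have : U 0 = 0 := S.dU.eq_of_circle (DA.const 0) (fun w => by
      rw [S.circ_U, (hz w).1, (hz w).2]; simp) zero_mem_unitClosedBall
    rw [hU] at this
    exact D.zero_ne_zero this
  obtain ⟨s, hs, hst⟩ : ∃ s : ℝ, 0 < s ∧ s * s * t = 1 :=
    ⟨1 / √t, by positivity, by
      have := Real.mul_self_sqrt ht0.le
      have h4 : √t ≠ 0 := by positivity
      field_simp
      rw [sq, this]⟩
  have T := S.comb S s 0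
  refine ⟨J, _, _, _, _, { toSol := T, unit := fun w => ?_, pos := ⟨s * t, by positivity, ?_⟩ }⟩
  · have hst' : (s : ℂ) * s * t = 1 := by exact_mod_cast hst
    have := h2 w
    rw [hqt] at this
    simp only [Complex.ofReal_zero, zero_mul, sub_zero, map_mul, Complex.conj_ofReal]
    linear_combination (s : ℂ) * s * this + hst'
  · simp [hq, hqt]

end HardPulse

namespace HardPulse

/-! ### The transmission function with prescribed modulus and zeros -/

theorem fc_conj (F : Circle → ℂ) (n : ℤ) : fc (fun w => conj (F w)) n = conj (fc F (-n)) := by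
  rw [fc, fc, ← avg_conj]
  refine congrArg avg (funext fun w => ?_)
  rw [map_mul, circle_conj_zpow, neg_neg]

/-- A real function in `H¹` is the real part of the boundary values of a disk algebra function. -/
theorem exists_analytic_completion {g : Circle → ℝ} (hg : SobolevLip fun w => (g w : ℂ)) :
    ∃ G : ℂ → ℂ, DA G ∧ SobolevLip (fun w => G w) ∧ (∀ w : Circle, (G w).re = g w) ∧
      (G 0).im = 0 := by
  set F : Circle → ℂ := fun w => (g w : ℂ) with hF
  have hs := hg.summable_norm
  have hconj : ∀ n, conj (fc F n) = fc F (-n) := fun n => by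
    have := fc_conj F (-n)
    rw [neg_neg] at this
    rw [← this]
    simp only [hF, Complex.conj_ofReal]
  have hx : Summable fun n : ℕ => ‖fc F n‖ := hs.comp_injective Nat.cast_injective
  have hP := DA.powSum hx
  set P := powSum fun n : ℕ => fc F n with hPdef
  have h0 : conj (fc F 0) = fc F 0 := by simpa using hconj 0
  -- Negative frequencies of a real function are conjugates of positive ones. The mean is counted
  -- twice and subtracted once, which leads to G = 2 P - f_0.
  have hsplit : ∀ w : Circle, F w = P w + (conj (P w) - fc F 0) := by
    intro w
    have h1 : HasSum (fun n : ℤ => fc F n * (w : ℂ) ^ n) (F w) := hasSum_fc hg.1 hs.of_norm w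
    have h2 : HasSum (fun n : ℕ => fc F (n : ℤ) * (w : ℂ) ^ (n : ℤ)) (P w) := by
      simp only [zpow_natCast]
      exact (summable_mul_pow hx (circle_mem_closedBall w)).hasSum
    have inj : Function.Injective fun n : ℕ => -((n : ℤ) + 1) := fun m n hmn => by
      simpa using hmn
    have inj1 : Function.Injective fun n : ℕ => -(n : ℤ) := fun m n hmn => by simpa using hmn
    have s3 : Summable fun n : ℕ => fc F (-((n : ℤ) + 1)) * (w : ℂ) ^ (-((n : ℤ) + 1)) :=
      h1.summable.comp_injective inj
    have s4 : Summable fun n : ℕ => fc F (-(n : ℤ)) * (w : ℂ) ^ (-(n : ℤ)) :=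
      h1.summable.comp_injective inj1
    have h3 := HasSum.of_nat_of_neg_add_one (f := fun n : ℤ => fc F n * (w : ℂ) ^ n) h2 s3.hasSum
    rw [h1.unique h3, hPdef, conj_powSum]
    simp only [hconj]
    rw [s4.tsum_eq_zero_add]
    simp
  have hPS : SobolevLip fun w => P w := by
    refine SobolevLip.of_summable_sq hP.continuous_circle
      (hg.summable_sq.of_nonneg_of_le (fun n => by positivity) fun n => ?_)
    rcases le_or_gt n 0 with hn | hn
    · rcases hn.eq_or_lt with rfl | hn
      · simp
      · obtain ⟨k, hk⟩ : ∃ k : ℕ, n = -(k : ℤ) := ⟨(-n).toNat, by omega⟩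
        rw [hk, fc_DA_neg hP (by omega)]
        rw [norm_zero, zero_pow two_ne_zero, mul_zero]
        positivity
    · have dPc : DA fun z => P z - fc F 0 := hP.sub' (DA.const _)
      have e1 : fc (fun w => F w - P w) n = 0 := by
        have e2 : (fun w => F w - P w) = fun w : Circle => conj (P w - fc F 0) := by
          ext w
          rw [hsplit w, map_sub, h0]; ring
        obtain ⟨k, hk⟩ : ∃ k : ℕ, n = k := ⟨n.toNat, by omega⟩
        rw [e2, fc_conj (fun w : Circle => P w - fc F 0), hk,
          fc_DA_neg dPc (by omega), map_zero]
      rw [fc_sub hg.1 hP.continuous_circle, sub_eq_zero] at e1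
      rw [e1]
  have him : (fc F 0).im = 0 := by
    have := congrArg Complex.im h0
    rw [Complex.conj_im] at this
    linarith
  refine ⟨fun z => 2 * P z - fc F 0, (hP.const_mul 2).sub' (DA.const _),
    ((SobolevLip.const 2).mul hPS).sub (SobolevLip.const _), fun w => ?_, ?_⟩
  · have := congrArg Complex.re (hsplit w)
    simp only [hF, Complex.ofReal_re, Complex.add_re, Complex.sub_re, Complex.conj_re] at this
    simp only [Complex.sub_re, Complex.mul_re, Complex.re_ofNat, Complex.im_ofNat, zero_mul,
      sub_zero]
    linarith
  · have hP0 : P 0 = fc F 0 := powSum_zero _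
    simp [hP0, him]

/-- Take G with real part -(1/2) log(1 + |r|^2) and real value at the origin; exp G has the wanted
modulus and no zeros. -/
theorem exists_outer {r : Circle → ℂ} (hr : SobolevLip r) :
    ∃ G : ℂ → ℂ, DA G ∧ SobolevLip (fun w => G w) ∧
      (∀ w : Circle, Complex.exp (G w) * conj (Complex.exp (G w)) * (1 + r w * conj (r w)) = 1) ∧
      ∃ t : ℝ, 0 < t ∧ Complex.exp (G 0) = t := by
  have hΦ : ContDiff ℝ 1 fun ζ : ℂ => ((-(1 / 2) * Real.log (1 + ‖ζ‖ ^ 2) : ℝ) : ℂ) := by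
    refine Complex.ofRealCLM.contDiff.comp (contDiff_const.mul (ContDiff.log ?_ fun ζ => ?_))
    · exact contDiff_const.add (contDiff_norm_sq ℝ)
    · positivity
  obtain ⟨G, dG, sG, re, im⟩ := exists_analytic_completion
    (g := fun w => -(1 / 2) * Real.log (1 + ‖r w‖ ^ 2)) (hr.comp_contDiff hΦ)
  refine ⟨G, dG, sG, fun w => ?_, Real.exp (G 0).re, Real.exp_pos _, ?_⟩
  · have hpos : (0 : ℝ) < 1 + ‖r w‖ ^ 2 := by positivity
    rw [Complex.mul_conj', Complex.mul_conj', Complex.norm_exp, re]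
    have : Real.exp (-(1 / 2) * Real.log (1 + ‖r w‖ ^ 2)) ^ 2 * (1 + ‖r w‖ ^ 2) = 1 := by
      rw [← Real.exp_nat_mul]
      have : ((2 : ℕ) : ℝ) * (-(1 / 2) * Real.log (1 + ‖r w‖ ^ 2)) =
        -Real.log (1 + ‖r w‖ ^ 2) := by push_cast; ring
      rw [this, Real.exp_neg, Real.exp_log hpos, inv_mul_cancel₀ hpos.ne']
    exact_mod_cast this
  · rw [Complex.ofReal_exp]
    congr 1
    exact Complex.ext rfl (by simp [im])

/-- The Blaschke factor with zero `ζ`, positive at the origin. -/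
def blaschke (ζ z : ℂ) : ℂ := ‖ζ‖ / ζ * ((ζ - z) * (1 - conj ζ * z)⁻¹)

theorem blaschke_denom_ne_zero {ζ : ℂ} (h1 : ‖ζ‖ < 1) {z : ℂ} (hz : z ∈ closedBall (0 : ℂ) 1) : 1 - conj ζ * z ≠ 0 := by
  intro h
  have h2 : ‖conj ζ * z‖ = 1 := by rw [← sub_eq_zero.1 h, norm_one]
  rw [norm_mul, RCLike.norm_conj] at h2
  have h3 := mem_closedBall_zero_iff.1 hz
  nlinarith [norm_nonneg ζ, norm_nonneg z]

theorem DA.blaschke {ζ : ℂ} (h1 : ‖ζ‖ < 1) : DA (blaschke ζ) := by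
  have hd : DA fun z => 1 - conj ζ * z := (DA.const 1).sub' (DA.id'.const_mul _)
  have hi : DA fun z => (1 - conj ζ * z)⁻¹ := hd.inv fun z hz => blaschke_denom_ne_zero h1
    (by rwa [closure_unitBall] at hz)
  exact (((DA.const ζ).sub' DA.id').mul hi).const_mul _

theorem blaschke_mul_conj {ζ : ℂ} (h0 : ζ ≠ 0) (h1 : ‖ζ‖ < 1) (w : Circle) : blaschke ζ w * conj (blaschke ζ w) = 1 := by
  have hd := blaschke_denom_ne_zero h1 (circle_mem_closedBall w)
  have hd' : 1 - ζ * conj (w : ℂ) ≠ 0 := by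
    intro h
    apply hd
    have := congrArg conj h
    simpa using this
  have h0' : conj ζ ≠ 0 := by simpa using h0
  have hn : (‖ζ‖ : ℂ) ^ 2 = ζ * conj ζ := (Complex.mul_conj' ζ).symm
  have hw := circle_mul_conj w
  have key : (‖ζ‖ : ℂ) ^ 2 * ((ζ - w) * (conj ζ - conj (w : ℂ))) =
      ζ * conj ζ * ((1 - conj ζ * w) * (1 - ζ * conj (w : ℂ))) := by
    linear_combination (ζ - w) * (conj ζ - conj (w : ℂ)) * hn + ζ * conj ζ * (1 - ζ * conj ζ) * hw
  simp only [blaschke, map_mul, map_div₀, map_inv₀, map_sub, map_one, Complex.conj_conj,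
    Complex.conj_ofReal]
  generalize 1 - conj ζ * (w : ℂ) = p at *
  generalize 1 - ζ * conj (w : ℂ) = q at *
  field_simp
  linear_combination key

theorem blaschke_zero {ζ : ℂ} (h0 : ζ ≠ 0) : blaschke ζ 0 = ‖ζ‖ := by
  simp [blaschke, h0]

theorem sobolevLip_blaschke {ζ : ℂ} (h1 : ‖ζ‖ < 1) : SobolevLip fun w => blaschke ζ w := by
  refine (SobolevLip.const _).mul (((SobolevLip.const _).sub SobolevLip.coe).mul
    (((SobolevLip.const _).sub ((SobolevLip.const _).mul SobolevLip.coe)).inv fun w => ?_))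
  exact blaschke_denom_ne_zero h1 (circle_mem_closedBall w)

theorem order_blaschke {ζ : ℂ} (h0 : ζ ≠ 0) (h1 : ‖ζ‖ < 1) {z : ℂ} (hz : z ∈ ball (0 : ℂ) 1) :
    analyticOrderAt (blaschke ζ) z = if z = ζ then 1 else 0 := by
  have han := (DA.blaschke h1).analyticAt hz
  have hd := blaschke_denom_ne_zero h1 (ball_mem_closedBall hz)
  have hc : (‖ζ‖ : ℂ) / ζ ≠ 0 := div_ne_zero (by simpa using h0) h0
  split_ifs with h
  · subst h
    rw [← Nat.cast_one, han.analyticOrderAt_eq_natCast]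
    refine ⟨fun y => -(‖z‖ / z * (1 - conj z * y)⁻¹), ?_, ?_, ?_⟩
    · have : AnalyticAt ℂ (fun y : ℂ => 1 - conj z * y) z := by fun_prop
      exact (analyticAt_const.mul (this.inv hd)).neg
    · exact neg_ne_zero.2 (mul_ne_zero hc (inv_ne_zero hd))
    · refine Eventually.of_forall fun y => ?_
      rw [blaschke, smul_eq_mul, pow_one]; ring
  · rw [han.analyticOrderAt_eq_zero, blaschke]
    exact mul_ne_zero hc (mul_ne_zero (sub_ne_zero.2 (Ne.symm h)) (inv_ne_zero hd))

theorem exists_blaschke_product (m : ℂ →₀ ℕ) (hm : ∀ z ∈ m.support, z ≠ 0 ∧ ‖z‖ < 1) :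
    ∃ b : ℂ → ℂ, DA b ∧ SobolevLip (fun w => b w) ∧ (∀ w : Circle, b w * conj (b w) = 1) ∧
      (∃ t : ℝ, 0 < t ∧ b 0 = t) ∧ ∀ z ∈ ball (0 : ℂ) 1, analyticOrderAt b z = m z := by
  induction m using Finsupp.induction_linear with
  | zero =>
    refine ⟨fun _ => 1, DA.const 1, SobolevLip.const 1, fun w => by simp, ⟨1, by simp⟩,
      fun z hz => ?_⟩
    simp [analyticAt_const.analyticOrderAt_eq_zero]
  | add f g hf hg =>
    have sub : ∀ z, (f + g) z = 0 → f z = 0 ∧ g z = 0 := fun z hz => by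
      rw [Finsupp.add_apply] at hz; omega
    obtain ⟨b, d, s, n, ⟨t, ht, et⟩, o⟩ := hf fun z hz => hm z (by
      rw [Finsupp.mem_support_iff] at hz ⊢; exact fun h => hz (sub z h).1)
    obtain ⟨b', d', s', n', ⟨t', ht', et'⟩, o'⟩ := hg fun z hz => hm z (by
      rw [Finsupp.mem_support_iff] at hz ⊢; exact fun h => hz (sub z h).2)
    refine ⟨fun z => b z * b' z, d.mul d', s.mul s', fun w => ?_,
      ⟨t * t', by positivity, by simp [et, et']⟩, fun z hz => ?_⟩
    · rw [map_mul]
      linear_combination b' w * conj (b' w) * n w + n' w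
    · have := analyticOrderAt_mul (d.analyticAt hz) (d'.analyticAt hz)
      change analyticOrderAt (b * b') z = _
      rw [this, o z hz, o' z hz, Finsupp.add_apply]
      push_cast; rfl
  | single ζ n =>
    rcases eq_or_ne n 0 with rfl | hn
    · refine ⟨fun _ => 1, DA.const 1, SobolevLip.const 1, fun w => by simp, ⟨1, by simp⟩,
        fun z hz => ?_⟩
      simp [analyticAt_const.analyticOrderAt_eq_zero]
    · obtain ⟨h0, h1⟩ := hm ζ (by simp [hn])
      clear hm hn
      induction n with
      | zero =>
        refine ⟨fun _ => 1, DA.const 1, SobolevLip.const 1, fun w => by simp, ⟨1, by simp⟩,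
          fun z hz => ?_⟩
        simp [analyticAt_const.analyticOrderAt_eq_zero]
      | succ n ih =>
        obtain ⟨b, d, s, u, ⟨t, ht, et⟩, o⟩ := ih
        refine ⟨fun z => b z * blaschke ζ z, d.mul (DA.blaschke h1), s.mul (sobolevLip_blaschke h1),
          fun w => ?_, ⟨t * ‖ζ‖, mul_pos ht (norm_pos_iff.2 h0), ?_⟩, fun z hz => ?_⟩
        · rw [map_mul]
          linear_combination blaschke ζ w * conj (blaschke ζ w) * u w + blaschke_mul_conj h0 h1 w
        · simp [et, blaschke_zero h0]
        · have := analyticOrderAt_mul (d.analyticAt hz) ((DA.blaschke h1).analyticAt hz)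
          change analyticOrderAt (b * blaschke ζ) z = _
          rw [this, o z hz, order_blaschke h0 h1 hz, Finsupp.single_apply, Finsupp.single_apply]
          by_cases h : z = ζ
          · subst h; simp
          · simp [h, Ne.symm h]

/-- The transmission function with given zeros and modulus `(1 + |r|²)^{-1/2}`. -/
theorem exists_transmission {r : Circle → ℂ} (hr : SobolevLip r) (m : ℂ →₀ ℕ)
    (hm : ∀ z ∈ m.support, z ≠ 0 ∧ ‖z‖ < 1) :
    ∃ a : ℂ → ℂ, DA a ∧ SobolevLip (fun w => a w) ∧
      (∀ w : Circle, a w * conj (a w) * (1 + r w * conj (r w)) = 1) ∧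
      (∃ t : ℝ, 0 < t ∧ a 0 = t) ∧ ∀ z ∈ ball (0 : ℂ) 1, analyticOrderAt a z = m z := by
  obtain ⟨b, d, s, u, ⟨t, ht, et⟩, o⟩ := exists_blaschke_product m hm
  obtain ⟨G, dG, sG, nG, t', ht', et'⟩ := exists_outer hr
  have dE : DA fun z => Complex.exp (G z) := Complex.differentiable_exp.comp_diffContOnCl dG
  refine ⟨fun z => b z * Complex.exp (G z), d.mul dE,
    s.mul (sG.comp_contDiff Complex.contDiff_exp), fun w => ?_,
    ⟨t * t', by positivity, by simp [et, et']⟩, fun z hz => ?_⟩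
  · rw [map_mul]
    linear_combination b w * conj (b w) * nG w + u w
  · have := analyticOrderAt_mul (d.analyticAt hz) (dE.analyticAt hz)
    change analyticOrderAt (b * fun z => Complex.exp (G z)) z = _
    rw [this, o z hz, (dE.analyticAt hz).analyticOrderAt_eq_zero.2 (Complex.exp_ne_zero _),
      add_zero]

/-- Interpolation of the norming data. -/
theorem exists_norming_interpolation (m : ℂ →₀ ℕ) (h0 : m 0 = 0) (g : ℂ → ℂ → ℂ)
    (hg : ∀ z, m z ≠ 0 → AnalyticAt ℂ (g z) z ∧ g z z ≠ 0) :
    ∃ E E' : Polynomial ℂ, E.eval 0 = 0 ∧ E'.eval 0 = 0 ∧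
      (∀ z, (m z : ℕ∞) ≤ analyticOrderAt (fun w => E.eval w - g z w) z) ∧
      ∀ z, (m z : ℕ∞) ≤ analyticOrderAt (fun w => E.eval w * E'.eval w + 1) z := by
  obtain ⟨E, e0, hE⟩ := exists_interpolation m h0 g fun z hz => (hg z hz).1
  have aE : ∀ z, AnalyticAt ℂ (fun w => E.eval w) z := fun z =>
    AnalyticOnNhd.eval_polynomial _ z trivial
  have hne : ∀ z, m z ≠ 0 → E.eval z ≠ 0 := by
    intro z hz h
    have h1 : analyticOrderAt (fun w => E.eval w - g z w) z ≠ 0 := by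
      intro h2
      have := hE z
      rw [h2] at this
      exact hz (by simpa using this)
    have h2 : E.eval z - g z z = 0 :=
      ((aE z).sub (hg z hz).1).analyticOrderAt_ne_zero.1 h1
    rw [h, zero_sub, neg_eq_zero] at h2
    exact (hg z hz).2 h2
  -- E' interpolates -1/E, which is analytic at the energies since E takes the nonzero norming value
  -- there.
  obtain ⟨E', e0', hE'⟩ := exists_interpolation m h0 (fun _ w => -(E.eval w)⁻¹) fun z hz =>
    ((aE z).inv (hne z hz)).neg
  refine ⟨E, E', e0, e0', hE, fun z => ?_⟩
  by_cases hz : m z = 0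
  · simp [hz]
  · have aE' : AnalyticAt ℂ (fun w => E'.eval w - -(E.eval w)⁻¹) z :=
      (AnalyticOnNhd.eval_polynomial E' z trivial).sub ((aE z).inv (hne z hz)).neg
    have h1 : (fun w => E.eval w * E'.eval w + 1) =ᶠ[𝓝 z]
        (fun w => E.eval w) * fun w => E'.eval w - -(E.eval w)⁻¹ := by
      filter_upwards [(aE z).continuousAt.eventually_ne (hne z hz)] with w hw
      rw [Pi.mul_apply]
      field_simp
      ring
    rw [analyticOrderAt_congr h1, analyticOrderAt_mul (aE z) aE']
    exact (hE' z).trans le_add_self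

end HardPulse

namespace HardPulse

/-! ### From normalized solutions to hard pulses -/

/-- The pulse strength with reflection parameter `g`. -/
def flip (g : ℂ) : ℂ := -2 * Complex.I * conj (Real.arctan ‖g‖ * (g / ‖g‖))

theorem flip_zero : flip 0 = 0 := by simp [flip]

theorem norm_arctan_mul (g : ℂ) : ‖(Real.arctan ‖g‖ : ℂ) * (g / ‖g‖)‖ = Real.arctan ‖g‖ := by
  by_cases hg : g = 0
  · simp [hg]
  · rw [norm_mul, norm_div, Complex.norm_real, Complex.norm_real, norm_norm,
      div_self (norm_ne_zero_iff.2 hg), mul_one,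
      Real.norm_of_nonneg (Real.arctan_nonneg.2 (norm_nonneg g))]

theorem norm_flip (g : ℂ) : ‖flip g‖ = 2 * Real.arctan ‖g‖ := by
  rw [flip, norm_mul, RCLike.norm_conj, norm_arctan_mul]
  simp

theorem norm_flip_lt (g : ℂ) : ‖flip g‖ < Real.pi := by
  rw [norm_flip]
  linarith [Real.arctan_lt_pi_div_two ‖g‖]

theorem norm_flip_le (g : ℂ) : ‖flip g‖ ≤ 2 * ‖g‖ := by
  rw [norm_flip]
  have := Real.le_tan (Real.arctan_nonneg.2 (norm_nonneg g)) (Real.arctan_lt_pi_div_two ‖g‖)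
  rw [Real.tan_arctan] at this
  linarith

theorem potential_flip (γ : ℤ → ℂ) (j : ℤ) :
    potential (fun j => flip (γ j)) j = Real.arctan ‖γ j‖ * (γ j / ‖γ j‖) := by
  simp only [potential, flip, map_mul, map_neg, Complex.conj_conj, Complex.conj_I]
  rw [Complex.conj_ofNat]
  linear_combination -((Real.arctan ‖γ j‖ : ℂ) * (γ j / ‖γ j‖)) * Complex.I_mul_I

theorem cosP_flip (γ : ℤ → ℂ) (j : ℤ) : cosP (fun j => flip (γ j)) j = cosOf (γ j) := by
  rw [cosP, potential_flip, norm_arctan_mul, Real.cos_arctan, cosOf]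

theorem sinP_flip (γ : ℤ → ℂ) (j : ℤ) : sinP (fun j => flip (γ j)) j = sinOf (γ j) := by
  by_cases h : γ j = 0
  · simp [sinP, potential, h, flip_zero, sinOf_zero]
  have h0 : (‖γ j‖ : ℂ) ≠ 0 := by exact_mod_cast norm_ne_zero_iff.2 h
  have h1 : (Real.arctan ‖γ j‖ : ℂ) ≠ 0 := by
    exact_mod_cast (Real.arctan_pos.2 (norm_pos_iff.2 h)).ne'
  rw [sinP, potential_flip, norm_arctan_mul, Real.sin_arctan, sinOf, cosOf]
  simp only [Complex.ofReal_div, Complex.ofReal_one]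
  field_simp

/-- With half the flip angle below π/2, the modulus of g is its tangent and the phase of g is that
of the potential, so arctan inverts the parametrization. -/
theorem eq_flip {ω : ℤ → ℂ} {j : ℤ} (hω : ‖ω j‖ < Real.pi) {g : ℂ}
    (h : sinP ω j = g * cosP ω j) : ω j = flip g := by
  have hμ : ‖potential ω j‖ < Real.pi / 2 := by rw [norm_potential]; linarith
  have hμ0 := norm_nonneg (potential ω j)
  have hω' : ω j = -2 * Complex.I * conj (potential ω j) := by
    simp only [potential, map_mul, map_neg, map_div₀, Complex.conj_I, Complex.conj_conj,
      Complex.conj_ofNat]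
    linear_combination ω j * Complex.I_mul_I
  have hcos : 0 < Real.cos ‖potential ω j‖ :=
    Real.cos_pos_of_mem_Ioo ⟨by linarith [Real.pi_pos], hμ⟩
  have hg : ‖g‖ = Real.tan ‖potential ω j‖ := by
    have := congrArg norm h
    rw [norm_sinP, abs_of_nonneg (Real.sin_nonneg_of_nonneg_of_le_pi hμ0
      (by linarith [Real.pi_pos])), norm_mul, Complex.norm_real, cosP, Real.norm_of_nonneg hcos.le]
      at this
    rw [Real.tan_eq_sin_div_cos, this, mul_div_cancel_right₀ _ hcos.ne']
  have ha : Real.arctan ‖g‖ = ‖potential ω j‖ := by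
    rw [hg, Real.arctan_tan (by linarith [Real.pi_pos]) hμ]
  rw [hω', flip, ha]
  congr 2
  by_cases hp : potential ω j = 0
  · simp [hp]
  have hp0 : (‖potential ω j‖ : ℂ) ≠ 0 := by exact_mod_cast norm_ne_zero_iff.2 hp
  have hc0 : (Real.cos ‖potential ω j‖ : ℂ) ≠ 0 := by exact_mod_cast hcos.ne'
  have hs0 : (Real.sin ‖potential ω j‖ : ℂ) ≠ 0 := by
    exact_mod_cast (Real.sin_pos_of_pos_of_lt_pi (norm_pos_iff.2 hp)
      (by linarith [Real.pi_pos])).ne'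
  have hgc : (‖g‖ : ℂ) * Real.cos ‖potential ω j‖ = Real.sin ‖potential ω j‖ := by
    rw [hg, Real.tan_eq_sin_div_cos]
    push_cast
    push_cast at hc0
    field_simp
  have hg0 : (‖g‖ : ℂ) ≠ 0 := by
    intro h0
    rw [h0, zero_mul] at hgc
    exact hs0 hgc.symm
  rw [sinP, cosP] at h
  have e : g = potential ω j / ‖potential ω j‖ * ‖g‖ := by
    apply mul_right_cancel₀ hc0
    rw [← h, mul_assoc, hgc]
  have e2 : g / ‖g‖ = potential ω j / ‖potential ω j‖ := by
    rw [div_eq_iff hg0]; exact e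
  rw [e2, mul_div_cancel₀ _ hp0]

theorem sq_norm_sub_le (x y c : ℂ) :
    Complex.normSq (x - y) ≤ 2 * Complex.normSq (x - c) + 2 * Complex.normSq (y - c) := by
  simp only [Complex.normSq_apply, Complex.sub_re, Complex.sub_im]
  nlinarith [sq_nonneg (x.re - c.re + (y.re - c.re)), sq_nonneg (x.im - c.im + (y.im - c.im))]

/-- By the unit norm, |h - 1|^2 + |k|^2 = 2 - 2 Re h on the circle. Convergence of h_j(0) to 1 thus
controls the L^2 distance to (1, 0). -/
theorem avg_normSq_sub_one {h k : ℂ → ℂ} (dh : DA h)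
    (u : ∀ w : Circle, h w * conj (h w) + k w * conj (k w) = 1) :
    avg (fun w : Circle => Complex.normSq (h w - 1) + Complex.normSq (k w)) =
      2 - 2 * (h 0).re := by
  have e : (fun w : Circle => ((Complex.normSq (h w - 1) + Complex.normSq (k w) : ℝ) : ℂ)) =
      fun w : Circle => (2 - h w) - conj (h w) := by
    ext w
    have := u w
    push_cast
    rw [← Complex.mul_conj, ← Complex.mul_conj, map_sub, map_one]
    linear_combination this
  have h1 : avg (fun w : Circle => ((Complex.normSq (h w - 1) + Complex.normSq (k w) : ℝ) : ℂ)) =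
      2 - h 0 - conj (h 0) := by
    rw [e]
    have ch := dh.continuous_circle
    have e1 : avg (fun w : Circle => (2 - h w) - conj (h w)) =
      avg (fun w : Circle => 2 - h w) - avg (fun w : Circle => conj (h w)) :=
      avg_sub (continuous_const.sub ch) (Complex.continuous_conj.comp ch)
    have e2 : avg (fun w : Circle => 2 - h w) = avg (fun _ : Circle => (2 : ℂ)) -
      avg (fun w : Circle => h w) := avg_sub continuous_const ch
    rw [e1, e2, avg_conj (fun w : Circle => h w), avg_DA dh, avg_const]
  rw [avg_ofReal] at h1
  have := congrArg Complex.re h1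
  simp only [Complex.ofReal_re, Complex.sub_re, Complex.conj_re, Complex.re_ofNat] at this
  linarith

/-- Two normalized families with the same norm preserving evolution agree if both are
asymptotically trivial in the mean. -/
theorem eq_of_tendsto_zero {l : Filter ℤ} (hl : l = atTop ∨ l = atBot) {h k h' k' : ℤ → ℂ → ℂ}
    (dh : ∀ j, DA (h j)) (dk : ∀ j, DA (k j)) (dh' : ∀ j, DA (h' j)) (dk' : ∀ j, DA (k' j))
    (u : ∀ j (w : Circle), h j w * conj (h j w) + k j w * conj (k j w) = 1)
    (u' : ∀ j (w : Circle), h' j w * conj (h' j w) + k' j w * conj (k' j w) = 1)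
    (step : ∀ j (w : Circle), Complex.normSq (h (j + 1) w - h' (j + 1) w) +
      Complex.normSq (k (j + 1) w - k' (j + 1) w) =
      Complex.normSq (h j w - h' j w) + Complex.normSq (k j w - k' j w))
    (lim : Tendsto (fun j => h j 0) l (𝓝 1)) (lim' : Tendsto (fun j => h' j 0) l (𝓝 1))
    (j : ℤ) {z : ℂ} (hz : z ∈ closedBall (0 : ℂ) 1) : h j z = h' j z ∧ k j z = k' j z := by
  set d : ℤ → ℝ := fun j => avg fun w : Circle =>
    Complex.normSq (h j w - h' j w) + Complex.normSq (k j w - k' j w) with hd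
  have ch := fun j => (dh j).continuous_circle
  have ck := fun j => (dk j).continuous_circle
  have ch' := fun j => (dh' j).continuous_circle
  have ck' := fun j => (dk' j).continuous_circle
  have cd : ∀ j, Continuous fun w : Circle =>
      Complex.normSq (h j w - h' j w) + Complex.normSq (k j w - k' j w) := fun j =>
    (Complex.continuous_normSq.comp ((ch j).sub (ch' j))).add
      (Complex.continuous_normSq.comp ((ck j).sub (ck' j)))
  have c1 : ∀ j, Continuous fun w : Circle =>
      Complex.normSq (h j w - 1) + Complex.normSq (k j w) := fun j =>
    (Complex.continuous_normSq.comp ((ch j).sub continuous_const)).add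
      (Complex.continuous_normSq.comp (ck j))
  have c2 : ∀ j, Continuous fun w : Circle =>
      Complex.normSq (h' j w - 1) + Complex.normSq (k' j w) := fun j =>
    (Complex.continuous_normSq.comp ((ch' j).sub continuous_const)).add
      (Complex.continuous_normSq.comp (ck' j))
  have hper : ∀ j, d (j + 1) = d j := fun j => congrArg avg (funext fun w => step j w)
  have hnn : ∀ j, 0 ≤ d j := fun j => avg_nonneg fun w =>
    add_nonneg (Complex.normSq_nonneg _) (Complex.normSq_nonneg _)
  have hle : ∀ j, d j ≤ 2 * (2 - 2 * (h j 0).re) + 2 * (2 - 2 * (h' j 0).re) := by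
    intro j
    have c3 : Continuous fun w : Circle =>
        2 * (Complex.normSq (h j w - 1) + Complex.normSq (k j w)) :=
      continuous_const.mul (c1 j)
    have c4 : Continuous fun w : Circle =>
        2 * (Complex.normSq (h' j w - 1) + Complex.normSq (k' j w)) :=
      continuous_const.mul (c2 j)
    rw [← avg_normSq_sub_one (dh j) (u j), ← avg_normSq_sub_one (dh' j) (u' j),
      ← avg_const_mul, ← avg_const_mul, ← avg_add c3 c4]
    refine avg_mono (cd j) (c3.add c4) fun w => ?_
    have e1 := sq_norm_sub_le (h j w) (h' j w) 1
    have e2 := sq_norm_sub_le (k j w) (k' j w) 0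
    rw [sub_zero, sub_zero] at e2
    linarith
  have hre : ∀ {f : ℤ → ℂ}, Tendsto f l (𝓝 1) → Tendsto (fun j => 2 * (2 - 2 * (f j).re)) l (𝓝 0) := by
    intro f hf
    have h1 : Tendsto (fun j => (f j).re) l (𝓝 1) := (Complex.continuous_re.tendsto 1).comp hf
    have h2 := ((h1.const_mul 2).const_sub 2).const_mul 2
    norm_num at h2
    exact h2
  have hlim : Tendsto d l (𝓝 0) :=
    squeeze_zero hnn hle (by simpa using (hre lim).add (hre lim'))
  have hd0 : d j = 0 := by
    rcases hl with rfl | rfl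
    · exact eq_zero_of_periodic_atTop hper hlim j
    · exact eq_zero_of_periodic_atBot hper hlim j
  have key : ∀ w : Circle, h j w = h' j w ∧ k j w = k' j w := by
    intro w
    have := eq_zero_of_avg_eq_zero (cd j)
      (fun w => add_nonneg (Complex.normSq_nonneg _) (Complex.normSq_nonneg _)) hd0 w
    rw [add_eq_zero_iff_of_nonneg (Complex.normSq_nonneg _) (Complex.normSq_nonneg _),
      Complex.normSq_eq_zero, Complex.normSq_eq_zero] at this
    exact ⟨sub_eq_zero.1 this.1, sub_eq_zero.1 this.2⟩
  exact ⟨(dh j).eq_of_circle (dh' j) (fun w => (key w).1) hz,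
    (dk j).eq_of_circle (dk' j) (fun w => (key w).2) hz⟩

variable {r : Circle → ℂ} {a : ℂ → ℂ} {E E' : Polynomial ℂ} {h k U V : ℤ → ℂ → ℂ}

theorem NSol.h_zero_ne {j : ℤ} {h k U V : ℂ → ℂ} (S : NSol r a E j h k U V) : h 0 ≠ 0 := by
  obtain ⟨t, ht, hh⟩ := S.pos
  rw [hh]; exact_mod_cast ht.ne'

/-- The evolution of the normalized solutions. -/
theorem nsol_step (D : ScatData r a E E') (S : ∀ j, NSol r a E j (h j) (k j) (U j) (V j))
    (j : ℤ) {z : ℂ} (hz : z ∈ closedBall (0 : ℂ) 1) :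
    h (j + 1) z = cosOf (k j 0 / h j 0) * h j z + conj (sinOf (k j 0 / h j 0)) * k j z ∧
    z * k (j + 1) z = -sinOf (k j 0 / h j 0) * h j z + cosOf (k j 0 / h j 0) * k j z ∧
    U (j + 1) z = cosOf (k j 0 / h j 0) * U j z + sinOf (k j 0 / h j 0) * V j z ∧
    V (j + 1) z = z * (-conj (sinOf (k j 0 / h j 0)) * U j z +
      cosOf (k j 0 / h j 0) * V j z) := by
  have hg : k j 0 = k j 0 / h j 0 * h j 0 := (div_mul_cancel₀ _ (S j).h_zero_ne).symm
  obtain ⟨e1, e2, e3, e4⟩ := (S (j + 1)).ext_circle ((S j).next hg) D hz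
  refine ⟨e1, ?_, e3, e4⟩
  rw [e2]
  refine mul_dslope_zero (f := fun z => -sinOf (k j 0 / h j 0) * h j z +
    cosOf (k j 0 / h j 0) * k j z) ?_ z
  rw [sinOf]
  linear_combination (cosOf (k j 0 / h j 0) : ℂ) * hg

theorem tendsto_atTop_of_nat {f : ℤ → ℂ} {c : ℂ} (h : Tendsto (fun n : ℕ => f n) atTop (𝓝 c)) :
    Tendsto f atTop (𝓝 c) := by
  have l : Tendsto Int.toNat atTop atTop := tendsto_atTop.2 fun b => by
    filter_upwards [eventually_ge_atTop (b : ℤ)] with j hj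
    omega
  refine (h.comp l).congr' ?_
  filter_upwards [eventually_ge_atTop 0] with j hj
  rw [Function.comp_apply, Int.toNat_of_nonneg hj]

/-- The a priori bounds cover positive times. At negative times they are applied to the reversed
family, whose parameter at n is minus the conjugate of the original one at -n. -/
theorem nsol_summable (D : ScatData r a E E') (hr : SobolevLip r) (ha : SobolevLip fun w => a w)
    (S : ∀ j, NSol r a E j (h j) (k j) (U j) (V j)) :
    (Summable fun j => ‖k j 0 / h j 0‖) ∧ Tendsto (fun j => h j 0) atTop (𝓝 1) ∧
      Tendsto (fun j => U j 0) atBot (𝓝 1) := by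
  obtain ⟨s1, l1⟩ := summable_of_nsol (fun j : ℕ => S j) D hr ha
  have S' : ∀ n : ℕ, NSol (dualCoeff r a) a E' n (U (1 - n)) (dslope (V (1 - n)) 0) (h (1 - n))
      (fun z => z * k (1 - n) z) := fun n => by
    have := (S (1 - n)).dual D
    rwa [sub_sub_cancel] at this
  obtain ⟨s2, l2⟩ := summable_of_nsol S' D.dual (D.sobolev_dual hr ha) ha
  have hU : ∀ j, U j 0 ≠ 0 := fun j => by
    obtain ⟨t, ht, hh⟩ := (S j).U_pos D
    rw [hh]; exact_mod_cast ht.ne'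
  have key : ∀ n : ℕ, ‖dslope (V (1 - n)) 0 0 / U (1 - n) 0‖ = ‖k (-n) 0 / h (-n) 0‖ := by
    intro n
    have st := fun {z : ℂ} (hz : z ∈ closedBall (0 : ℂ) 1) => nsol_step D S (-n) hz
    rw [show -(n : ℤ) + 1 = 1 - n by ring] at st
    set g := k (-n) 0 / h (-n) 0
    have e0 : dslope (V (1 - n)) 0 0 = -conj (sinOf g) * U (-n) 0 + cosOf g * V (-n) 0 := by
      refine (S (1 - n)).dV.dslope_zero.eq_of_circle
        (((S (-n)).dU.const_mul _).add' ((S (-n)).dV.const_mul _)) (fun w => ?_)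
        zero_mem_unitClosedBall
      apply mul_left_cancel₀ w.coe_ne_zero
      rw [mul_dslope_zero (S (1 - n)).V_zero]
      exact (st (circle_mem_closedBall w)).2.2.2
    have hc := cosOf_pos g
    have hc0 : (cosOf g : ℂ) ≠ 0 := by exact_mod_cast hc.ne'
    rw [e0, (st zero_mem_unitClosedBall).2.2.1, (S (-n)).V_zero, sinOf, map_mul,
      Complex.conj_ofReal, mul_zero, mul_zero, add_zero, add_zero]
    have hU0 := hU (-n)
    have : -(cosOf g * conj g) * U (-n) 0 / (cosOf g * U (-n) 0) = -conj g := by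
      field_simp
    rw [this, norm_neg, RCLike.norm_conj]
  refine ⟨Summable.of_nat_of_neg s1 (s2.congr key), ?_, ?_⟩
  · exact tendsto_atTop_of_nat l1
  · obtain ⟨f, hf⟩ : ∃ f : ℤ → ℂ, ∀ j, f j = U (1 - j) 0 := ⟨_, fun _ => rfl⟩
    have l2' : Tendsto (fun n : ℕ => f n) atTop (𝓝 1) := by
      simp only [hf]
      exact l2
    have l3 : Tendsto f atTop (𝓝 1) := tendsto_atTop_of_nat l2'
    have l4 : Tendsto (fun j : ℤ => 1 - j) atBot atTop := by
      simp only [sub_eq_add_neg]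
      exact tendsto_atTop_add_const_left _ 1 tendsto_neg_atBot_atTop
    refine (l3.comp l4).congr fun j => ?_
    rw [Function.comp_apply, hf, sub_sub_cancel]

/-- The family of normalized solutions consists of the Jost functions of a hard pulse. -/
theorem jost_of_nsol (D : ScatData r a E E') (hr : SobolevLip r) (ha : SobolevLip fun w => a w)
    (S : ∀ j, NSol r a E j (h j) (k j) (U j) (V j)) :
    IsHardPulse (fun j => flip (k j 0 / h j 0)) ∧
      Jost (fun j => flip (k j 0 / h j 0)) h k U V := by
  obtain ⟨hs, lh, lU⟩ := nsol_summable D hr ha S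
  set γ : ℤ → ℂ := fun j => k j 0 / h j 0
  have hω : IsHardPulse fun j => flip (γ j) :=
    ⟨Summable.of_nonneg_of_le (fun _ => norm_nonneg _) (fun j => norm_flip_le _) (hs.mul_left 2),
      fun j => norm_flip_lt _⟩
  refine ⟨hω, ?_⟩
  -- The genuine Jost functions of the constructed pulse obey the same recursion as the family and
  -- share its limits at the origin, so L^2 conservation identifies the two.
  obtain ⟨h', k', U', V', J⟩ := hω.exists_jost
  have st : ∀ j, ∀ z ∈ closedBall (0 : ℂ) 1,
      h (j + 1) z = cosP (fun j => flip (γ j)) j * h j z +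
        conj (sinP (fun j => flip (γ j)) j) * k j z ∧
      z * k (j + 1) z = -sinP (fun j => flip (γ j)) j * h j z +
        cosP (fun j => flip (γ j)) j * k j z ∧
      U (j + 1) z = cosP (fun j => flip (γ j)) j * U j z + sinP (fun j => flip (γ j)) j * V j z ∧
      V (j + 1) z = z * (-conj (sinP (fun j => flip (γ j)) j) * U j z +
        cosP (fun j => flip (γ j)) j * V j z) := by
    intro j z hz
    rw [cosP_flip, sinP_flip]
    exact nsol_step D S j hz
  have cs := cosP_sq_add fun j => flip (γ j)
  have sh : ∀ j, ∀ z ∈ closedBall (0 : ℂ) 1, h j z = cosP (fun j => flip (γ j)) j * h (j + 1) z -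
      conj (sinP (fun j => flip (γ j)) j) * (z * k (j + 1) z) := by
    intro j z hz
    rw [(st j z hz).1, (st j z hz).2.1]
    linear_combination -h j z * cs j
  have sk : ∀ j, ∀ z ∈ closedBall (0 : ℂ) 1, k j z = sinP (fun j => flip (γ j)) j * h (j + 1) z +
      cosP (fun j => flip (γ j)) j * (z * k (j + 1) z) := by
    intro j z hz
    rw [(st j z hz).1, (st j z hz).2.1]
    linear_combination -k j z * cs j
  have right : ∀ j {z : ℂ}, z ∈ closedBall (0 : ℂ) 1 → h j z = h' j z ∧ k j z = k' j z := by
    intro j z hz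
    refine eq_of_tendsto_zero (Or.inl rfl) (fun j => (S j).dh) (fun j => (S j).dk) J.dh J.dk
      (fun j => (S j).unit) J.unit_right (fun j w => ?_) lh (J.lim_h zero_mem_unitClosedBall) j hz
    have hw := circle_mem_closedBall w
    have e := normSq_transfer (cs j) (h (j + 1) w - h' (j + 1) w)
      (w * (k (j + 1) w - k' (j + 1) w))
    rw [map_mul, w.normSq_coe, one_mul] at e
    rw [sh j w hw, sk j w hw, J.step_h j w hw, J.step_k j w hw, ← e]
    congr 2 <;> ring
  have left : ∀ j {z : ℂ}, z ∈ closedBall (0 : ℂ) 1 → U j z = U' j z ∧ V j z = V' j z := by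
    intro j z hz
    have uU : ∀ j (w : Circle), U j w * conj (U j w) + V j w * conj (V j w) = 1 := by
      intro j w
      have e := ((S j).dual D).unit w
      have e' := mul_dslope_zero (S j).V_zero w
      have e'' := congrArg conj e'
      rw [map_mul] at e''
      rw [← e, ← e', map_mul]
      linear_combination dslope (V j) 0 w * conj (dslope (V j) 0 w) * circle_mul_conj w
    refine eq_of_tendsto_zero (Or.inr rfl) (fun j => (S j).dU) (fun j => (S j).dV) J.dU J.dV
      uU J.unit_left (fun j w => ?_) lU (J.lim_U zero_mem_unitClosedBall) j hz
    have hw := circle_mem_closedBall w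
    have e := normSq_step (cs j) w (U j w - U' j w) (V j w - V' j w)
    rw [(st j w hw).2.2.1, (st j w hw).2.2.2, J.step_U j w hw, J.step_V j w hw, ← e]
    congr 2 <;> ring
  obtain ⟨η, hη, hb⟩ := J.lim_right
  obtain ⟨η', hη', hb'⟩ := J.lim_left
  exact
    { dh := fun j => (S j).dh, dk := fun j => (S j).dk, dU := fun j => (S j).dU
      dV := fun j => (S j).dV, step_h := sh, step_k := sk
      step_U := fun j z hz => (st j z hz).2.2.1
      step_V := fun j z hz => (st j z hz).2.2.2
      lim_right := ⟨η, hη, fun j z hz => by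
        rw [(right j hz).1, (right j hz).2]; exact hb j z hz⟩
      lim_left := ⟨η', hη', fun j z hz => by
        rw [(left j hz).1, (left j hz).2]; exact hb' j z hz⟩ }

end HardPulse

namespace HardPulse

/-! ### Bound state data -/

theorem analyticOrderAt_congr_ball {f g : ℂ → ℂ} {z : ℂ} (hz : z ∈ ball (0 : ℂ) 1)
    (h : ∀ y ∈ ball (0 : ℂ) 1, f y = g y) : analyticOrderAt f z = analyticOrderAt g z :=
  analyticOrderAt_congr (by filter_upwards [isOpen_ball.mem_nhds hz] with y hy using h y hy)

theorem le_order_mul {f g : ℂ → ℂ} {z : ℂ} {d : ℕ∞} (hf : AnalyticAt ℂ f z)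
    (hg : AnalyticAt ℂ g z) (h : d ≤ analyticOrderAt g z) :
    d ≤ analyticOrderAt (fun w => f w * g w) z := by
  change d ≤ analyticOrderAt (f * g) z
  rw [analyticOrderAt_mul hf hg]
  exact h.trans le_add_self

theorem le_order_of_mul {f g : ℂ → ℂ} {z : ℂ} {d : ℕ∞} (hf : AnalyticAt ℂ f z)
    (hg : AnalyticAt ℂ g z) (h0 : f z ≠ 0) (h : d ≤ analyticOrderAt (fun w => f w * g w) z) :
    d ≤ analyticOrderAt g z := by
  change d ≤ analyticOrderAt (f * g) z at h
  rwa [analyticOrderAt_mul hf hg, hf.analyticOrderAt_eq_zero.2 h0, zero_add] at h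

theorem le_order_add {f g : ℂ → ℂ} {z : ℂ} {d : ℕ∞} (hf : d ≤ analyticOrderAt f z)
    (hg : d ≤ analyticOrderAt g z) : d ≤ analyticOrderAt (fun w => f w + g w) z :=
  (le_min hf hg).trans le_analyticOrderAt_add

theorem le_order_sub {f g : ℂ → ℂ} {z : ℂ} {d : ℕ∞} (hf : d ≤ analyticOrderAt f z)
    (hg : d ≤ analyticOrderAt g z) : d ≤ analyticOrderAt (fun w => f w - g w) z :=
  (le_min hf hg).trans le_analyticOrderAt_sub

theorem analyticAt_zpow {z : ℂ} (hz : z ≠ 0) (j : ℤ) : AnalyticAt ℂ (fun w : ℂ => w ^ j) z :=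
  analyticAt_id.fun_zpow hz

theorem analyticAt_eval (p : Polynomial ℂ) (z : ℂ) : AnalyticAt ℂ (fun w => p.eval w) z :=
  AnalyticOnNhd.eval_polynomial _ z trivial

theorem BoundStateData.eq_of {D D' : BoundStateData} (h1 : D.mult = D'.mult)
    (h2 : D.norming = D'.norming) : D = D' := by
  cases D; cases D'; cases h1; cases h2; rfl

theorem BoundStateData.mult_zero (D : BoundStateData) : D.mult 0 = 0 := by
  by_contra h
  exact (D.mem_disk 0 (Finsupp.mem_support_iff.2 h)).1 rfl

theorem BoundStateData.mult_of_notMem (D : BoundStateData) {z : ℂ} (hz : z ∉ ball (0 : ℂ) 1) :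
    D.mult z = 0 := by
  by_contra h
  exact hz (mem_ball_zero_iff.2 (D.mem_disk z (Finsupp.mem_support_iff.2 h)).2)

/-- The initial value is the infinite product of the c_n, hence real and nonnegative. It is not
zero, because some later x_n is nonzero and the partial products are positive. -/
theorem exists_pos_of_tendsto {x : ℕ → ℂ} {c : ℕ → ℝ} (hc : ∀ n, 0 < c n)
    (hx : ∀ n, x n = c n * x (n + 1)) (lim : Tendsto x atTop (𝓝 1)) :
    ∃ t : ℝ, 0 < t ∧ x 0 = t := by
  have hP : ∀ n, x 0 = (∏ i ∈ Finset.range n, c i : ℝ) * x n := by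
    intro n
    induction n with
    | zero => simp
    | succ n ih =>
      rw [ih, Finset.prod_range_succ, hx n]
      push_cast; ring
  have hpos : ∀ n, 0 < ∏ i ∈ Finset.range n, c i := fun n => Finset.prod_pos fun i _ => hc i
  have hne : ∀ᶠ n in atTop, x n ≠ 0 := lim.eventually_ne one_ne_zero
  have hlim : Tendsto (fun n => x 0 / x n) atTop (𝓝 (x 0)) := by
    have := (tendsto_const_nhds (x := x 0)).div lim one_ne_zero
    rw [div_one] at this
    exact this
  have hev : ∀ᶠ n in atTop, ((∏ i ∈ Finset.range n, c i : ℝ) : ℂ) = x 0 / x n := by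
    filter_upwards [hne] with n hn
    rw [eq_div_iff hn, ← hP n]
  have hlim' : Tendsto (fun n => ((∏ i ∈ Finset.range n, c i : ℝ) : ℂ)) atTop (𝓝 (x 0)) :=
    hlim.congr' (hev.mono fun n hn => hn.symm)
  have hre : Tendsto (fun n => ∏ i ∈ Finset.range n, c i) atTop (𝓝 (x 0).re) := by
    have := (Complex.continuous_re.tendsto _).comp hlim'
    exact this
  have him : (x 0).im = 0 := by
    have := (Complex.continuous_im.tendsto _).comp hlim'
    simp only [Function.comp_def, Complex.ofReal_im] at this
    exact (tendsto_nhds_unique tendsto_const_nhds this).symm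
  have h0 : 0 ≤ (x 0).re := ge_of_tendsto' hre fun n => (hpos n).le
  have hx0 : x 0 = (x 0).re := Complex.ext rfl (by simp [him])
  refine ⟨(x 0).re, lt_of_le_of_ne h0 fun h => ?_, hx0⟩
  obtain ⟨n, hn⟩ := hne.exists
  rw [← h, Complex.ofReal_zero, hP n] at hx0
  exact mul_ne_zero (by exact_mod_cast (hpos n).ne') hn hx0

namespace Jost

variable {ω : ℤ → ℂ} {h k U V : ℤ → ℂ → ℂ}

theorem h_pos (J : Jost ω h k U V) (hω : IsHardPulse ω) (j : ℤ) :
    ∃ t : ℝ, 0 < t ∧ h j 0 = t := by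
  have l : Tendsto (fun n : ℕ => j + n) atTop atTop :=
    tendsto_atTop_add_const_left _ j tendsto_natCast_atTop_atTop
  have := exists_pos_of_tendsto (x := fun n : ℕ => h (j + n) 0) (c := fun n => cosP ω (j + n))
    (fun n => hω.cosP_pos _) (fun n => by
      have := J.step_h (j + n) 0 zero_mem_unitClosedBall
      rw [this]
      push_cast
      rw [add_assoc]
      ring) ((J.lim_h zero_mem_unitClosedBall).comp l)
  simpa using this

theorem U_pos (J : Jost ω h k U V) (hω : IsHardPulse ω) (j : ℤ) :
    ∃ t : ℝ, 0 < t ∧ U j 0 = t := by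
  have l : Tendsto (fun n : ℕ => j + -(n : ℤ)) atTop atBot :=
    tendsto_atBot_add_const_left _ j
      (tendsto_neg_atTop_atBot.comp tendsto_natCast_atTop_atTop)
  have := exists_pos_of_tendsto (x := fun n : ℕ => U (j + -(n : ℤ)) 0)
    (c := fun n : ℕ => cosP ω (j + -((n + 1 : ℕ) : ℤ)))
    (fun n => hω.cosP_pos _) (fun n => by
      have := J.step_U (j + -((n + 1 : ℕ) : ℤ)) 0 zero_mem_unitClosedBall
      rw [J.V_zero, mul_zero, add_zero] at this
      rw [← this]
      congr 1
      push_cast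
      ring) ((J.lim_U zero_mem_unitClosedBall).comp l)
  simpa using this

/-- At the origin the terms with z drop out, so h_j(0) and k_j(0) are c_j and s_j times h_(j+1)(0).
Hence the pulse is read off from its Jost functions. -/
theorem eq_flip (J : Jost ω h k U V) (hω : IsHardPulse ω) (j : ℤ) :
    ω j = flip (k j 0 / h j 0) := by
  refine HardPulse.eq_flip (hω.norm_lt j) ?_
  have e1 := J.step_h j 0 zero_mem_unitClosedBall
  have e2 := J.step_k j 0 zero_mem_unitClosedBall
  obtain ⟨t, ht, h0⟩ := J.h_pos hω j
  have hne : h j 0 ≠ 0 := by rw [h0]; exact_mod_cast ht.ne'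
  rw [div_mul_eq_mul_div, eq_div_iff hne, e1, e2]
  ring

/-- A common zero at z ≠ 0 would propagate to all later times, against h_j(z) → 1. -/
theorem right_ne_zero (J : Jost ω h k U V) (j : ℤ) {z : ℂ} (hz : z ∈ closedBall (0 : ℂ) 1)
    (h0 : z ≠ 0) : h j z ≠ 0 ∨ k j z ≠ 0 := by
  by_contra! hc
  have key : ∀ n : ℕ, h (j + n) z = 0 ∧ k (j + n) z = 0 := by
    intro n
    induction n with
    | zero => simpa using hc
    | succ n ih =>
      have e1 := J.next_h (j + n) hz
      have e2 := J.next_k (j + n) hz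
      rw [ih.1, ih.2] at e1 e2
      rw [Nat.cast_succ, ← add_assoc]
      refine ⟨by simpa using e1, ?_⟩
      have : z * k (j + n + 1) z = 0 := by simpa using e2
      exact (mul_eq_zero.1 this).resolve_left h0
  have l : Tendsto (fun n : ℕ => j + n) atTop atTop :=
    tendsto_atTop_add_const_left _ j tendsto_natCast_atTop_atTop
  have := (J.lim_h hz).comp l
  simp only [Function.comp_def, (key _).1] at this
  exact zero_ne_one (tendsto_nhds_unique tendsto_const_nhds this)

theorem left_ne_zero (J : Jost ω h k U V) (j : ℤ) {z : ℂ} (hz : z ∈ closedBall (0 : ℂ) 1)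
    (h0 : z ≠ 0) : U j z ≠ 0 ∨ V j z ≠ 0 := by
  by_contra! hc
  have key : ∀ n : ℕ, U (j + -(n : ℤ)) z = 0 ∧ V (j + -(n : ℤ)) z = 0 := by
    intro n
    induction n with
    | zero => simpa using hc
    | succ n ih =>
      have e1 := J.prev_U (j + -((n + 1 : ℕ) : ℤ)) hz
      have e2 := J.prev_V (j + -((n + 1 : ℕ) : ℤ)) hz
      have e : j + -((n + 1 : ℕ) : ℤ) + 1 = j + -(n : ℤ) := by push_cast; ring
      rw [e, ih.1, ih.2] at e1 e2
      exact ⟨(mul_eq_zero.1 (by simpa using e1)).resolve_left h0,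
        (mul_eq_zero.1 (by simpa using e2)).resolve_left h0⟩
  have l : Tendsto (fun n : ℕ => j + -(n : ℤ)) atTop atBot :=
    tendsto_atBot_add_const_left _ j
      (tendsto_neg_atTop_atBot.comp tendsto_natCast_atTop_atTop)
  have := (J.lim_U hz).comp l
  simp only [Function.comp_def, (key _).1] at this
  exact zero_ne_one (tendsto_nhds_unique tendsto_const_nhds this)

theorem hasBoundStateData_iff (J : Jost ω h k U V) {D : BoundStateData} :
    HasBoundStateData ω D ↔
      (∀ z ∈ ball (0 : ℂ) 1,
        analyticOrderAt (fun w => h 0 w * U 0 w + k 0 w * V 0 w) z = (D.mult z : ℕ∞)) ∧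
      (∀ z ∈ ball (0 : ℂ) 1, ∀ j : ℤ,
        (D.mult z : ℕ∞) ≤
          analyticOrderAt (fun w => U j w + (D.norming z).eval w * w ^ j * k j w) z ∧
        (D.mult z : ℕ∞) ≤
          analyticOrderAt (fun w => V j w - (D.norming z).eval w * w ^ j * h j w) z) := by
  constructor
  · rintro ⟨Am, Bm, Ap, Bp, L, R, o, c⟩
    have l := fun (j : ℤ) {y : ℂ} (hy : y ∈ ball (0 : ℂ) 1) =>
      L.unique J.isLeftJost j (ball_mem_closedBall hy)
    have r := fun (j : ℤ) {y : ℂ} (hy : y ∈ ball (0 : ℂ) 1) =>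
      R.unique J.isRightJostConj j (ball_mem_closedBall hy)
    refine ⟨fun z hz => ?_, fun z hz j => ⟨?_, ?_⟩⟩
    · rw [← o z hz]
      exact analyticOrderAt_congr_ball hz fun y hy => by
        rw [(l 0 hy).1, (l 0 hy).2, (r 0 hy).1, (r 0 hy).2]
    · refine (c z hz j).1.trans_eq (analyticOrderAt_congr_ball hz fun y hy => ?_)
      rw [(l j hy).1, (r j hy).2]
    · refine (c z hz j).2.trans_eq (analyticOrderAt_congr_ball hz fun y hy => ?_)
      rw [(l j hy).2, (r j hy).1]
  · rintro ⟨o, c⟩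
    exact ⟨U, V, h, k, J.isLeftJost, J.isRightJostConj, o, c⟩

/-- Congruences at an energy propagate in time. -/
theorem congruence_all (J : Jost ω h k U V) {z : ℂ} (hz : z ∈ ball (0 : ℂ) 1) (h0 : z ≠ 0)
    {p : Polynomial ℂ} {d : ℕ∞}
    (c : d ≤ analyticOrderAt (fun w => U 0 w + p.eval w * w ^ (0 : ℤ) * k 0 w) z ∧
      d ≤ analyticOrderAt (fun w => V 0 w - p.eval w * w ^ (0 : ℤ) * h 0 w) z) (j : ℤ) :
    d ≤ analyticOrderAt (fun w => U j w + p.eval w * w ^ j * k j w) z ∧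
      d ≤ analyticOrderAt (fun w => V j w - p.eval w * w ^ j * h j w) z := by
  have aP : ∀ j, AnalyticAt ℂ (fun w => U j w + p.eval w * w ^ j * k j w) z := fun j =>
    ((J.dU j).analyticAt hz).add
      (((analyticAt_eval p z).mul (analyticAt_zpow h0 j)).mul ((J.dk j).analyticAt hz))
  have aQ : ∀ j, AnalyticAt ℂ (fun w => V j w - p.eval w * w ^ j * h j w) z := fun j =>
    ((J.dV j).analyticAt hz).sub
      (((analyticAt_eval p z).mul (analyticAt_zpow h0 j)).mul ((J.dh j).analyticAt hz))
  have hU : {w : ℂ | w ∈ ball (0 : ℂ) 1 ∧ w ≠ 0} ∈ 𝓝 z :=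
    inter_mem (isOpen_ball.mem_nhds hz) (isOpen_ne.mem_nhds h0)
  induction j using Int.induction_on with
  | zero => exact c
  | succ i ih =>
    constructor
    · have := le_order_add (le_order_mul (f := fun _ => (cosP ω i : ℂ)) analyticAt_const (aP i) ih.1)
        (le_order_mul (f := fun _ => sinP ω i) analyticAt_const (aQ i) ih.2)
      refine this.trans_eq (analyticOrderAt_congr ?_)
      filter_upwards [hU] with w ⟨hw, hw0⟩
      rw [J.step_U i w (ball_mem_closedBall hw), zpow_add_one₀ hw0]
      linear_combination -p.eval w * w ^ (i : ℤ) * J.next_k i (ball_mem_closedBall hw)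
    · have := le_order_add
        (le_order_mul (f := fun w => w * -conj (sinP ω i)) (analyticAt_id.mul analyticAt_const)
          (aP i) ih.1)
        (le_order_mul (f := fun w => w * (cosP ω i : ℂ)) (analyticAt_id.mul analyticAt_const)
          (aQ i) ih.2)
      refine this.trans_eq (analyticOrderAt_congr ?_)
      filter_upwards [hU] with w ⟨hw, hw0⟩
      rw [J.step_V i w (ball_mem_closedBall hw), zpow_add_one₀ hw0,
        J.next_h i (ball_mem_closedBall hw)]
      ring
  | pred i ih =>
    obtain ⟨m, hm⟩ : ∃ m : ℤ, m = -(i : ℤ) - 1 := ⟨_, rfl⟩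
    rw [← hm]
    rw [show -(i : ℤ) = m + 1 by rw [hm]; ring] at ih
    constructor
    · have := le_order_sub
        (le_order_mul (f := fun w => w * (cosP ω m : ℂ)) (analyticAt_id.mul analyticAt_const)
          (aP _) ih.1)
        (le_order_mul (f := fun _ => sinP ω m) analyticAt_const (aQ _) ih.2)
      -- The inverse step yields the congruence multiplied by w, which cancels since z ≠ 0.
      refine le_order_of_mul analyticAt_id (aP m) h0 (this.trans_eq (analyticOrderAt_congr ?_))
      filter_upwards [hU] with w ⟨hw, hw0⟩
      have e1 := J.prev_U m (ball_mem_closedBall hw)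
      have e2 := J.step_k m w (ball_mem_closedBall hw)
      rw [zpow_add_one₀ hw0, id]
      linear_combination -e1 - p.eval w * w ^ m * w * e2
    · have := le_order_add
        (le_order_mul (f := fun w => w * conj (sinP ω m)) (analyticAt_id.mul analyticAt_const)
          (aP _) ih.1)
        (le_order_mul (f := fun _ => (cosP ω m : ℂ)) analyticAt_const (aQ _) ih.2)
      refine le_order_of_mul analyticAt_id (aQ m) h0 (this.trans_eq (analyticOrderAt_congr ?_))
      filter_upwards [hU] with w ⟨hw, hw0⟩
      have e1 := J.prev_V m (ball_mem_closedBall hw)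
      have e2 := J.step_h m w (ball_mem_closedBall hw)
      rw [zpow_add_one₀ hw0, id]
      linear_combination -e1 + p.eval w * w ^ m * w * e2

end Jost

end HardPulse

namespace HardPulse

/-! ### Parameterization of the hard pulses by bound state data -/

/-- A transmission function is determined by its modulus and its zeros. -/
theorem transmission_unique {a a' : ℂ → ℂ} (da : DA a) (da' : DA a')
    (hn : ∀ w : Circle, ‖a w‖ = ‖a' w‖) (h1 : ∀ w : Circle, a w ≠ 0)
    (pos : ∃ t : ℝ, 0 < t ∧ a 0 = t) (pos' : ∃ t : ℝ, 0 < t ∧ a' 0 = t)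
    (ho : ∀ z ∈ ball (0 : ℂ) 1, analyticOrderAt a z = analyticOrderAt a' z) {z : ℂ}
    (hz : z ∈ closedBall (0 : ℂ) 1) : a z = a' z := by
  have h1' : ∀ w : Circle, a' w ≠ 0 := fun w => by
    rw [← norm_ne_zero_iff, ← hn, norm_ne_zero_iff]; exact h1 w
  obtain ⟨t, ht, e⟩ := pos
  obtain ⟨t', ht', e'⟩ := pos'
  have h0 : a 0 ≠ 0 := by rw [e]; exact_mod_cast ht.ne'
  have h0' : a' 0 ≠ 0 := by rw [e']; exact_mod_cast ht'.ne'
  obtain ⟨q, dq, hq⟩ := DiskDvd.exists_mul_eq (a := a) (f := a')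
    (fun z hz _ => (ho z hz).le) da da' h1 h0
  obtain ⟨q', dq', hq'⟩ := DiskDvd.exists_mul_eq (a := a') (f := a)
    (fun z hz _ => (ho z hz).ge) da' da h1' h0'
  have hqq : ∀ z ∈ closedBall (0 : ℂ) 1, q z * q' z = 1 := fun z hz => by
    refine (dq.mul dq').eq_of_circle (DA.const 1) (fun w => ?_) hz
    have e1 := hq w (circle_mem_closedBall w)
    have e2 := hq' w (circle_mem_closedBall w)
    apply mul_left_cancel₀ (h1 w)
    rw [mul_one, ← mul_assoc, ← e1, ← e2]
  have hc : ∀ z ∈ closedBall (0 : ℂ) 1, q z = q 0 := fun z hz => by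
    refine dq.eq_of_norm_eq_one (fun z hz h => ?_) (fun w => ?_) hz
    · have := hqq z hz
      rw [h, zero_mul] at this
      exact zero_ne_one this
    · have e1 := congrArg norm (hq w (circle_mem_closedBall w))
      rw [norm_mul, ← hn] at e1
      exact (mul_eq_left₀ (norm_ne_zero_iff.2 (h1 w))).1 e1.symm
  have hnorm : ‖q 0‖ = 1 := by
    have e1 := congrArg norm (hq (1 : Circle) (circle_mem_closedBall 1))
    rw [norm_mul, ← hn, hc _ (circle_mem_closedBall 1)] at e1
    exact (mul_eq_left₀ (norm_ne_zero_iff.2 (h1 1))).1 e1.symm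
  have hq0 : q 0 = 1 := by
    have e1 := hq 0 zero_mem_unitClosedBall
    have e2 := congrArg norm e1
    rw [norm_mul, hnorm, mul_one, e, e', Complex.norm_real, Complex.norm_real,
      Real.norm_of_nonneg ht.le, Real.norm_of_nonneg ht'.le] at e2
    rw [e, e', e2] at e1
    exact (mul_eq_left₀ (by exact_mod_cast ht.ne')).1 e1.symm
  rw [hq z hz, hc z hz, hq0, mul_one]

namespace Jost

variable {ω : ℤ → ℂ} {h k U V : ℤ → ℂ → ℂ}

theorem da (J : Jost ω h k U V) : DA fun z => h 0 z * U 0 z + k 0 z * V 0 z :=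
  ((J.dh 0).mul (J.dU 0)).add' ((J.dk 0).mul (J.dV 0))

theorem a_pos (J : Jost ω h k U V) (hω : IsHardPulse ω) :
    ∃ t : ℝ, 0 < t ∧ h 0 0 * U 0 0 + k 0 0 * V 0 0 = t := by
  obtain ⟨s, hs, e⟩ := J.h_pos hω 0
  obtain ⟨t, ht, e'⟩ := J.U_pos hω 0
  exact ⟨s * t, by positivity, by rw [J.V_zero, e, e']; push_cast; ring⟩

variable {r : Circle → ℂ}

theorem norm_eq (J : Jost ω h k U V) (hr : ∀ w : Circle, conj (h 0 w) * V 0 w -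
    conj (k 0 w) * U 0 w = r w * (h 0 w * U 0 w + k 0 w * V 0 w)) (w : Circle) :
    (h 0 w * U 0 w + k 0 w * V 0 w) * conj (h 0 w * U 0 w + k 0 w * V 0 w) *
      (1 + r w * conj (r w)) = 1 := by
  have e := J.unit_ab w
  rw [hr, map_mul] at e
  linear_combination e

theorem a_ne_zero (J : Jost ω h k U V) (hr : ∀ w : Circle, conj (h 0 w) * V 0 w -
    conj (k 0 w) * U 0 w = r w * (h 0 w * U 0 w + k 0 w * V 0 w)) (w : Circle) :
    h 0 w * U 0 w + k 0 w * V 0 w ≠ 0 := by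
  intro h0
  have := J.norm_eq hr w
  rw [h0] at this
  simp at this

/-- At a zero of a the identity h U + k V = a makes (U, V) proportional to (-k, h) up to the order
of the zero. The factor is V/h or -U/k, whichever denominator is nonzero, and the norming polynomial
is its Taylor polynomial. Time 0 suffices by `congruence_all`. -/
theorem existsUnique_boundStateData (J : Jost ω h k U V) (hω : IsHardPulse ω)
    (hr : ∀ w : Circle, conj (h 0 w) * V 0 w -
      conj (k 0 w) * U 0 w = r w * (h 0 w * U 0 w + k 0 w * V 0 w)) :
    ∃! D : BoundStateData, HasBoundStateData ω D := by
  have ha0 : h 0 0 * U 0 0 + k 0 0 * V 0 0 ≠ 0 := by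
    obtain ⟨t, ht, e⟩ := J.a_pos hω
    rw [e]; exact_mod_cast ht.ne'
  obtain ⟨m, hm, ho⟩ := J.da.exists_order (J.a_ne_zero hr) ha0
  have hex : ∀ z, ∃ p : Polynomial ℂ, p.degree < (m z : WithBot ℕ) ∧
      (z ∈ m.support → p.eval z ≠ 0 ∧ ∀ j : ℤ,
        (m z : ℕ∞) ≤ analyticOrderAt (fun w => U j w + p.eval w * w ^ j * k j w) z ∧
        (m z : ℕ∞) ≤ analyticOrderAt (fun w => V j w - p.eval w * w ^ j * h j w) z) := by
    intro z
    by_cases hz : z ∈ m.support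
    swap
    · exact ⟨0, by simp, fun h => absurd h hz⟩
    obtain ⟨z0, z1⟩ := hm z hz
    have hzb : z ∈ ball (0 : ℂ) 1 := mem_ball_zero_iff.2 z1
    have hzc := ball_mem_closedBall hzb
    have ah := (J.dh 0).analyticAt hzb
    have ak := (J.dk 0).analyticAt hzb
    have aU := (J.dU 0).analyticAt hzb
    have aV := (J.dV 0).analyticAt hzb
    have hmz : m z ≠ 0 := Finsupp.mem_support_iff.1 hz
    have oa : (m z : ℕ∞) ≤ analyticOrderAt (fun w => h 0 w * U 0 w + k 0 w * V 0 w) z :=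
      (ho z hzb).ge
    have az : h 0 z * U 0 z + k 0 z * V 0 z = 0 := by
      have h1 : analyticOrderAt (fun w => h 0 w * U 0 w + k 0 w * V 0 w) z ≠ 0 := by
        rw [ho z hzb]; exact_mod_cast hmz
      exact (J.da.analyticAt hzb).analyticOrderAt_ne_zero.1 h1
    have eval_eq : ∀ {p : Polynomial ℂ} {g : ℂ → ℂ}, AnalyticAt ℂ g z →
        (m z : ℕ∞) ≤ analyticOrderAt (fun w => p.eval w - g w) z → p.eval z = g z := by
      intro p g hg hp
      have h1 : analyticOrderAt (fun w => p.eval w - g w) z ≠ 0 := fun h2 => by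
        rw [h2] at hp
        exact hmz (by simpa using hp)
      exact sub_eq_zero.1 (((analyticAt_eval p z).sub hg).analyticOrderAt_ne_zero.1 h1)
    by_cases hh : h 0 z = 0
    · have hk : k 0 z ≠ 0 := (J.right_ne_zero 0 hzc z0).resolve_left (not_not.2 hh)
      have ag : AnalyticAt ℂ (fun w => -(U 0 w / k 0 w)) z := (aU.div ak hk).neg
      obtain ⟨p, hp, hp'⟩ := exists_taylor_polynomial ag (m z)
      have ap := analyticAt_eval p z
      have o1 : (m z : ℕ∞) ≤ analyticOrderAt (fun w => U 0 w + p.eval w * k 0 w) z := by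
        refine (le_order_mul ak (ap.sub ag) hp').trans_eq (analyticOrderAt_congr ?_)
        filter_upwards [ak.continuousAt.eventually_ne hk] with w hw
        simp only [Pi.sub_apply]
        field_simp
        ring
      have a2 : AnalyticAt ℂ (fun w => V 0 w - p.eval w * h 0 w) z := aV.sub (ap.mul ah)
      have o2 : (m z : ℕ∞) ≤ analyticOrderAt (fun w => V 0 w - p.eval w * h 0 w) z := by
        refine le_order_of_mul ak a2 hk ((le_order_sub oa (le_order_mul ah (aU.add (ap.mul ak))
          o1)).trans_eq (congrArg (analyticOrderAt · z) (funext fun w => ?_)))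
        simp only [Pi.add_apply, Pi.mul_apply]
        ring
      refine ⟨p, hp, fun _ => ⟨?_, J.congruence_all hzb z0 ⟨by simpa using o1, by simpa using o2⟩⟩⟩
      -- A vanishing factor would give U = V = 0 at z, contradicting `left_ne_zero`.
      rw [eval_eq ag hp']
      intro h0
      have hU : U 0 z = 0 := by
        rw [neg_eq_zero, div_eq_zero_iff] at h0
        exact h0.resolve_right hk
      have hV : V 0 z = 0 := by
        rw [hU, mul_zero, zero_add] at az
        exact (mul_eq_zero.1 az).resolve_left hk
      rcases J.left_ne_zero 0 hzc z0 with h | h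
      · exact h hU
      · exact h hV
    · have ag : AnalyticAt ℂ (fun w => V 0 w / h 0 w) z := aV.div ah hh
      obtain ⟨p, hp, hp'⟩ := exists_taylor_polynomial ag (m z)
      have ap := analyticAt_eval p z
      have o2 : (m z : ℕ∞) ≤ analyticOrderAt (fun w => V 0 w - p.eval w * h 0 w) z := by
        refine (le_order_mul ah.neg (ap.sub ag) hp').trans_eq (analyticOrderAt_congr ?_)
        filter_upwards [ah.continuousAt.eventually_ne hh] with w hw
        simp only [Pi.sub_apply, Pi.neg_apply]
        field_simp
        ring
      have a1 : AnalyticAt ℂ (fun w => U 0 w + p.eval w * k 0 w) z := aU.add (ap.mul ak)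
      have o1 : (m z : ℕ∞) ≤ analyticOrderAt (fun w => U 0 w + p.eval w * k 0 w) z := by
        refine le_order_of_mul ah a1 hh ((le_order_sub oa (le_order_mul ak (aV.sub (ap.mul ah))
          o2)).trans_eq (congrArg (analyticOrderAt · z) (funext fun w => ?_)))
        simp only [Pi.sub_apply, Pi.mul_apply]
        ring
      refine ⟨p, hp, fun _ => ⟨?_, J.congruence_all hzb z0 ⟨by simpa using o1, by simpa using o2⟩⟩⟩
      rw [eval_eq ag hp']
      intro h0
      have hV : V 0 z = 0 := by
        rw [div_eq_zero_iff] at h0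
        exact h0.resolve_right hh
      have hU : U 0 z = 0 := by
        rw [hV, mul_zero, add_zero] at az
        exact (mul_eq_zero.1 az).resolve_left hh
      rcases J.left_ne_zero 0 hzc z0 with h | h
      · exact h hU
      · exact h hV
  choose p hp hp' using hex
  refine ⟨⟨m, p, hm, hp, fun z hz => (hp' z hz).1⟩, ?_, fun D hD => ?_⟩
  · refine J.hasBoundStateData_iff.2 ⟨ho, fun z hz j => ?_⟩
    by_cases hs : z ∈ m.support
    · exact (hp' z hs).2 j
    · rw [Finsupp.notMem_support_iff] at hs
      simp only [hs, Nat.cast_zero, zero_le, and_self]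
  · obtain ⟨o, c⟩ := J.hasBoundStateData_iff.1 hD
    have hmult : D.mult = m := by
      ext z
      by_cases hz : z ∈ ball (0 : ℂ) 1
      · have := (o z hz).symm.trans (ho z hz)
        exact_mod_cast this
      · rw [D.mult_of_notMem hz]
        by_contra h
        exact hz (mem_ball_zero_iff.2 (hm z (Finsupp.mem_support_iff.2 (Ne.symm h))).2)
    refine BoundStateData.eq_of hmult (funext fun z => ?_)
    change D.norming z = p z
    have hd := D.degree_lt z
    rw [hmult] at hd
    by_cases hs : z ∈ m.support
    · obtain ⟨z0, z1⟩ := hm z hs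
      have hzb : z ∈ ball (0 : ℂ) 1 := mem_ball_zero_iff.2 z1
      have ah := (J.dh 0).analyticAt hzb
      have ak := (J.dk 0).analyticAt hzb
      obtain ⟨c1, c2⟩ := c z hzb 0
      obtain ⟨c1', c2'⟩ := (hp' z hs).2 0
      rw [hmult] at c1 c2
      rw [← sub_eq_zero]
      refine eq_zero_of_degree_lt_of_le_order (z := z)
        (lt_of_le_of_lt (Polynomial.degree_sub_le _ _) (max_lt hd (hp z))) ?_
      have an := analyticAt_eval (D.norming z - p z) z
      rcases J.right_ne_zero 0 (ball_mem_closedBall hzb) z0 with h | h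
      · refine le_order_of_mul ah an h ((le_order_sub c2' c2).trans_eq
          (congrArg (analyticOrderAt · z) (funext fun w => ?_)))
        simp only [zpow_zero, Polynomial.eval_sub]
        ring
      · refine le_order_of_mul ak an h ((le_order_sub c1 c1').trans_eq
          (congrArg (analyticOrderAt · z) (funext fun w => ?_)))
        simp only [zpow_zero, Polynomial.eval_sub]
        ring
    · rw [Finsupp.notMem_support_iff] at hs
      have h1 := hp z
      rw [Polynomial.degree_lt_iff_coeff_zero] at h1 hd
      ext n
      rw [hd n (by omega), h1 n (by omega)]

end Jost

/-! ### The bijection between pulses and bound state data -/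

variable {M : Circle → sphere (0 : EuclideanSpace ℝ (Fin 3)) 1} {a : ℂ → ℂ} {E E' : Polynomial ℂ}

/-- The hard pulse of a scattering problem that is solvable at one time. -/
theorem exists_pulse (hM : ∀ w, (M w).1 2 ≠ -1) (D : ScatData (reflectionCoeff M) a E E')
    (hr : SobolevLip (reflectionCoeff M)) (ha : SobolevLip fun w => a w) {i : ℤ}
    {h₀ k₀ U₀ V₀ : ℂ → ℂ} (S₀ : NSol (reflectionCoeff M) a E i h₀ k₀ U₀ V₀) :
    ∃ (ω : ℤ → ℂ) (h k U V : ℤ → ℂ → ℂ), IsHardPulse ω ∧ TransformsTo ω M ∧ Jost ω h k U V ∧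
      (∀ j, NSol (reflectionCoeff M) a E j (h j) (k j) (U j) (V j)) ∧
      ∀ j, ω j = flip (k j 0 / h j 0) := by
  choose h k U V S using fun j => S₀.exists_all D j
  obtain ⟨hω, J⟩ := jost_of_nsol D hr ha S
  refine ⟨_, h, k, U, V, hω, (J.transformsTo_iff hM).2 fun w => ?_, J, S, fun j => rfl⟩
  rw [(S 0).mul_add_mul D (circle_mem_closedBall w), (S 0).circ_U, (S 0).circ_V, zpow_zero]
  linear_combination (reflectionCoeff M w * a w) * (S 0).unit w

/-- The data D fix a through zeros and modulus, and fix E modulo a. The Jost functions of a pulse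
with data D are exactly the normalized solutions for (r, a, E), so both existence and uniqueness
pass to the pulse. -/
theorem existsUnique_pulse (hM : ∀ w, (M w).1 2 ≠ -1) (hr : SobolevLip (reflectionCoeff M))
    (D : BoundStateData) :
    ∃! ω : ℤ → ℂ, IsHardPulse ω ∧ TransformsTo ω M ∧ HasBoundStateData ω D := by
  obtain ⟨a, da, sa, na, pa, oa⟩ := exists_transmission hr D.mult D.mem_disk
  obtain ⟨E, E', e0, e0', hE, hEE⟩ := exists_norming_interpolation D.mult D.mult_zero
    (fun z w => (D.norming z).eval w) fun z hz =>
      ⟨analyticAt_eval _ z, D.eval_ne_zero z (Finsupp.mem_support_iff.2 hz)⟩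
  have SD : ScatData (reflectionCoeff M) a E E' :=
    { da := da, norm_eq := na, pos := pa, eval_zero := e0, eval_zero' := e0'
      dvd := fun z hz _ => by rw [oa z hz]; exact hEE z }
  obtain ⟨i, h₀, k₀, U₀, V₀, S₀⟩ := SD.exists_nsol hr sa
  obtain ⟨ω, h, k, U, V, hω, hT, J, S, hf⟩ := exists_pulse hM SD hr sa S₀
  refine ⟨ω, ⟨hω, hT, J.hasBoundStateData_iff.2 ⟨fun z hz => ?_, fun z hz j => ?_⟩⟩, ?_⟩
  · rw [← oa z hz]
    exact analyticOrderAt_congr_ball hz fun y hy =>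
      (S 0).mul_add_mul SD (ball_mem_closedBall hy)
  · by_cases hmz : D.mult z = 0
    · rw [hmz]; simp
    have z0 : z ≠ 0 := (D.mem_disk z (Finsupp.mem_support_iff.2 hmz)).1
    have aN := (analyticAt_eval E z).sub (analyticAt_eval (D.norming z) z)
    have aw := analyticAt_zpow z0 j
    constructor
    · have o1 := (S j).dvd_U z hz z0
      rw [oa z hz] at o1
      refine (le_order_sub o1 (le_order_mul (aw.mul ((J.dk j).analyticAt hz)) aN
        (hE z))).trans_eq (congrArg (analyticOrderAt · z) (funext fun w => ?_))
      simp only [Pi.mul_apply, Pi.sub_apply]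
      ring
    · have o1 := (S j).dvd_V z hz z0
      rw [oa z hz] at o1
      refine (le_order_add o1 (le_order_mul (aw.mul ((J.dh j).analyticAt hz)) aN
        (hE z))).trans_eq (congrArg (analyticOrderAt · z) (funext fun w => ?_))
      simp only [Pi.mul_apply, Pi.sub_apply]
      ring
  · rintro ω' ⟨hω', hT', hB'⟩
    obtain ⟨h', k', U', V', J'⟩ := hω'.exists_jost
    rw [J'.hasBoundStateData_iff] at hB'
    obtain ⟨o', c'⟩ := hB'
    have hr' := (J'.transformsTo_iff hM).1 hT'
    have ha' : ∀ z ∈ closedBall (0 : ℂ) 1, h' 0 z * U' 0 z + k' 0 z * V' 0 z = a z := by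
      intro z hz
      refine transmission_unique J'.da da (fun w => ?_) (J'.a_ne_zero hr') (J'.a_pos hω') pa
        (fun z hz => (o' z hz).trans (oa z hz).symm) hz
      have n1 := J'.norm_eq hr' w
      have n2 := na w
      have hne : (1 + reflectionCoeff M w * conj (reflectionCoeff M w)) ≠ 0 := by
        intro h0; rw [h0, mul_zero] at n2; exact zero_ne_one n2
      have n3 := mul_right_cancel₀ hne (n1.trans n2.symm)
      rw [Complex.mul_conj', Complex.mul_conj'] at n3
      have n4 : ‖h' 0 w * U' 0 w + k' 0 w * V' 0 w‖ ^ 2 = ‖a w‖ ^ 2 := by exact_mod_cast n3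
      exact (pow_left_inj₀ (norm_nonneg _) (norm_nonneg _) two_ne_zero).1 n4
    have S' : ∀ j, NSol (reflectionCoeff M) a E j (h' j) (k' j) (U' j) (V' j) := by
      intro j
      have aN := fun z => (analyticAt_eval E z).sub (analyticAt_eval (D.norming z) z)
      refine
        { dh := J'.dh j, dk := J'.dk j, dU := J'.dU j, dV := J'.dV j
          circ_U := fun w => ?_, circ_V := fun w => ?_, dvd_U := fun z hz z0 => ?_
          dvd_V := fun z hz z0 => ?_, V_zero := J'.V_zero j, unit := J'.unit_right j
          pos := J'.h_pos hω' j }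
      · have e := J'.circ_U j w
        rw [hr', ha' w (circle_mem_closedBall w)] at e
        rw [e]; ring
      · have e := J'.circ_V j w
        rw [hr', ha' w (circle_mem_closedBall w)] at e
        rw [e]; ring
      · rw [oa z hz]
        refine (le_order_add (c' z hz j).1 (le_order_mul ((analyticAt_zpow z0 j).mul
          ((J'.dk j).analyticAt hz)) (aN z) (hE z))).trans_eq
          (congrArg (analyticOrderAt · z) (funext fun w => ?_))
        simp only [Pi.mul_apply, Pi.sub_apply]
        ring
      · rw [oa z hz]
        refine (le_order_sub (c' z hz j).2 (le_order_mul ((analyticAt_zpow z0 j).mul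
          ((J'.dh j).analyticAt hz)) (aN z) (hE z))).trans_eq
          (congrArg (analyticOrderAt · z) (funext fun w => ?_))
        simp only [Pi.mul_apply, Pi.sub_apply]
        ring
    ext j
    obtain ⟨e1, e2, -⟩ := (S' j).ext_circle (S j) SD zero_mem_unitClosedBall
    rw [J'.eq_flip hω' j, hf j, e1, e2]

theorem existsUnique_data (hM : ∀ w, (M w).1 2 ≠ -1) {ω : ℤ → ℂ} (hω : IsHardPulse ω)
    (hT : TransformsTo ω M) : ∃! D : BoundStateData, HasBoundStateData ω D := by
  obtain ⟨h, k, U, V, J⟩ := hω.exists_jost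
  exact J.existsUnique_boundStateData hω ((J.transformsTo_iff hM).1 hT)

/-- Bound state data with a single simple energy. -/
def singleEnergy (z : ℂ) (h0 : z ≠ 0) (h1 : ‖z‖ < 1) : BoundStateData where
  mult := Finsupp.single z 1
  norming := fun y => if y = z then 1 else 0
  mem_disk y hy := by
    have := Finsupp.support_single_subset hy
    rw [Finset.mem_singleton] at this
    rw [this]; exact ⟨h0, h1⟩
  degree_lt y := by
    by_cases h : y = z
    · simp [h]
    · simp [h]
  eval_ne_zero y hy := by
    have := Finsupp.support_single_subset hy
    rw [Finset.mem_singleton] at this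
    simp [this]

theorem infinite_pulses (hM : ∀ w, (M w).1 2 ≠ -1) (hr : SobolevLip (reflectionCoeff M)) :
    {ω : ℤ → ℂ | IsHardPulse ω ∧ TransformsTo ω M}.Infinite := by
  have n0 : ∀ n : ℕ, (n : ℂ) + 2 ≠ 0 := fun n => by exact_mod_cast (by omega : n + 2 ≠ 0)
  have n1 : ∀ n : ℕ, ‖((n : ℂ) + 2)⁻¹‖ < 1 := fun n => by
    have : ((n : ℂ) + 2) = ((n + 2 : ℕ) : ℂ) := by push_cast; rfl
    rw [this, norm_inv, Complex.norm_natCast]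
    exact inv_lt_one_of_one_lt₀ (by exact_mod_cast (by omega : 1 < n + 2))
  -- The points 1/(n + 2) are distinct and lie in the punctured disk; equal pulses would have equal
  -- energies.
  set D : ℕ → BoundStateData := fun n =>
    singleEnergy ((n : ℂ) + 2)⁻¹ (inv_ne_zero (n0 n)) (n1 n) with hD
  choose ω hω using fun n => (existsUnique_pulse hM hr (D n)).exists
  refine Set.infinite_of_injective_forall_mem (f := ω) (fun n m hnm => ?_)
    fun n => ⟨(hω n).1, (hω n).2.1⟩
  have h1 := (hω n).2.2
  rw [hnm] at h1
  have h2 := congrArg BoundStateData.mult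
    ((existsUnique_data hM (hω m).1 (hω m).2.1).unique h1 (hω m).2.2)
  have h3 := Finsupp.single_left_injective one_ne_zero h2
  have h4 := add_right_cancel (inv_injective h3)
  exact_mod_cast h4

end HardPulse

namespace HardPulse

/-! ### Pulses of finite rephasing time -/

/-- Removable singularities up to the boundary of the unit disk. -/
theorem exists_DA_of_meromorphic {f : ℂ → ℂ} (hf : MeromorphicOn f (ball 0 1))
    (h0 : ∀ z ∈ ball (0 : ℂ) 1, 0 ≤ meromorphicOrderAt f z)
    (hc : ∀ w : Circle, ContinuousWithinAt f (ball 0 1) w) :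
    ∃ V : ℂ → ℂ, DA V ∧ (∀ w : Circle, V w = f w) ∧
      ∀ z ∈ ball (0 : ℂ) 1, V =ᶠ[𝓝[≠] z] f := by
  set g := toMeromorphicNFOn f (ball 0 1)
  have hg : ∀ z ∈ ball (0 : ℂ) 1, AnalyticAt ℂ g z := fun z hz => by
    rw [← (meromorphicNFOn_toMeromorphicNFOn f (ball 0 1) hz).meromorphicOrderAt_nonneg_iff_analyticAt,
      meromorphicOrderAt_toMeromorphicNFOn hf hz]
    exact h0 z hz
  have hgf : ∀ z ∈ ball (0 : ℂ) 1, g =ᶠ[𝓝[≠] z] f := fun z hz =>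
    hf.toMeromorphicNFOn_eq_self_on_nhdsNE hz
  have lim1 : ∀ z ∈ ball (0 : ℂ) 1, Tendsto g (𝓝[ball 0 1] z) (𝓝 (g z)) := fun z hz =>
    (hg z hz).continuousAt.continuousWithinAt
  have lim2 : ∀ w : Circle, Tendsto g (𝓝[ball 0 1] (w : ℂ)) (𝓝 (f w)) := by
    intro w
    refine (closed_nhds_basis (f w)).tendsto_right_iff.2 fun N hN => ?_
    -- At isolated points f and its normal form may differ. Values of the latter are limits of
    -- values of f, so closed neighbourhoods are used.
    have h1 : ∀ᶠ z in 𝓝[ball 0 1] (w : ℂ), f z ∈ N := hc w hN.1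
    filter_upwards [eventually_eventually_nhdsWithin.2 h1, self_mem_nhdsWithin] with z hz hzb
    rw [isOpen_ball.nhdsWithin_eq hzb] at hz
    have h2 : ∀ᶠ y in 𝓝[≠] z, g y ∈ N := by
      filter_upwards [hgf z hzb, hz.filter_mono nhdsWithin_le_nhds] with y hy hy'
      rwa [hy]
    exact hN.2.mem_of_tendsto ((hg z hzb).continuousAt.tendsto.mono_left nhdsWithin_le_nhds) h2
  have hV : ∀ z ∈ ball (0 : ℂ) 1, extendFrom (ball 0 1) g z = g z := fun z hz =>
    extendFrom_eq (subset_closure hz) (lim1 z hz)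
  refine ⟨extendFrom (ball 0 1) g, ⟨?_, ?_⟩, fun w => ?_, fun z hz => ?_⟩
  · exact DifferentiableOn.congr (fun z hz => (hg z hz).differentiableAt.differentiableWithinAt) hV
  · refine continuousOn_extendFrom subset_rfl fun z hz => ?_
    rw [closure_unitBall] at hz
    rcases mem_ball_or_circle hz with h | ⟨w, rfl⟩
    · exact ⟨_, lim1 z h⟩
    · exact ⟨_, lim2 w⟩
  · exact extendFrom_eq (by rw [closure_unitBall]; exact circle_mem_closedBall w) (lim2 w)
  · refine EventuallyEq.trans ?_ (hgf z hz)
    filter_upwards [mem_nhdsWithin_of_mem_nhds (isOpen_ball.mem_nhds hz)] with y hy using hV y hy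

/-- Poles cannot accumulate inside the disk by meromorphy, nor on the circle, near which the
continuous boundary values keep f bounded. -/
theorem finite_poles {f : ℂ → ℂ} (hf : MeromorphicOn f (ball 0 1))
    (hc : ∀ w : Circle, ContinuousWithinAt f (ball 0 1) w) :
    {z ∈ ball (0 : ℂ) 1 | meromorphicOrderAt f z < 0}.Finite := by
  by_contra hinf
  obtain ⟨x, hx, hacc⟩ := Set.Infinite.exists_accPt_of_subset_isCompact hinf
    (isCompact_closedBall (0 : ℂ) 1) fun z hz => ball_mem_closedBall hz.1
  rw [accPt_iff_frequently] at hacc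
  rcases mem_ball_or_circle hx with hxb | ⟨w, rfl⟩
  · refine hacc ?_
    filter_upwards [eventually_nhdsWithin_iff.1 (hf x hxb).eventually_analyticAt] with y hy h
    exact not_lt.2 (hy h.1).meromorphicOrderAt_nonneg h.2.2
  · refine hacc ?_
    have h1 : ∀ᶠ z in 𝓝[ball 0 1] (w : ℂ), ‖f z‖ < ‖f w‖ + 1 :=
      (hc w).norm (gt_mem_nhds (lt_add_one _))
    filter_upwards [eventually_nhdsWithin_iff.1 (eventually_eventually_nhdsWithin.2 h1)]
      with y hy h
    have h2 := hy h.2.1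
    rw [isOpen_ball.nhdsWithin_eq h.2.1] at h2
    have h3 := (tendsto_cobounded_iff_meromorphicOrderAt_neg (hf y h.2.1)).2 h.2.2
    rw [← tendsto_norm_atTop_iff_cobounded] at h3
    obtain ⟨u, hu, hu'⟩ := ((h3.eventually (eventually_ge_atTop (‖f w‖ + 1))).and
      (h2.filter_mono nhdsWithin_le_nhds)).exists
    linarith

variable {r : Circle → ℂ} {a : ℂ → ℂ} {E E' : Polynomial ℂ} {h k U V : ℤ → ℂ → ℂ}

/-- If the right Jost function is trivial at some time, the pulse has ended. -/
theorem nsol_k_eq_zero (D : ScatData r a E E') (S : ∀ j, NSol r a E j (h j) (k j) (U j) (V j))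
    {i : ℤ} (hk : ∀ z ∈ closedBall (0 : ℂ) 1, k i z = 0) {j : ℤ} (hj : i ≤ j) : k j 0 = 0 := by
  suffices ∀ z ∈ closedBall (0 : ℂ) 1, k j z = 0 from this 0 zero_mem_unitClosedBall
  induction j, hj using Int.leInduction with
  | base => exact hk
  | succ j _ ih =>
    intro z hz
    refine (S (j + 1)).dk.eq_of_circle (DA.const 0) (fun w => ?_) hz
    have hw := circle_mem_closedBall w
    have e := (nsol_step D S j hw).2.1
    rw [ih _ hw, ih 0 zero_mem_unitClosedBall, zero_div, sinOf_zero] at e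
    apply mul_left_cancel₀ w.coe_ne_zero
    rw [e]; ring

/-- If the left Jost function is trivial at some time, the pulse has not begun. -/
theorem nsol_k_eq_zero_of_V (D : ScatData r a E E')
    (S : ∀ j, NSol r a E j (h j) (k j) (U j) (V j)) {i : ℤ}
    (hV : ∀ z ∈ closedBall (0 : ℂ) 1, V i z = 0) {j : ℤ} (hj : j < i) : k j 0 = 0 := by
  have key : ∀ j, (∀ z ∈ closedBall (0 : ℂ) 1, V (j + 1) z = 0) →
      k j 0 = 0 ∧ ∀ z ∈ closedBall (0 : ℂ) 1, V j z = 0 := by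
    intro j hV
    have hz : ∀ z ∈ closedBall (0 : ℂ) 1, -conj (sinOf (k j 0 / h j 0)) * U j z +
        cosOf (k j 0 / h j 0) * V j z = 0 := by
      intro z hz
      refine (((S j).dU.const_mul _).add' ((S j).dV.const_mul _)).eq_of_circle (DA.const 0)
        (fun w => ?_) hz
      have e := (nsol_step D S j (circle_mem_closedBall w)).2.2.2
      rw [hV _ (circle_mem_closedBall w)] at e
      exact (mul_eq_zero.1 e.symm).resolve_left w.coe_ne_zero
    have hU : U j 0 ≠ 0 := by
      obtain ⟨t, ht, e⟩ := (S j).U_pos D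
      rw [e]; exact_mod_cast ht.ne'
    have hc : (cosOf (k j 0 / h j 0) : ℂ) ≠ 0 := by exact_mod_cast (cosOf_pos _).ne'
    -- At the origin V = 0 while U is positive, so the relation leaves only the sine.
    have hs : sinOf (k j 0 / h j 0) = 0 := by
      have e := hz 0 zero_mem_unitClosedBall
      rw [(S j).V_zero, mul_zero, add_zero] at e
      have := (mul_eq_zero.1 e).resolve_right hU
      simpa using this
    refine ⟨?_, fun z hz' => ?_⟩
    · rw [sinOf] at hs
      have := (mul_eq_zero.1 hs).resolve_left hc
      exact (div_eq_zero_iff.1 this).resolve_right (S j).h_zero_ne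
    · have e := hz z hz'
      rw [hs, map_zero, neg_zero, zero_mul, zero_add] at e
      exact (mul_eq_zero.1 e).resolve_left hc
  have hall : ∀ j ≤ i, ∀ z ∈ closedBall (0 : ℂ) 1, V j z = 0 := by
    intro j hj
    induction j, hj using Int.leInductionDown with
    | base => exact hV
    | pred j _ ih =>
      refine (key (j - 1) ?_).2
      rwa [sub_add_cancel]
  exact (key j (hall (j + 1) hj)).1

/-- The pulse is over at time ρ when the right solution is (1, 0), which forces U = a and V = a r_0.
The zeros of a are placed at the poles of r_0 with equal orders, so V is in the disk algebra and
nonzero at the energies; the norming data are then the germs of V w^(-ρ). -/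
theorem exists_pulse_rephasing {M : Circle → sphere (0 : EuclideanSpace ℝ (Fin 3)) 1}
    (hM : ∀ w, (M w).1 2 ≠ -1) (hr : SobolevLip (reflectionCoeff M)) (ρ : ℤ) {r₀ : ℂ → ℂ}
    (hm : MeromorphicOn r₀ (ball 0 1))
    (hc : ∀ w : Circle, ContinuousWithinAt r₀ (ball 0 1) w)
    (h0 : Tendsto r₀ (𝓝[≠] 0) (𝓝 0))
    (hrr : ∀ w : Circle, reflectionCoeff M w = (w : ℂ) ^ (-ρ) * r₀ w) :
    ∃ ω : ℤ → ℂ, IsHardPulse ω ∧ TransformsTo ω M ∧ ∀ j, ρ ≤ j → ω j = 0 := by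
  classical
  -- `untop₀` sends infinite order to 0, so an identically vanishing germ gets multiplicity zero,
  -- and `toNat` discards zeros of r_0.
  set μ : ℂ → ℕ := fun z => if z ∈ ball (0 : ℂ) 1 then (-(meromorphicOrderAt r₀ z).untop₀).toNat
    else 0 with hμ
  have hsub : ∀ z, μ z ≠ 0 → z ∈ ball (0 : ℂ) 1 ∧ meromorphicOrderAt r₀ z = -(μ z : ℤ) ∧
      meromorphicOrderAt r₀ z < 0 := by
    intro z hz
    have hzb : z ∈ ball (0 : ℂ) 1 := by
      by_contra h
      exact hz (if_neg h)
    simp only [hμ, if_pos hzb] at hz ⊢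
    refine ⟨hzb, ?_⟩
    cases ho : meromorphicOrderAt r₀ z with
    | top => simp [ho] at hz
    | coe n =>
      rw [ho, WithTop.untop₀_coe] at hz
      rw [WithTop.untop₀_coe]
      have h1 : n = -((-n).toNat : ℤ) := by omega
      have h2 : n < 0 := by omega
      exact ⟨by exact_mod_cast h1, by exact_mod_cast h2⟩
  have hge : ∀ z ∈ ball (0 : ℂ) 1, 0 ≤ ((μ z : ℤ) : WithTop ℤ) + meromorphicOrderAt r₀ z := by
    intro z hzb
    simp only [hμ, if_pos hzb]
    cases ho : meromorphicOrderAt r₀ z with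
    | top => simp
    | coe n =>
      rw [WithTop.untop₀_coe]
      have h1 : 0 ≤ ((-n).toNat : ℤ) + n := by omega
      exact_mod_cast h1
  have h00 : μ 0 = 0 := by
    by_contra h
    exact not_lt.2 ((tendsto_zero_iff_meromorphicOrderAt_pos (hm 0 zero_mem_unitBall)).1 h0).le
      (hsub 0 h).2.2
  set m : ℂ →₀ ℕ := Finsupp.ofSupportFinite μ
    ((finite_poles hm hc).subset fun z hz => ⟨(hsub z hz).1, (hsub z hz).2.2⟩)
  have hmμ : ∀ z, m z = μ z := fun z => rfl
  have hms : ∀ z ∈ m.support, z ≠ 0 ∧ ‖z‖ < 1 := by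
    intro z hz
    rw [Finsupp.mem_support_iff, hmμ] at hz
    exact ⟨fun h => hz (h ▸ h00), mem_ball_zero_iff.1 (hsub z hz).1⟩
  obtain ⟨a, da, sa, na, pa, oa⟩ := exists_transmission hr m hms
  have moa : ∀ z ∈ ball (0 : ℂ) 1, meromorphicOrderAt a z = ((μ z : ℤ) : WithTop ℤ) := by
    intro z hz
    rw [(da.analyticAt hz).meromorphicOrderAt_eq, oa z hz, hmμ]
    rfl
  have mord : ∀ z ∈ ball (0 : ℂ) 1, meromorphicOrderAt (fun z => a z * r₀ z) z =
      ((μ z : ℤ) : WithTop ℤ) + meromorphicOrderAt r₀ z := by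
    intro z hz
    rw [← moa z hz]
    exact meromorphicOrderAt_mul (da.analyticAt hz).meromorphicAt (hm z hz)
  have ca : ∀ w : Circle, ContinuousWithinAt a (ball 0 1) w := fun w =>
    (da.continuousOn' w (circle_mem_closedBall w)).mono ball_subset_closedBall
  obtain ⟨V, dV, cV, eV⟩ := exists_DA_of_meromorphic (f := fun z => a z * r₀ z)
    (fun z hz => (da.analyticAt hz).meromorphicAt.mul (hm z hz))
    (fun z hz => by rw [mord z hz]; exact hge z hz) fun w => (ca w).mul (hc w)
  have V0 : V 0 = 0 := by
    have l1 : Tendsto V (𝓝[≠] 0) (𝓝 (V 0)) :=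
      (dV.analyticAt zero_mem_unitBall).continuousAt.tendsto.mono_left nhdsWithin_le_nhds
    have l2 : Tendsto (fun z => a z * r₀ z) (𝓝[≠] 0) (𝓝 (a 0 * 0)) :=
      ((da.analyticAt zero_mem_unitBall).continuousAt.tendsto.mono_left nhdsWithin_le_nhds).mul h0
    rw [mul_zero] at l2
    exact tendsto_nhds_unique l1 (l2.congr' (eV 0 zero_mem_unitBall).symm)
  have Vne : ∀ z, m z ≠ 0 → V z ≠ 0 := by
    intro z hz
    obtain ⟨hzb, ho, -⟩ := hsub z hz
    have hV := meromorphicOrderAt_congr (eV z hzb)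
    rw [mord z hzb, ho, (dV.analyticAt hzb).meromorphicOrderAt_eq] at hV
    rw [← (dV.analyticAt hzb).analyticOrderAt_eq_zero]
    have h3 : (((μ z : ℤ) : WithTop ℤ) + -((μ z : ℤ) : WithTop ℤ)) = 0 := by
      have : (μ z : ℤ) + -(μ z : ℤ) = 0 := by ring
      exact_mod_cast this
    rw [h3] at hV
    cases hn : analyticOrderAt V z with
    | top => rw [hn] at hV; simp at hV
    | coe n =>
      rw [hn] at hV
      have : ((n : ℤ) : WithTop ℤ) = 0 := hV
      have : (n : ℤ) = 0 := by exact_mod_cast this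
      exact_mod_cast this
  have hz0 : ∀ z, m z ≠ 0 → z ≠ 0 := fun z hz => (hms z (Finsupp.mem_support_iff.2 hz)).1
  obtain ⟨E, E', e0, e0', hE, hEE⟩ := exists_norming_interpolation m h00
    (fun _ w => V w * w ^ (-ρ)) fun z hz =>
      ⟨(dV.analyticAt (hsub z hz).1).mul (analyticAt_zpow (hz0 z hz) _),
        mul_ne_zero (Vne z hz) (zpow_ne_zero _ (hz0 z hz))⟩
  have SD : ScatData (reflectionCoeff M) a E E' :=
    { da := da, norm_eq := na, pos := pa, eval_zero := e0, eval_zero' := e0'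
      dvd := fun z hz _ => by rw [oa z hz]; exact hEE z }
  have S₀ : NSol (reflectionCoeff M) a E ρ (fun _ => 1) (fun _ => 0) a V :=
    { dh := DA.const 1, dk := DA.const 0, dU := da, dV := dV
      circ_U := fun w => by simp
      circ_V := fun w => by
        have : (w : ℂ) ^ (-ρ) * (w : ℂ) ^ ρ = 1 := by
          rw [← zpow_add₀ w.coe_ne_zero]; simp
        rw [cV, hrr, map_zero]
        linear_combination -a w * r₀ w * this
      dvd_U := by simpa using DiskDvd.refl a
      dvd_V := fun z hz z0 => by
        rw [oa z hz]
        have aE : AnalyticAt ℂ (fun w => E.eval w - V w * w ^ (-ρ)) z :=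
          (analyticAt_eval E z).sub ((dV.analyticAt hz).mul (analyticAt_zpow z0 _))
        refine (le_order_mul (f := fun w => -w ^ ρ) (analyticAt_zpow z0 ρ).neg aE
          (hE z)).trans_eq (analyticOrderAt_congr ?_)
        filter_upwards [isOpen_ne.mem_nhds z0] with w hw
        have : w ^ (-ρ) * w ^ ρ = 1 := by rw [← zpow_add₀ hw]; simp
        linear_combination V w * this
      V_zero := V0
      unit := fun w => by simp
      pos := ⟨1, one_pos, by simp⟩ }
  obtain ⟨ω, h, k, U, V', hω, hT, -, S, hf⟩ := exists_pulse hM SD hr sa S₀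
  refine ⟨ω, hω, hT, fun j hj => ?_⟩
  rw [hf j, nsol_k_eq_zero SD S (fun z hz => ((S ρ).ext_circle S₀ SD hz).2.1) hj, zero_div,
    flip_zero]

end HardPulse

namespace HardPulse

/-! ### Pulses of finite duration -/

/-- The polynomial `w^T conj (A (1 / conj w))`. -/
def conjReflect (T : ℕ) (A : Polynomial ℂ) : Polynomial ℂ := (A.map (starRingEnd ℂ)).reflect T

theorem eval_conjReflect {T : ℕ} {A : Polynomial ℂ} (hA : A.natDegree ≤ T) (w : Circle) :
    (conjReflect T A).eval (w : ℂ) = (w : ℂ) ^ T * conj (A.eval (w : ℂ)) := by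
  have hw : conj (w : ℂ) ≠ 0 := by simp
  let _ : Invertible (conj (w : ℂ)) := invertibleOfNonzero hw
  have h := Polynomial.eval₂_reflect_mul_pow (RingHom.id ℂ) (conj (w : ℂ)) T
    (A.map (starRingEnd ℂ)) ((Polynomial.natDegree_map_le).trans hA)
  have hinv : ⅟(conj (w : ℂ)) = (w : ℂ) := by
    rw [invOf_eq_inv, circle_conj, inv_inv]
  rw [hinv, Polynomial.eval₂_id, Polynomial.eval₂_id, Polynomial.eval_map,
    Polynomial.eval₂_hom] at h
  have h1 : (w : ℂ) ^ T * conj (w : ℂ) ^ T = 1 := by rw [← mul_pow, circle_mul_conj, one_pow]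
  rw [← h, conjReflect]
  linear_combination -((A.map (starRingEnd ℂ)).reflect T).eval (w : ℂ) * h1

theorem coeff_zero_conjReflect (T : ℕ) (A : Polynomial ℂ) :
    (conjReflect T A).coeff 0 = conj (A.coeff T) := by
  rw [conjReflect, Polynomial.coeff_reflect, Polynomial.revAt_le (Nat.zero_le T), Nat.sub_zero,
    Polynomial.coeff_map]

/-- The spectral factorization identity. -/
theorem mul_conjReflect_add {T : ℕ} {A B : Polynomial ℂ} (hA : A.natDegree ≤ T)
    (hB : B.natDegree ≤ T) (hAB : ∀ w : Circle, ‖A.eval (w : ℂ)‖ ^ 2 + ‖B.eval (w : ℂ)‖ ^ 2 = 1) :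
    A * conjReflect T A + B * conjReflect T B = Polynomial.X ^ T := by
  refine Polynomial.eq_of_infinite_eval_eq _ _
    ((infinite_of_mem_nhds (0 : ℂ) (ball_mem_nhds 0 one_pos)).mono fun z hz => ?_)
  refine (DA.poly _).eq_of_circle (DA.poly _) (fun w => ?_) (ball_mem_closedBall hz)
  rw [Polynomial.eval_add, Polynomial.eval_mul, Polynomial.eval_mul, eval_conjReflect hA,
    eval_conjReflect hB, Polynomial.eval_pow, Polynomial.eval_X]
  have h1 : A.eval (w : ℂ) * conj (A.eval (w : ℂ)) + B.eval (w : ℂ) * conj (B.eval (w : ℂ)) = 1 := by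
    rw [Complex.mul_conj', Complex.mul_conj']; exact_mod_cast hAB w
  linear_combination (w : ℂ) ^ T * h1

variable {M : Circle → sphere (0 : EuclideanSpace ℝ (Fin 3)) 1}

/-- Finite duration pulses, with `A` positive and `B` zero at the origin. -/
theorem exists_pulse_of_pos (hM : ∀ w, (M w).1 2 ≠ -1) (hr : SobolevLip (reflectionCoeff M))
    (ρ : ℤ) (T : ℕ) {A B : Polynomial ℂ} (hA : A.natDegree ≤ T) (hB : B.natDegree ≤ T)
    (hAB : ∀ w : Circle, ‖A.eval (w : ℂ)‖ ^ 2 + ‖B.eval (w : ℂ)‖ ^ 2 = 1)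
    (hrr : ∀ w : Circle, reflectionCoeff M w =
      (w : ℂ) ^ (-ρ) * (B.eval (w : ℂ) / A.eval (w : ℂ)))
    (h1 : ∀ w : Circle, A.eval (w : ℂ) ≠ 0) (hA0 : ∃ t : ℝ, 0 < t ∧ A.eval 0 = t)
    (hB0 : B.eval 0 = 0) :
    ∃ ω : ℤ → ℂ, IsHardPulse ω ∧ TransformsTo ω M ∧
      (∀ j, ρ ≤ j → ω j = 0) ∧ (∀ j, j < ρ - T → ω j = 0) := by
  have key := mul_conjReflect_add hA hB hAB
  have key' : ∀ z : ℂ, A.eval z * (conjReflect T A).eval z + B.eval z * (conjReflect T B).eval z =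
      z ^ T := fun z => by
    have := congrArg (Polynomial.eval z) key
    simpa using this
  have hABc : ∀ w : Circle, A.eval (w : ℂ) * conj (A.eval (w : ℂ)) +
      B.eval (w : ℂ) * conj (B.eval (w : ℂ)) = 1 := fun w => by
    rw [Complex.mul_conj', Complex.mul_conj']; exact_mod_cast hAB w
  have da := DA.poly A
  have A0 : A.eval 0 ≠ 0 := by
    obtain ⟨t, ht, e⟩ := hA0
    rw [e]; exact_mod_cast ht.ne'
  obtain ⟨m, hm, ho⟩ := da.exists_order h1 A0
  have m0 : m 0 = 0 := by
    by_contra h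
    exact (hm 0 (Finsupp.mem_support_iff.2 h)).1 rfl
  -- A common zero of A and B away from the origin is excluded by the factorization of w^T, so B
  -- supplies admissible norming data at the zeros of A.
  have hBne : ∀ z, m z ≠ 0 → z ≠ 0 ∧ B.eval z ≠ 0 := by
    intro z hz
    obtain ⟨z0, z1⟩ := hm z (Finsupp.mem_support_iff.2 hz)
    have hzb : z ∈ ball (0 : ℂ) 1 := mem_ball_zero_iff.2 z1
    have hAz : A.eval z = 0 := by
      have h2 : analyticOrderAt (fun z => A.eval z) z ≠ 0 := by
        rw [ho z hzb]; exact_mod_cast hz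
      exact (da.analyticAt hzb).analyticOrderAt_ne_zero.1 h2
    refine ⟨z0, fun hBz => ?_⟩
    have := key' z
    rw [hAz, hBz, zero_mul, zero_mul, add_zero] at this
    exact pow_ne_zero T z0 this.symm
  obtain ⟨E, E', e0, e0', hE, hEE⟩ := exists_norming_interpolation m m0
    (fun _ w => B.eval w * w ^ (-ρ)) fun z hz =>
      ⟨(analyticAt_eval B z).mul (analyticAt_zpow (hBne z hz).1 _),
        mul_ne_zero (hBne z hz).2 (zpow_ne_zero _ (hBne z hz).1)⟩
  have SD : ScatData (reflectionCoeff M) (fun z => A.eval z) E E' :=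
    { da := da
      norm_eq := fun w => by
        have hw := h1 w
        have hw' : conj (A.eval (w : ℂ)) ≠ 0 := by simpa using hw
        have hz : (w : ℂ) ^ (-ρ) * conj ((w : ℂ) ^ (-ρ)) = 1 := by
          rw [circle_conj_zpow, ← zpow_add₀ w.coe_ne_zero]; simp
        have h2 := hABc w
        rw [hrr, map_mul, map_div₀]
        generalize (w : ℂ) ^ (-ρ) = x at hz
        generalize conj x = y at hz
        field_simp
        linear_combination h2 + B.eval (w : ℂ) * conj (B.eval (w : ℂ)) * hz
      pos := hA0, eval_zero := e0, eval_zero' := e0'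
      dvd := fun z hz _ => by rw [ho z hz]; exact hEE z }
  have hrA : ∀ (w : Circle) (x : ℂ), A.eval (w : ℂ) * (reflectionCoeff M w * x) =
      B.eval (w : ℂ) * ((w : ℂ) ^ (-ρ) * x) := fun w x => by
    have hw := h1 w
    rw [hrr]
    field_simp
  have S₁ : NSol (reflectionCoeff M) (fun z => A.eval z) E ρ (fun _ => 1) (fun _ => 0)
      (fun z => A.eval z) (fun z => B.eval z) :=
    { dh := DA.const 1, dk := DA.const 0, dU := da, dV := DA.poly B
      circ_U := fun w => by simp
      circ_V := fun w => by
        have : (w : ℂ) ^ (-ρ) * (w : ℂ) ^ ρ = 1 := by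
          rw [← zpow_add₀ w.coe_ne_zero]; simp
        rw [map_zero]
        linear_combination -hrA w ((w : ℂ) ^ ρ) - B.eval (w : ℂ) * this
      dvd_U := by simpa using DiskDvd.refl fun z => A.eval z
      dvd_V := fun z hz z0 => by
        rw [ho z hz]
        have aE : AnalyticAt ℂ (fun w => E.eval w - B.eval w * w ^ (-ρ)) z :=
          (analyticAt_eval E z).sub ((analyticAt_eval B z).mul (analyticAt_zpow z0 _))
        refine (le_order_mul (f := fun w => -w ^ ρ) (analyticAt_zpow z0 ρ).neg aE
          (hE z)).trans_eq (analyticOrderAt_congr ?_)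
        filter_upwards [isOpen_ne.mem_nhds z0] with w hw
        have : w ^ (-ρ) * w ^ ρ = 1 := by rw [← zpow_add₀ hw]; simp
        linear_combination B.eval w * this
      V_zero := hB0
      unit := fun w => by simp
      pos := ⟨1, one_pos, by simp⟩ }
  -- The same scattering problem is solved at time ρ - T with trivial left part. The congruence for
  -- U uses A A~ + B B~ = w^T, where ~ is `conjReflect T`. By uniqueness both explicit solutions
  -- belong to one pulse.
  have S₂ : NSol (reflectionCoeff M) (fun z => A.eval z) E (ρ - T) (fun z => A.eval z)
      (fun z => (-conjReflect T B).eval z) (fun _ => 1) (fun _ => 0) :=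
    { dh := da, dk := DA.poly _, dU := DA.const 1, dV := DA.const 0
      circ_U := fun w => by
        have hz : (w : ℂ) ^ (-ρ) * (w : ℂ) ^ (ρ - T) * (w : ℂ) ^ T = 1 := by
          rw [← zpow_natCast, ← zpow_add₀ w.coe_ne_zero, ← zpow_add₀ w.coe_ne_zero,
            neg_add_eq_sub, sub_sub_cancel_left, neg_add_cancel, zpow_zero]
        rw [Polynomial.eval_neg, eval_conjReflect hB]
        have e := hrA w ((w : ℂ) ^ (ρ - T) * ((w : ℂ) ^ T * conj (B.eval (w : ℂ))))
        linear_combination -hABc w - e - B.eval (w : ℂ) * conj (B.eval (w : ℂ)) * hz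
      circ_V := fun w => by
        have hz : (w : ℂ) ^ (-ρ) * (w : ℂ) ^ (ρ - T) = (w : ℂ) ^ (-(T : ℤ)) := by
          rw [← zpow_add₀ w.coe_ne_zero]; congr 1; ring
        have hT : conj ((w : ℂ) ^ T) = (w : ℂ) ^ (-(T : ℤ)) := by
          rw [← zpow_natCast, circle_conj_zpow]
        have e := hrA w ((w : ℂ) ^ (ρ - T) * A.eval (w : ℂ))
        rw [Polynomial.eval_neg, eval_conjReflect hB, map_neg, map_mul, Complex.conj_conj, hT]
        linear_combination -e - B.eval (w : ℂ) * A.eval (w : ℂ) * hz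
      dvd_U := fun z hz z0 => by
        have aE : AnalyticAt ℂ (fun w => E.eval w - B.eval w * w ^ (-ρ)) z :=
          (analyticAt_eval E z).sub ((analyticAt_eval B z).mul (analyticAt_zpow z0 _))
        have o1 : analyticOrderAt (fun z => A.eval z) z ≤
            analyticOrderAt (fun w => w ^ (-(T : ℤ)) * (conjReflect T A).eval w * A.eval w) z :=
          le_order_mul ((analyticAt_zpow z0 _).mul (analyticAt_eval _ z)) (analyticAt_eval A z)
            le_rfl
        have o2 : analyticOrderAt (fun z => A.eval z) z ≤ analyticOrderAt (fun w =>
            w ^ (ρ - T) * (conjReflect T B).eval w * (E.eval w - B.eval w * w ^ (-ρ))) z := by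
          rw [ho z hz]
          exact le_order_mul ((analyticAt_zpow z0 _).mul (analyticAt_eval _ z)) aE (hE z)
        refine (le_order_sub o1 o2).trans_eq (analyticOrderAt_congr ?_)
        filter_upwards [isOpen_ne.mem_nhds z0] with w hw
        have e1 : w ^ (-ρ) * w ^ (ρ - T) = w ^ (-(T : ℤ)) := by
          rw [← zpow_add₀ hw]; congr 1; ring
        have e2 : w ^ (-(T : ℤ)) * w ^ T = 1 := by
          rw [← zpow_natCast, ← zpow_add₀ hw]; simp
        rw [Polynomial.eval_neg]
        linear_combination w ^ (-(T : ℤ)) * key' w + e2 +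
          B.eval w * (conjReflect T B).eval w * e1
      dvd_V := fun z hz z0 => by
        refine (le_order_mul (f := fun w => -(E.eval w * w ^ (ρ - T)))
          ((analyticAt_eval E z).mul (analyticAt_zpow z0 _)).neg (analyticAt_eval A z)
          le_rfl).trans_eq (congrArg (analyticOrderAt · z) (funext fun w => ?_))
        ring
      V_zero := rfl
      unit := fun w => by
        have hT : (w : ℂ) ^ T * conj ((w : ℂ) ^ T) = 1 := by
          rw [map_pow, ← mul_pow, circle_mul_conj, one_pow]
        rw [Polynomial.eval_neg, eval_conjReflect hB, map_neg, map_mul, Complex.conj_conj]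
        linear_combination hABc w + B.eval (w : ℂ) * conj (B.eval (w : ℂ)) * hT
      pos := hA0 }
  obtain ⟨ω, h, k, U, V, hω, hT, -, S, hf⟩ := exists_pulse hM SD hr (SobolevLip.polynomial A) S₁
  refine ⟨ω, hω, hT, fun j hj => ?_, fun j hj => ?_⟩
  · rw [hf j, nsol_k_eq_zero SD S (fun z hz => ((S ρ).ext_circle S₁ SD hz).2.1) hj, zero_div,
      flip_zero]
  · rw [hf j, nsol_k_eq_zero_of_V SD S
      (fun z hz => ((S (ρ - T)).ext_circle S₂ SD hz).2.2.2) hj, zero_div, flip_zero]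

/-- Serves to make punctured neighbourhoods in the circle nonempty, so that limits along them are
unique. -/
theorem circle_nontrivial : Nontrivial Circle := ⟨1, Circle.exp Real.pi, fun h => by
  have := congrArg (fun w : Circle => (w : ℂ).re) h
  simp at this
  norm_num at this⟩

/-- A continuous reflection coefficient forces `A` to be free of zeros on the circle. -/
theorem eval_ne_zero_of_continuous {r : Circle → ℂ} (hr : Continuous r) {ρ : ℤ}
    {A B : Polynomial ℂ} (hA : A ≠ 0)
    (hAB : ∀ w : Circle, ‖A.eval (w : ℂ)‖ ^ 2 + ‖B.eval (w : ℂ)‖ ^ 2 = 1)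
    (hrr : ∀ w : Circle, r w = (w : ℂ) ^ (-ρ) * (B.eval (w : ℂ) / A.eval (w : ℂ)))
    (w : Circle) : A.eval (w : ℂ) ≠ 0 := by
  intro h0
  have := circle_nontrivial
  have hne : ∀ᶠ u : Circle in 𝓝[≠] w, A.eval (u : ℂ) ≠ 0 := by
    have hfin : {u : Circle | A.eval (u : ℂ) = 0}.Finite :=
      ((A.rootSet_finite ℂ).preimage (f := fun u : Circle => (u : ℂ))
        (Circle.coe_injective.injOn)).subset fun u hu => by
          rw [Set.mem_preimage, Polynomial.mem_rootSet]
          exact ⟨hA, by simpa using hu⟩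
    have h1 : ∀ᶠ u in 𝓝[≠] w, u ∉ {u : Circle | A.eval (u : ℂ) = 0} \ {w} :=
      nhdsWithin_le_nhds ((hfin.subset Set.sdiff_subset).isClosed.compl_mem_nhds (by simp))
    filter_upwards [h1, self_mem_nhdsWithin] with u hu hu' h
    exact hu ⟨h, hu'⟩
  have cA := (DA.poly A).continuous_circle
  have cB := (DA.poly B).continuous_circle
  have l1 : Tendsto (fun u : Circle => (u : ℂ) ^ ρ * r u * A.eval (u : ℂ)) (𝓝[≠] w)
      (𝓝 ((w : ℂ) ^ ρ * r w * A.eval (w : ℂ))) :=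
    (((continuous_circle_zpow ρ).mul hr).mul cA).continuousAt.tendsto.mono_left nhdsWithin_le_nhds
  have l2 : Tendsto (fun u : Circle => B.eval (u : ℂ)) (𝓝[≠] w) (𝓝 (B.eval (w : ℂ))) :=
    cB.continuousAt.tendsto.mono_left nhdsWithin_le_nhds
  -- By continuity w^ρ r A = B holds at the zeros of A too, where the quotient B/A carries no
  -- information. Then B would vanish as well, against |A|^2 + |B|^2 = 1.
  have e := tendsto_nhds_unique (l1.congr' (by
    filter_upwards [hne] with u hu
    have hz : (u : ℂ) ^ ρ * (u : ℂ) ^ (-ρ) = 1 := by rw [← zpow_add₀ u.coe_ne_zero]; simp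
    rw [hrr]
    field_simp
    linear_combination B.eval (u : ℂ) * hz)) l2
  rw [h0, mul_zero] at e
  have := hAB w
  rw [h0, ← e] at this
  simp at this

/-- Finite duration pulses; common powers of `w` in `A` and `B` are cancelled. -/
theorem exists_pulse_of_factor (hM : ∀ w, (M w).1 2 ≠ -1) (hr : SobolevLip (reflectionCoeff M))
    (ρ : ℤ) (T n : ℕ) {A B : Polynomial ℂ} (hA : (Polynomial.X ^ n * A).natDegree ≤ T)
    (hB : (Polynomial.X ^ n * B).natDegree ≤ T)
    (hAB : ∀ w : Circle, ‖(Polynomial.X ^ n * A).eval (w : ℂ)‖ ^ 2 +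
      ‖(Polynomial.X ^ n * B).eval (w : ℂ)‖ ^ 2 = 1)
    (hrr : ∀ w : Circle, reflectionCoeff M w = (w : ℂ) ^ (-ρ) *
      ((Polynomial.X ^ n * B).eval (w : ℂ) / (Polynomial.X ^ n * A).eval (w : ℂ)))
    (hA0 : A.eval 0 ≠ 0) (hB0 : B.eval 0 = 0) :
    ∃ ω : ℤ → ℂ, IsHardPulse ω ∧ TransformsTo ω M ∧
      (∀ j, ρ ≤ j → ω j = 0) ∧ (∀ j, j < ρ - T → ω j = 0) := by
  have hX : (Polynomial.X ^ n : Polynomial ℂ) ≠ 0 := pow_ne_zero _ Polynomial.X_ne_zero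
  have deg : ∀ {P : Polynomial ℂ}, (Polynomial.X ^ n * P).natDegree ≤ T → P.natDegree ≤ T := by
    intro P hP
    by_cases h : P = 0
    · simp [h]
    · exact (Polynomial.natDegree_le_of_dvd (Dvd.intro_left _ rfl) (mul_ne_zero hX h)).trans hP
  have hA' : A ≠ 0 := fun h => hA0 (by simp [h])
  have nz := eval_ne_zero_of_continuous hr.1 (mul_ne_zero hX hA') hAB hrr
  -- A unimodular constant makes A positive at the origin; it changes neither B/A nor the moduli.
  obtain ⟨c, hc, t, ht, hct⟩ : ∃ c : ℂ, ‖c‖ = 1 ∧ ∃ t : ℝ, 0 < t ∧ c * A.eval 0 = t := by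
    have hn : (‖A.eval 0‖ : ℂ) ≠ 0 := by exact_mod_cast norm_ne_zero_iff.2 hA0
    refine ⟨conj (A.eval 0) / ‖A.eval 0‖, ?_, ‖A.eval 0‖, norm_pos_iff.2 hA0, ?_⟩
    · rw [norm_div, RCLike.norm_conj, Complex.norm_real, norm_norm,
        div_self (norm_ne_zero_iff.2 hA0)]
    · rw [div_mul_eq_mul_div, Complex.conj_mul', div_eq_iff hn, sq]
  have hc0 : c ≠ 0 := fun h => by simp [h] at hc
  have nw : ∀ (w : Circle) (P : Polynomial ℂ),
      ‖(Polynomial.C c * P).eval (w : ℂ)‖ = ‖(Polynomial.X ^ n * P).eval (w : ℂ)‖ := by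
    intro w P
    rw [Polynomial.eval_mul, Polynomial.eval_mul, Polynomial.eval_pow, Polynomial.eval_X,
      Polynomial.eval_C, norm_mul, norm_mul, norm_pow, w.norm_coe, hc, one_pow]
  refine exists_pulse_of_pos hM hr ρ T (A := Polynomial.C c * A) (B := Polynomial.C c * B)
    ((Polynomial.natDegree_C_mul_le _ _).trans (deg hA))
    ((Polynomial.natDegree_C_mul_le _ _).trans (deg hB)) (fun w => ?_) (fun w => ?_)
    (fun w => ?_) ⟨t, ht, by simpa using hct⟩ (by simp [hB0])
  · rw [nw, nw]; exact hAB w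
  · rw [hrr]
    simp only [Polynomial.eval_mul, Polynomial.eval_pow, Polynomial.eval_X, Polynomial.eval_C]
    rw [mul_div_mul_left _ _ (pow_ne_zero n w.coe_ne_zero), mul_div_mul_left _ _ hc0]
  · rw [← norm_ne_zero_iff, nw, norm_ne_zero_iff]
    exact nz w

/-- If `A = 0`, the reflection coefficient vanishes and there is nothing to do. -/
theorem exists_pulse_of_zero (hM : ∀ w, (M w).1 2 ≠ -1) (hr : SobolevLip (reflectionCoeff M))
    (ρ : ℤ) (T : ℕ) (h0 : ∀ w, reflectionCoeff M w = 0) :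
    ∃ ω : ℤ → ℂ, IsHardPulse ω ∧ TransformsTo ω M ∧
      (∀ j, ρ ≤ j → ω j = 0) ∧ (∀ j, j < ρ - T → ω j = 0) :=
  exists_pulse_of_factor hM hr ρ T 0 (A := 1) (B := 0) (by simp) (by simp) (by simp)
    (fun w => by simp [h0]) (by simp) (by simp)

theorem exists_pulse_duration (hM : ∀ w, (M w).1 2 ≠ -1) (hr : SobolevLip (reflectionCoeff M))
    (ρ : ℤ) (T : ℕ) {A B : Polynomial ℂ} (hA : A.natDegree ≤ T) (hB : B.natDegree ≤ T)
    (hAB : ∀ w : Circle, ‖A.eval (w : ℂ)‖ ^ 2 + ‖B.eval (w : ℂ)‖ ^ 2 = 1)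
    (hrr : ∀ w : Circle, reflectionCoeff M w =
      (w : ℂ) ^ (-ρ) * (B.eval (w : ℂ) / A.eval (w : ℂ)))
    (lim : Tendsto (fun w : ℂ => B.eval w / A.eval w) (𝓝[≠] 0) (𝓝 0)) :
    ∃ ω : ℤ → ℂ, IsHardPulse ω ∧ TransformsTo ω M ∧
      (∀ j, ρ ≤ j → ω j = 0) ∧ (∀ j, j < ρ - T → ω j = 0) := by
  by_cases hA0 : A = 0
  -- Division by zero gives 0, so A = 0 means r = 0.
  · exact exists_pulse_of_zero hM hr ρ T fun w => by rw [hrr, hA0]; simp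
  obtain ⟨A₁, eA, nA⟩ := A.exists_eq_pow_rootMultiplicity_mul_and_not_dvd hA0 0
  rw [map_zero, sub_zero] at eA nA
  set n := A.rootMultiplicity 0
  rw [Polynomial.X_dvd_iff, Polynomial.coeff_zero_eq_eval_zero] at nA
  obtain ⟨B₁, eB, zB⟩ : ∃ B₁ : Polynomial ℂ, B = Polynomial.X ^ n * B₁ ∧ B₁.eval 0 = 0 := by
    by_cases hB0 : B = 0
    · exact ⟨0, by simp [hB0], by simp⟩
    obtain ⟨B₂, eB, nB⟩ := B.exists_eq_pow_rootMultiplicity_mul_and_not_dvd hB0 0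
    rw [map_zero, sub_zero] at eB nB
    set l := B.rootMultiplicity 0
    rw [Polynomial.X_dvd_iff, Polynomial.coeff_zero_eq_eval_zero] at nB
    -- If B vanished at 0 to order at most n, then multiplying B/A by w^(n - l) A₁ would give B₂,
    -- whose value at 0 would be zero.
    have hnl : n < l := by
      by_contra! hln
      apply nB
      have l1 : Tendsto (fun w : ℂ => B.eval w / A.eval w * (w ^ (n - l) * A₁.eval w)) (𝓝[≠] 0)
          (𝓝 (0 * ((0 : ℂ) ^ (n - l) * A₁.eval 0))) := by
        have hcont : Continuous fun w : ℂ => w ^ (n - l) * A₁.eval w :=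
          (continuous_pow _).mul A₁.continuous
        exact lim.mul (hcont.continuousAt.tendsto.mono_left nhdsWithin_le_nhds)
      have l2 : Tendsto (fun w : ℂ => B₂.eval w) (𝓝[≠] 0) (𝓝 (B₂.eval 0)) :=
        B₂.continuous.continuousAt.tendsto.mono_left nhdsWithin_le_nhds
      rw [zero_mul] at l1
      refine tendsto_nhds_unique l2 (l1.congr' ?_)
      have hne : ∀ᶠ w in 𝓝[≠] (0 : ℂ), A₁.eval w ≠ 0 :=
        nhdsWithin_le_nhds (A₁.continuous.continuousAt.eventually_ne nA)
      filter_upwards [hne, self_mem_nhdsWithin] with w hw hw0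
      have hw0 : w ≠ 0 := hw0
      rw [eB, eA]
      simp only [Polynomial.eval_mul, Polynomial.eval_pow, Polynomial.eval_X]
      have hp : w ^ n = w ^ l * w ^ (n - l) := by rw [← pow_add, Nat.add_sub_cancel' hln]
      rw [hp]
      field_simp
    refine ⟨Polynomial.X ^ (l - n) * B₂, ?_, ?_⟩
    · rw [eB, ← mul_assoc, ← pow_add, Nat.add_sub_cancel' hnl.le]
    · simp only [Polynomial.eval_mul, Polynomial.eval_pow, Polynomial.eval_X]
      rw [zero_pow (by omega), zero_mul]
  rw [eA] at hA hAB hrr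
  rw [eB] at hB hAB hrr
  exact exists_pulse_of_factor hM hr ρ T n hA hB hAB hrr nA zB

/-- Replacing B by w B, ρ by ρ + 1 and T by T + 1 leaves r unchanged and makes B vanish at the
origin. This must survive cancelling the power w^n in A, so w^n has to divide B. Indeed w^n divides
w^T - A A~ = B B~, where ~ is `conjReflect T`, and B~ has nonzero constant term because B has degree
exactly T. -/
theorem exists_pulse_closed_duration (hM : ∀ w, (M w).1 2 ≠ -1)
    (hr : SobolevLip (reflectionCoeff M)) (ρ : ℤ) (T : ℕ) {A B : Polynomial ℂ}
    (hA : A.natDegree = T) (hB : B.natDegree = T)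
    (hAB : ∀ w : Circle, ‖A.eval (w : ℂ)‖ ^ 2 + ‖B.eval (w : ℂ)‖ ^ 2 = 1)
    (hrr : ∀ w : Circle, reflectionCoeff M w =
      (w : ℂ) ^ (-ρ) * (B.eval (w : ℂ) / A.eval (w : ℂ))) :
    ∃ ω : ℤ → ℂ, IsHardPulse ω ∧ TransformsTo ω M ∧
      (∀ j, ρ < j → ω j = 0) ∧ (∀ j, j < ρ - T → ω j = 0) := by
  suffices ∃ ω : ℤ → ℂ, IsHardPulse ω ∧ TransformsTo ω M ∧
      (∀ j, ρ + 1 ≤ j → ω j = 0) ∧ (∀ j, j < ρ + 1 - (T + 1 : ℕ) → ω j = 0) by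
    obtain ⟨ω, h1, h2, h3, h4⟩ := this
    exact ⟨ω, h1, h2, fun j hj => h3 j hj, fun j hj => h4 j (by push_cast; omega)⟩
  by_cases hA0 : A = 0
  · exact exists_pulse_of_zero hM hr _ _ fun w => by rw [hrr, hA0]; simp
  obtain ⟨A₁, eA, nA⟩ := A.exists_eq_pow_rootMultiplicity_mul_and_not_dvd hA0 0
  rw [map_zero, sub_zero] at eA nA
  have hnT : A.rootMultiplicity 0 ≤ T := by
    have := Polynomial.natDegree_le_of_dvd (p := Polynomial.X ^ A.rootMultiplicity 0)
      (Dvd.intro _ eA.symm) hA0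
    rwa [Polynomial.natDegree_X_pow, hA] at this
  set n := A.rootMultiplicity 0
  rw [Polynomial.X_dvd_iff, Polynomial.coeff_zero_eq_eval_zero] at nA
  have hdvd : Polynomial.X ^ n ∣ B := by
    by_cases hB0 : B = 0
    · simp [hB0]
    refine Polynomial.prime_X.pow_dvd_of_dvd_mul_right n (b := conjReflect T B) ?_ ?_
    · rw [Polynomial.X_dvd_iff, coeff_zero_conjReflect, ← hB]
      simpa using hB0
    · have key := mul_conjReflect_add hA.le hB.le hAB
      have e : B * conjReflect T B = Polynomial.X ^ T - A * conjReflect T A := by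
        rw [← key]; ring
      rw [e]
      exact dvd_sub (pow_dvd_pow _ hnT) (Dvd.dvd.mul_right (Dvd.intro _ eA.symm) _)
  obtain ⟨B₁, eB⟩ := hdvd
  have eB' : Polynomial.X ^ n * (Polynomial.X * B₁) = Polynomial.X * B := by rw [eB]; ring
  refine exists_pulse_of_factor hM hr (ρ + 1) (T + 1) n (A := A₁) (B := Polynomial.X * B₁)
    ?_ ?_ (fun w => ?_) (fun w => ?_) nA (by simp)
  · rw [← eA]; omega
  · rw [eB']
    refine (Polynomial.natDegree_mul_le).trans ?_
    rw [Polynomial.natDegree_X]; omega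
  · rw [← eA, eB', Polynomial.eval_mul, Polynomial.eval_X, norm_mul, w.norm_coe, one_mul]
    exact hAB w
  · rw [← eA, eB', Polynomial.eval_mul, Polynomial.eval_X, hrr, neg_add, zpow_add₀ w.coe_ne_zero,
      zpow_neg_one]
    have hw := w.coe_ne_zero
    field_simp

end HardPulse

end

theorem mainTheorem1
    (M : Circle → Metric.sphere (0 : EuclideanSpace ℝ (Fin 3)) 1)
    (hM : ∀ w, (M w).1 2 ≠ -1)
    (hr : HardPulse.MemH1 (HardPulse.reflectionCoeff M)) :
    -- (a) infinitely many hard pulses, in bijection with the bound state data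
    ({ω : ℤ → ℂ | HardPulse.IsHardPulse ω ∧ HardPulse.TransformsTo ω M}.Infinite ∧
      (∀ D : HardPulse.BoundStateData,
        ∃! ω : ℤ → ℂ, HardPulse.IsHardPulse ω ∧ HardPulse.TransformsTo ω M ∧
          HardPulse.HasBoundStateData ω D) ∧
      (∀ ω : ℤ → ℂ, HardPulse.IsHardPulse ω → HardPulse.TransformsTo ω M →
        ∃! D : HardPulse.BoundStateData, HardPulse.HasBoundStateData ω D)) ∧
    -- (b) finitely many rephasing time steps
    (∀ (ρ : ℤ) (r₀ : ℂ → ℂ),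
      MeromorphicOn r₀ (Metric.ball 0 1) →
      (∀ w : Circle, ContinuousWithinAt r₀ (Metric.ball 0 1) w) →
      Filter.Tendsto r₀ (nhdsWithin 0 {0}ᶜ) (nhds 0) →
      (∀ w : Circle, HardPulse.reflectionCoeff M w = (w : ℂ) ^ (-ρ) * r₀ w) →
      ∃ ω : ℤ → ℂ, HardPulse.IsHardPulse ω ∧ HardPulse.TransformsTo ω M ∧
        ∀ j, ρ ≤ j → ω j = 0) ∧
    -- (c) finite duration
    (∀ (ρ : ℤ) (T : ℕ) (A B : Polynomial ℂ),
      (∀ w : Circle, ‖A.eval (w : ℂ)‖ ^ 2 + ‖B.eval (w : ℂ)‖ ^ 2 = 1) →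
      (∀ w : Circle, HardPulse.reflectionCoeff M w =
        (w : ℂ) ^ (-ρ) * (B.eval (w : ℂ) / A.eval (w : ℂ))) →
      -- `B / A` vanishes at the origin: pulse at the `T` time steps `ρ - T ≤ j < ρ`
      (A.natDegree ≤ T → B.natDegree ≤ T →
        Filter.Tendsto (fun w : ℂ => B.eval w / A.eval w) (nhdsWithin 0 {0}ᶜ) (nhds 0) →
        ∃ ω : ℤ → ℂ, HardPulse.IsHardPulse ω ∧ HardPulse.TransformsTo ω M ∧
          (∀ j, ρ ≤ j → ω j = 0) ∧ (∀ j, j < ρ - T → ω j = 0)) ∧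
      -- no condition at the origin: pulse supported in the closed interval `ρ - T ≤ j ≤ ρ`
      (A.natDegree = T → B.natDegree = T →
        ∃ ω : ℤ → ℂ, HardPulse.IsHardPulse ω ∧ HardPulse.TransformsTo ω M ∧
          (∀ j, ρ < j → ω j = 0) ∧ (∀ j, j < ρ - T → ω j = 0))) := by
  have hs := hr.sobolevLip
  refine ⟨⟨HardPulse.infinite_pulses hM hs, HardPulse.existsUnique_pulse hM hs,
    fun ω hω hT => HardPulse.existsUnique_data hM hω hT⟩,
    fun ρ r₀ hm hc h0 hrr => HardPulse.exists_pulse_rephasing hM hs ρ hm hc h0 hrr,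
    fun ρ T A B hAB hrr => ⟨fun hA hB lim =>
      HardPulse.exists_pulse_duration hM hs ρ T hA hB hAB hrr lim, fun hA hB =>
      HardPulse.exists_pulse_closed_duration hM hs ρ T hA hB hAB hrr⟩⟩
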